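/- Let $d\ge 4$ and $n\ge 2$, and let $F\in\mathbb C[z_1,\dots,z_d]$ be homogeneous of degree $n$ such that the projective hypersurface $X=\{F=0\}\subset\mathbb P^{d-1}(\mathbb C)$ is smooth (at every $z\ne 0$ with $F(z)=0$ some partial derivative of $F$ is nonzero). Let the homogeneous coordinates $\xi=(\xi_1,\dots,\xi_d)$ of a point of $X$ be expressed through uniformizing parameters $t=(t_1,\dots,t_{d-1})$; that is, let $D\subset\mathbb C^{d-1}$ be a nonempty open set and $\xi:D\to\mathbb C^d\setminus\{0\}$ a holomorphic map with $F(\xi(t))=0$ such that, for every $t\in D$, the vectors $\xi(t),\partial\xi/\partial t_1(t),\dots,\partial\xi/\partial t_{d-1}(t)$ span a space of dimension $d-1$ (equivalently, $t\mapsto[\xi(t)]$ is a submersion into $X$; for instance, $\xi$ may be a local chart of the cone over $X$). Let $V$ be a complex-valued real-analytic function on an open set $\Omega\subset\mathbb R^d$ with $$F\Big(\frac{\partial}{\partial x_1},\dots,\frac{\partial}{\partial x_d}\Big)V=0\quad\text{on }\Omega .$$ Then every point $p\in\Omega$ has an open neighbourhood $U\subset\Omega$ for which there are a compact $(d-1)$-dimensional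 cuboid $S=\{c+s: s\in\mathbb R^{d-1},\ 0\le s_j\le r_j\}\subset D$, with $c\in\mathbb C^{d-1}$ and all $r_j>0$, and a function $\Phi$ of $1+(d-1)$ complex variables, holomorphic in a neighbourhood of every point $(\xi_1(t)x_1+\dots+\xi_d(t)x_d,\ t)$ with $x\in U$ and $t\in S$, such that for all $x\in U$ $$V(x)=\int_S\Phi\big(\xi_1(t)x_1+\dots+\xi_d(t)x_d,\ t_1,\dots,t_{d-1}\big)\,dt_1\cdots dt_{d-1}.$$ -/

import Mathlib

open MeasureTheory

noncomputable section

namespace PlaneWave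

/-- The partial derivative `∂f/∂xᵢ` of a complex-valued function on `ℝᵈ`. -/
def partialDeriv {d : ℕ} (i : Fin d) (f : (Fin d → ℝ) → ℂ) : (Fin d → ℝ) → ℂ :=
  fun x => lineDeriv ℝ f x (Pi.single i 1)

/-- The iterated partial derivative `∂^α f = ∂₁^α₁ ⋯ ∂_d^α_d f`. -/
def iteratedPartial {d : ℕ} (α : Fin d →₀ ℕ) (f : (Fin d → ℝ) → ℂ) : (Fin d → ℝ) → ℂ :=
  (List.finRange d).foldr (fun i g => (partialDeriv i)^[α i] g) f

/-- The constant-coefficient differential operator `F(∂/∂x₁, …, ∂/∂x_d)` applied to `f`. -/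
def diffOp {d : ℕ} (F : MvPolynomial (Fin d) ℂ) (f : (Fin d → ℝ) → ℂ) : (Fin d → ℝ) → ℂ :=
  fun x => ∑ α ∈ F.support, F.coeff α * iteratedPartial α f x

/-- The projective hypersurface `{F = 0}` of a homogeneous polynomial `F` is smooth: the partial
derivatives of `F` have no common zero on it. -/
def IsSmoothHypersurface {d : ℕ} (F : MvPolynomial (Fin d) ℂ) : Prop :=
  ∀ z : Fin d → ℂ, z ≠ 0 → MvPolynomial.eval z F = 0 →
    ∃ i, MvPolynomial.eval z (MvPolynomial.pderiv i F) ≠ 0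

/-- `ξ₁, …, ξ_d`, as holomorphic functions of `t₁, …, t_{d-1}` on the nonempty open set `D`, are
homogeneous coordinates of a point of the hypersurface `{F = 0}` which is locally uniformized by
these parameters: `t ↦ [ξ(t)]` is a submersion onto an open part of the hypersurface. Because the
cone over the hypersurface has dimension `d - 1`, this says that `ξ(t)` and the vectors
`∂ξ/∂tⱼ(t)` together span a space of dimension `d - 1`. In particular, local charts of the cone
are of this form. -/
structure IsUniformization {d : ℕ} (F : MvPolynomial (Fin d) ℂ) (D : Set (Fin (d - 1) → ℂ))
    (ξ : (Fin (d - 1) → ℂ) → (Fin d → ℂ)) : Prop where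
  isOpen : IsOpen D
  nonempty : D.Nonempty
  analytic : AnalyticOnNhd ℂ ξ D
  ne_zero : ∀ t ∈ D, ξ t ≠ 0
  mem_hypersurface : ∀ t ∈ D, MvPolynomial.eval (ξ t) F = 0
  finrank_tangent : ∀ t ∈ D,
    Module.finrank ℂ ↥(Submodule.span ℂ {ξ t} ⊔ (fderiv ℂ ξ t).range) = d - 1

/-- The linear form `ξ₁x₁ + ⋯ + ξ_dx_d` at a real point `x`. -/
def linForm {d : ℕ} (ξ : Fin d → ℂ) (x : Fin d → ℝ) : ℂ :=
  ∑ i, ξ i * (x i : ℂ)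

/-- The point `c + s` of `ℂᵏ`, for `c ∈ ℂᵏ` and a real vector `s`. -/
def shift {k : ℕ} (c : Fin k → ℂ) (s : Fin k → ℝ) : Fin k → ℂ :=
  fun j => c j + (s j : ℂ)

/-- The compact `k`-dimensional cuboid `{c + s : 0 ≤ sⱼ ≤ rⱼ}` in `ℂᵏ`. -/
def cuboid {k : ℕ} (c : Fin k → ℂ) (r : Fin k → ℝ) : Set (Fin k → ℂ) :=
  shift c '' Set.Icc 0 r

/-- The integral of the form `g(t) dt₁ ⋯ dt_k` over the cuboid `cuboid c r`. -/
def cuboidIntegral {k : ℕ} (c : Fin k → ℂ) (r : Fin k → ℝ) (g : (Fin k → ℂ) → ℂ) : ℂ :=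
  ∫ s in Set.Icc (0 : Fin k → ℝ) r, g (shift c s)

end PlaneWave

end

/-!
# Solutions of `F(∂) V = 0` as superpositions of plane waves

Write `X` for the cone `{F = 0}` in `ℂᵈ`, `t₀` for a point of `D`, `S` for a small cuboid around `t₀`
and `V(p + y) = ∑ₘ Vₘ(y)` for the Taylor expansion at `p`. The representation is found degree by
degree: a polynomial `Qₘ`, homogeneous of degree `m`, is wanted with
`Vₘ(y) = ∫_S conj(Qₘ(ξ(t))) (ξ(t)·y)ᵐ dt`, and with coefficients at most `Cᵐ⁺¹`. Then
`H = ∑ₘ conj(Qₘ)`, where the conjugation is applied to the coefficients, is holomorphic near the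
origin of `ℂᵈ`, and
`Φ(w, t) = H((w - ξ(t)·p) ξ*(t))` solves the problem, where `ξ*(t) = conj(ξ(c + conj(t - c)))` is the
holomorphic function that agrees with the conjugate of `ξ` on the cuboid with real edges at `c`.

The functional `ℓₘ(P) = P(∂)V(p) / m!` on homogeneous polynomials of degree `m` takes the value `Vₘ(y)`
at the `m`-th power of the linear form `y` (`diffOp_linear_pow`) and vanishes on the multiples of `F`
(`diffOp_mul_eq_zero`). By the Riesz representation theorem in `L²(S)`, `Qₘ` exists with an `L²` norm
at most `Cᵐ⁺¹` as soon as `|ℓₘ(P)| ≤ Cᵐ⁺¹ ‖P ∘ ξ‖` with the norm of `L²(S)`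
(`exists_polynomial_kernel`). This inequality, `exists_norm_diffOp_le`, and the bound for the
coefficients of `Qₘ` rest on two estimates for homogeneous polynomials `P` of degree `m`.

* *Reduction modulo `F`* (`exists_reduction`). There is `P'` with `P - P'` divisible by `F` whose
  maximum over the unit ball of `ℂᵈ` is at most `Cᵐ⁺¹` times the maximum of `P` over the part of `X`
  in the unit ball. It is the remainder of `P(z + Te)` on division by `F(z + Te)` as polynomials in
  `T`, at `T = 0`; Lagrange interpolation in the roots bounds it at generic `z`, and homogeneity
  carries the bound to the whole ball.

* *Comparison of norms on the cone* (`exists_norm_eval_le_of_isControlledAt`). The maximum of `P`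
  over the part of `X` in the unit ball is at most `Cᵐ⁺¹ ‖P ∘ ξ‖`. Near `ξ(t₀)`, a polynomial with
  maximum `1` is bounded by `Cᵐ⁺¹ ‖P ∘ ξ‖ ^ θ` for some `θ > 0`: the passage from the mean square to
  the maximum over a real cube, and from there to a complex neighbourhood of the cube
  (`norm_pow_le_integral_complex`), costs only a power, and the multiples of the points `ξ(t)` fill
  a neighbourhood of `ξ(t₀)` in `X` (`IsUniformization.eventually_eq_smul`). By the three circles
  inequality such an estimate propagates along `X \ {0}` (`IsControlledAt.propagate`), and `X \ {0}`
  is connected (`IsClopenSubcone.eq_puncturedCone`), so it holds everywhere on `X \ {0}`. Applied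
  to `P` divided by its maximum it becomes linear, as the exponent `θ` can then be removed.

Smoothness of the hypersurface is used for the separability of `F(z + Te)` at generic `z` and for the
charts of `X \ {0}`; the connectedness of `X \ {0}` needs `d ≥ 3`.
-/

namespace PlaneWave

open Filter Topology

/-! ### Interpolation inequalities for holomorphic functions of one variable -/

lemma norm_cosh_le (u : ℂ) : ‖Complex.cosh u‖ ≤ Real.cosh u.re := by
  rw [Complex.cosh, Real.cosh_eq, norm_div]
  have h := norm_add_le (Complex.exp u) (Complex.exp (-u))
  rw [Complex.norm_exp, Complex.norm_exp, Complex.neg_re] at h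
  simpa using div_le_div_of_nonneg_right h (by norm_num : (0 : ℝ) ≤ 2)

/-- A holomorphic function that is small on the real segment `[-1, 1]` is small at `I`: the map
`z ↦ cosh (Y z)` carries the strip `0 ≤ re z ≤ 1` to an ellipse with foci `±1`, and the three lines
theorem applies to the composition. -/
lemma norm_apply_I_le {f : ℂ → ℂ} {ε M : ℝ}
    (hf : DifferentiableOn ℂ f (Metric.ball 0 4))
    (hM : ∀ z ∈ Metric.ball (0 : ℂ) 4, ‖f z‖ ≤ M)
    (hε : ∀ x : ℝ, |x| ≤ 1 → ‖f x‖ ≤ ε) :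
    ‖f Complex.I‖ ≤ ε ^ (1 / 2 : ℝ) * M ^ (1 / 2 : ℝ) := by
  set Y : ℝ := 2 * Real.arsinh 1 with hY
  have ha : 0 < Real.arsinh 1 := Real.arsinh_pos_iff.2 one_pos
  have hY0 : 0 < Y := by positivity
  have hcY : Real.cosh Y = 3 := by
    rw [hY, Real.cosh_two_mul, Real.sinh_arsinh, Real.cosh_sq, Real.sinh_arsinh]; norm_num
  let φ : ℂ → ℂ := fun z => Complex.cosh (Y * z)
  have hφd : Differentiable ℂ φ := by
    intro z
    exact (Complex.differentiable_cosh _).comp z (by fun_prop)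
  have hφ : ∀ z : ℂ, z.re ∈ Set.Icc (0 : ℝ) 1 → φ z ∈ Metric.ball (0 : ℂ) 4 := by
    intro z hz
    rw [mem_ball_zero_iff]
    refine (norm_cosh_le _).trans_lt ?_
    have h1 : ((Y : ℂ) * z).re = Y * z.re := by simp
    rw [h1]
    have : Real.cosh (Y * z.re) ≤ Real.cosh Y := by
      rw [Real.cosh_le_cosh, abs_of_nonneg (mul_nonneg hY0.le hz.1), abs_of_pos hY0]
      exact mul_le_of_le_one_right hY0.le hz.2
    linarith
  have hmaps : Set.MapsTo φ (Complex.HadamardThreeLines.verticalClosedStrip 0 1)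
      (Metric.ball 0 4) := fun z hz => hφ z hz
  have hd : DifferentiableOn ℂ (f ∘ φ) (Complex.HadamardThreeLines.verticalClosedStrip 0 1) :=
    hf.comp hφd.differentiableOn hmaps
  have hdc : DiffContOnCl ℂ (f ∘ φ) (Complex.HadamardThreeLines.verticalStrip 0 1) := by
    refine DifferentiableOn.diffContOnCl (hd.mono ?_)
    refine closure_minimal ?_ ?_
    · intro z hz
      exact Set.Ioo_subset_Icc_self hz
    · exact isClosed_Icc.preimage Complex.continuous_re
  set z₀ : ℂ := ((1 / 2 : ℝ) : ℂ) + (((Real.pi / 2) / Y : ℝ) : ℂ) * Complex.I with hz₀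
  have hre : z₀.re = 1 / 2 := by simp [hz₀]
  have hval : φ z₀ = Complex.I := by
    have h1 : (Y : ℂ) * z₀ = ((Real.arsinh 1 : ℝ) : ℂ) + ((Real.pi / 2 : ℝ) : ℂ) * Complex.I := by
      have hYc : (Y : ℂ) ≠ 0 := by exact_mod_cast hY0.ne'
      rw [hz₀, hY] at *
      push_cast at *
      field_simp
    change Complex.cosh ((Y : ℂ) * z₀) = _
    rw [h1, Complex.cosh_add, Complex.cosh_mul_I, Complex.sinh_mul_I, ← Complex.ofReal_cos,
      ← Complex.ofReal_sin, Real.cos_pi_div_two, Real.sin_pi_div_two, ← Complex.ofReal_sinh,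
      Real.sinh_arsinh]
    simp
  have key := Complex.HadamardThreeLines.norm_le_interp_of_mem_verticalClosedStrip₀₁' (f ∘ φ)
    (z := z₀) (a := ε) (b := M) ?_ hdc ?_ ?_ ?_
  · rw [hre] at key
    simp only [Function.comp, hval] at key
    norm_num at key ⊢
    exact key
  · change z₀.re ∈ Set.Icc (0 : ℝ) 1
    rw [hre]; norm_num
  · refine ⟨M, ?_⟩
    rintro _ ⟨z, hz, rfl⟩
    exact hM _ (hφ z hz)
  · intro z hz
    have hz' : z.re = 0 := hz
    have : φ z = ((Real.cos (Y * z.im) : ℝ) : ℂ) := by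
      have : (Y : ℂ) * z = ((Y * z.im : ℝ) : ℂ) * Complex.I := by
        apply Complex.ext <;> simp [hz']
      change Complex.cosh ((Y : ℂ) * z) = _
      rw [this, Complex.cosh_mul_I, Complex.ofReal_cos]
    simp only [Function.comp, this]
    exact hε _ (Real.abs_cos_le_one _)
  · intro z hz
    have hz' : z.re = 1 := hz
    exact hM _ (hφ z (by rw [hz']; norm_num))

/-- The three circles inequality for the circles of radii `δ < 1 < 2`: the map `z ↦ δ exp (L z)` with
`L = log (2 / δ)` carries the strip `0 ≤ re z ≤ 1` onto the annulus between the outer two. -/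
lemma exists_three_circles {δ : ℝ} (hδ : 0 < δ) (hδ1 : δ < 1) :
    ∃ σ : ℝ, 0 < σ ∧ σ < 1 ∧ ∀ (f : ℂ → ℂ) (ε M : ℝ),
      DifferentiableOn ℂ f (Metric.ball 0 3) → (∀ z ∈ Metric.ball (0 : ℂ) 3, ‖f z‖ ≤ M) →
      (∀ z : ℂ, ‖z‖ ≤ δ → ‖f z‖ ≤ ε) → ‖f 1‖ ≤ ε ^ (1 - σ) * M ^ σ := by
  set L : ℝ := Real.log (2 / δ) with hL
  have h2δ : 1 < 2 / δ := by rw [lt_div_iff₀ hδ]; linarith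
  have hL0 : 0 < L := Real.log_pos h2δ
  have hl : 0 < Real.log (1 / δ) := Real.log_pos (by rw [lt_div_iff₀ hδ]; linarith)
  have hlL : Real.log (1 / δ) < L :=
    Real.log_lt_log (by positivity) (by gcongr; norm_num)
  refine ⟨Real.log (1 / δ) / L, by positivity, (div_lt_one hL0).2 hlL, ?_⟩
  intro f ε M hf hM hε
  let φ : ℂ → ℂ := fun z => δ * Complex.exp (L * z)
  have hφd : Differentiable ℂ φ := by
    intro z
    fun_prop
  have hφn : ∀ z : ℂ, ‖φ z‖ = δ * Real.exp (L * z.re) := by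
    intro z
    simp [φ, Complex.norm_exp, abs_of_pos hδ]
  have hexpL : Real.exp L = 2 / δ := Real.exp_log (by positivity)
  have hφ : ∀ z : ℂ, z.re ∈ Set.Icc (0 : ℝ) 1 → φ z ∈ Metric.ball (0 : ℂ) 3 := by
    intro z hz
    rw [mem_ball_zero_iff, hφn]
    have : Real.exp (L * z.re) ≤ Real.exp L :=
      Real.exp_le_exp.2 (mul_le_of_le_one_right hL0.le hz.2)
    rw [hexpL] at this
    calc δ * Real.exp (L * z.re) ≤ δ * (2 / δ) := by gcongr
      _ = 2 := by field_simp
      _ < 3 := by norm_num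
  have hd : DifferentiableOn ℂ (f ∘ φ) (Complex.HadamardThreeLines.verticalClosedStrip 0 1) :=
    hf.comp hφd.differentiableOn fun z hz => hφ z hz
  have hdc : DiffContOnCl ℂ (f ∘ φ) (Complex.HadamardThreeLines.verticalStrip 0 1) := by
    refine DifferentiableOn.diffContOnCl (hd.mono ?_)
    refine closure_minimal ?_ ?_
    · intro z hz
      exact Set.Ioo_subset_Icc_self hz
    · exact isClosed_Icc.preimage Complex.continuous_re
  set z₀ : ℂ := ((Real.log (1 / δ) / L : ℝ) : ℂ) with hz₀
  have hre : z₀.re = Real.log (1 / δ) / L := by simp [hz₀]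
  have hval : φ z₀ = 1 := by
    have h1 : (L : ℂ) * z₀ = ((Real.log (1 / δ) : ℝ) : ℂ) := by
      rw [hz₀, ← Complex.ofReal_mul, mul_div_cancel₀ _ hL0.ne']
    change (δ : ℂ) * Complex.exp ((L : ℂ) * z₀) = 1
    rw [h1, ← Complex.ofReal_exp, Real.exp_log (by positivity), ← Complex.ofReal_mul]
    rw [mul_one_div_cancel hδ.ne']; simp
  have key := Complex.HadamardThreeLines.norm_le_interp_of_mem_verticalClosedStrip₀₁' (f ∘ φ)
    (z := z₀) (a := ε) (b := M) ?_ hdc ?_ ?_ ?_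
  · rw [hre] at key
    simpa only [Function.comp, hval] using key
  · change z₀.re ∈ Set.Icc (0 : ℝ) 1
    rw [hre]
    exact ⟨by positivity, ((div_lt_one hL0).2 hlL).le⟩
  · refine ⟨M, ?_⟩
    rintro _ ⟨z, hz, rfl⟩
    exact hM _ (hφ z hz)
  · intro z hz
    have hz' : z.re = 0 := hz
    refine hε _ ?_
    rw [hφn, hz']; simp
  · intro z hz
    have hz' : z.re = 1 := hz
    exact hM _ (hφ z (by rw [hz']; norm_num))

/-! ### Coefficients of polynomials bounded on a polydisc -/

/-- By Parseval's identity, a bound on the unit circle bounds each coefficient. -/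
lemma norm_coeff_le_of_norm_eval_le (p : Polynomial ℂ) {K : ℝ}
    (h : ∀ z : ℂ, ‖z‖ = 1 → ‖p.eval z‖ ≤ K) (k : ℕ) : ‖p.coeff k‖ ≤ K := by
  have hK : 0 ≤ K := (norm_nonneg _).trans (h 1 (by simp))
  by_cases hk : k ∈ p.support
  · have h1 : ‖p.coeff k‖ ^ 2 ≤ K ^ 2 := by
      refine (Finset.single_le_sum (f := fun i => ‖p.coeff i‖ ^ 2)
        (fun i _ => by positivity) hk).trans ?_
      rw [p.sum_sq_norm_coeff_eq_circleAverage]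
      refine Real.circleAverage_mono_on_of_le_circle ?_ ?_
      · apply ContinuousOn.circleIntegrable'
        fun_prop
      · intro z hz
        have : ‖z‖ = 1 := by simpa using hz
        have := h z this
        gcongr
    exact abs_le_of_sq_le_sq' h1 hK |>.2
  · rw [Polynomial.notMem_support_iff.1 hk]; simpa using hK

lemma norm_mvCoeff_le_of_norm_eval_le : ∀ {d : ℕ} (P : MvPolynomial (Fin d) ℂ) {K : ℝ}
    (_ : ∀ z : Fin d → ℂ, ‖z‖ ≤ 1 → ‖MvPolynomial.eval z P‖ ≤ K) (α : Fin d →₀ ℕ),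
    ‖P.coeff α‖ ≤ K := by
  intro d
  induction d with
  | zero =>
    intro P K h α
    have h0 := h 0 (by rw [norm_zero]; exact zero_le_one)
    rw [MvPolynomial.eq_C_of_isEmpty P] at h0 ⊢
    rw [Subsingleton.elim α 0]
    simpa using h0
  | succ d ih =>
    intro P K h α
    rw [← Finsupp.cons_tail α, ← MvPolynomial.finSuccEquiv_coeff_coeff]
    refine ih _ ?_ _
    intro z hz
    have := norm_coeff_le_of_norm_eval_le
      (Polynomial.map (MvPolynomial.eval z) (MvPolynomial.finSuccEquiv ℂ d P)) (K := K) ?_ (α 0)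
    · simpa using this
    · intro w hw
      rw [← MvPolynomial.eval_eq_eval_mv_eval']
      refine h _ ?_
      rw [pi_norm_le_iff_of_nonneg zero_le_one]
      intro i
      refine Fin.cases ?_ (fun j => ?_) i
      · simp [hw]
      · simpa using (norm_le_pi_norm z j).trans hz

/-! ### Evaluation of polynomials along lines -/

lemma hasFDerivAt_eval {d : ℕ} (P : MvPolynomial (Fin d) ℂ) (z : Fin d → ℂ) :
    HasFDerivAt (fun w => MvPolynomial.eval w P)
      (∑ i, MvPolynomial.eval z (MvPolynomial.pderiv i P) •
        (ContinuousLinearMap.proj i : (Fin d → ℂ) →L[ℂ] ℂ)) z := by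
  induction P using MvPolynomial.induction_on with
  | C a =>
    refine ((hasFDerivAt_const (𝕜 := ℂ) a z).congr_of_eventuallyEq
      (Filter.Eventually.of_forall fun w => by simp)).congr_fderiv ?_
    ext w; simp [sum_apply]
  | add P Q hP hQ =>
    refine ((hP.add hQ).congr_of_eventuallyEq
      (Filter.Eventually.of_forall fun w => by simp)).congr_fderiv ?_
    ext w
    simp only [add_apply, sum_apply, smul_apply, map_add, smul_eq_mul, ← Finset.sum_add_distrib,
      add_mul]
  | mul_X P j hP =>
    have hX : HasFDerivAt (fun w : Fin d → ℂ => w j)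
        (ContinuousLinearMap.proj j : (Fin d → ℂ) →L[ℂ] ℂ) z := hasFDerivAt_apply j z
    refine ((hP.mul hX).congr_of_eventuallyEq
      (Filter.Eventually.of_forall fun w => by simp)).congr_fderiv ?_
    ext w
    have h1 : ∀ x : Fin d, MvPolynomial.eval z (MvPolynomial.pderiv x (P * MvPolynomial.X j)) * w x =
        z j * (MvPolynomial.eval z (MvPolynomial.pderiv x P) * w x) +
        (if j = x then MvPolynomial.eval z P * w x else 0) := by
      intro x
      rw [Derivation.leibniz, MvPolynomial.pderiv_X]
      by_cases h : j = x
      · subst h; simp; ring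
      · simp [h]; ring
    simp only [add_apply, sum_apply, smul_apply, smul_eq_mul, ContinuousLinearMap.proj_apply, h1,
      Finset.sum_add_distrib, Finset.sum_ite_eq, Finset.mem_univ, if_true, ← Finset.mul_sum]
    ring

lemma hasStrictFDerivAt_eval {d : ℕ} (P : MvPolynomial (Fin d) ℂ) (z : Fin d → ℂ) :
    HasStrictFDerivAt (fun w => MvPolynomial.eval w P)
      (fderiv ℂ (fun w => MvPolynomial.eval w P) z) z :=
  (AnalyticOnNhd.eval_mvPolynomial P z (Set.mem_univ z)).hasStrictFDerivAt

lemma differentiable_eval {d : ℕ} (P : MvPolynomial (Fin d) ℂ) :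
    Differentiable ℂ (fun w : Fin d → ℂ => MvPolynomial.eval w P) :=
  fun z => (hasFDerivAt_eval P z).differentiableAt

lemma continuous_eval {d : ℕ} (P : MvPolynomial (Fin d) ℂ) :
    Continuous (fun w : Fin d → ℂ => MvPolynomial.eval w P) :=
  (differentiable_eval P).continuous

lemma IsSmoothHypersurface.fderiv_ne_zero {d : ℕ} {F : MvPolynomial (Fin d) ℂ}
    (hX : IsSmoothHypersurface F) {z : Fin d → ℂ} (hz : z ≠ 0) (hFz : MvPolynomial.eval z F = 0) :
    fderiv ℂ (fun w => MvPolynomial.eval w F) z ≠ 0 := by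
  obtain ⟨i, hi⟩ := hX z hz hFz
  intro h
  apply hi
  have := congrArg (fun L : (Fin d → ℂ) →L[ℂ] ℂ => L (Pi.single i 1)) h
  rw [(hasFDerivAt_eval F z).fderiv] at this
  simpa [sum_apply, Pi.single_apply] using this

lemma eval_smul_of_isHomogeneous {d m : ℕ} {P : MvPolynomial (Fin d) ℂ} (hP : P.IsHomogeneous m)
    (c : ℂ) (z : Fin d → ℂ) : MvPolynomial.eval (c • z) P = c ^ m * MvPolynomial.eval z P := by
  rw [MvPolynomial.eval_eq', MvPolynomial.eval_eq', Finset.mul_sum]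
  refine Finset.sum_congr rfl fun α hα => ?_
  have h1 : ∑ i, α i = m := by
    have := hP (MvPolynomial.mem_support_iff.1 hα)
    rw [Finsupp.weight_apply, Finsupp.sum_fintype] at this
    · simpa using this
    · simp
  have h2 : ∏ i, (c • z) i ^ α i = c ^ m * ∏ i, z i ^ α i := by
    simp only [Pi.smul_apply, smul_eq_mul, mul_pow, Finset.prod_mul_distrib]
    rw [Finset.prod_pow_eq_pow_sum, h1]
  rw [h2]; ring

/-- The polynomial `P (z + T e)` in `T`, whose coefficients are polynomials in `z`. -/
noncomputable def alongLine {d : ℕ} (e : Fin d → ℂ) :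
    MvPolynomial (Fin d) ℂ →ₐ[ℂ] Polynomial (MvPolynomial (Fin d) ℂ) :=
  MvPolynomial.aeval fun i =>
    Polynomial.C (MvPolynomial.X i) + Polynomial.C (MvPolynomial.C (e i)) * Polynomial.X

lemma eval_map_alongLine {d : ℕ} (e : Fin d → ℂ) (P : MvPolynomial (Fin d) ℂ) (z : Fin d → ℂ)
    (T : ℂ) : ((alongLine e P).map (MvPolynomial.eval z)).eval T = MvPolynomial.eval (z + T • e) P := by
  induction P using MvPolynomial.induction_on with
  | C a =>
    have : alongLine e (MvPolynomial.C a) = Polynomial.C (MvPolynomial.C a) := by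
      simp [alongLine, MvPolynomial.algebraMap_eq, Polynomial.algebraMap_apply]
    rw [this]; simp
  | add P Q hP hQ => simp [hP, hQ]
  | mul_X P j hP =>
    have hj : alongLine e (MvPolynomial.X j) = Polynomial.C (MvPolynomial.X j) +
        Polynomial.C (MvPolynomial.C (e j)) * Polynomial.X := by
      rw [alongLine, MvPolynomial.aeval_X]
    rw [map_mul, Polynomial.map_mul, Polynomial.eval_mul, hP, map_mul, hj]
    simp only [Polynomial.map_add, Polynomial.map_mul, Polynomial.map_C, Polynomial.map_X,
      MvPolynomial.eval_X, MvPolynomial.eval_C, Polynomial.eval_add, Polynomial.eval_mul,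
      Polynomial.eval_C, Polynomial.eval_X, Pi.add_apply, Pi.smul_apply, smul_eq_mul]
    ring

lemma coeff_zero_alongLine {d : ℕ} (e : Fin d → ℂ) (P : MvPolynomial (Fin d) ℂ) :
    (alongLine e P).coeff 0 = P := by
  refine MvPolynomial.funext fun z => ?_
  have := eval_map_alongLine e P z 0
  rw [← Polynomial.coeff_zero_eq_eval_zero, Polynomial.coeff_map] at this
  simpa using this

lemma natDegree_coeff_prod_linear {d : ℕ} (e : Fin d → ℂ) (α : Fin d →₀ ℕ) (s : Finset (Fin d)) :
    (∏ i ∈ s, (Polynomial.C (MvPolynomial.X i : MvPolynomial (Fin d) ℂ) +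
      Polynomial.C (MvPolynomial.C (e i)) * Polynomial.X) ^ α i).natDegree ≤ ∑ i ∈ s, α i ∧
    (∏ i ∈ s, (Polynomial.C (MvPolynomial.X i : MvPolynomial (Fin d) ℂ) +
      Polynomial.C (MvPolynomial.C (e i)) * Polynomial.X) ^ α i).coeff (∑ i ∈ s, α i) =
      MvPolynomial.C (∏ i ∈ s, e i ^ α i) := by
  classical
  induction s using Finset.induction_on with
  | empty => simp
  | insert i s hi ih =>
    rw [Finset.prod_insert hi, Finset.sum_insert hi, Finset.prod_insert hi]
    have hl : (Polynomial.C (MvPolynomial.X i : MvPolynomial (Fin d) ℂ) +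
        Polynomial.C (MvPolynomial.C (e i)) * Polynomial.X).natDegree ≤ 1 := by
      compute_degree
    have hc : (Polynomial.C (MvPolynomial.X i : MvPolynomial (Fin d) ℂ) +
        Polynomial.C (MvPolynomial.C (e i)) * Polynomial.X).coeff 1 = MvPolynomial.C (e i) := by
      simp [Polynomial.coeff_C]
    have hp := Polynomial.natDegree_pow_le_of_le (α i) hl
    rw [mul_one] at hp
    refine ⟨Polynomial.natDegree_mul_le_of_le hp ih.1, ?_⟩
    rw [Polynomial.coeff_mul_add_eq_of_natDegree_le hp ih.1, ih.2]
    have := Polynomial.coeff_pow_of_natDegree_le hl (m := α i)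
    rw [mul_one] at this
    rw [this, hc, map_mul, map_pow]

lemma alongLine_natDegree_coeff {d n : ℕ} {F : MvPolynomial (Fin d) ℂ} (hF : F.IsHomogeneous n)
    (e : Fin d → ℂ) : (alongLine e F).natDegree ≤ n ∧
      (alongLine e F).coeff n = MvPolynomial.C (MvPolynomial.eval e F) := by
  have hsum : alongLine e F = ∑ α ∈ F.support, Polynomial.C (MvPolynomial.C (F.coeff α)) *
      ∏ i, (Polynomial.C (MvPolynomial.X i : MvPolynomial (Fin d) ℂ) +
      Polynomial.C (MvPolynomial.C (e i)) * Polynomial.X) ^ α i := by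
    rw [alongLine, MvPolynomial.aeval_eq_eval₂Hom, MvPolynomial.coe_eval₂Hom,
      MvPolynomial.eval₂_eq']
    rfl
  have hdeg : ∀ α ∈ F.support, ∑ i, α i = n := by
    intro α hα
    have := hF (MvPolynomial.mem_support_iff.1 hα)
    rw [Finsupp.weight_apply, Finsupp.sum_fintype] at this
    · simpa using this
    · simp
  rw [hsum]
  constructor
  · refine Polynomial.natDegree_sum_le_of_forall_le _ _ fun α hα => ?_
    refine (Polynomial.natDegree_C_mul_le _ _).trans ?_
    have := (natDegree_coeff_prod_linear e α Finset.univ).1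
    rwa [hdeg α hα] at this
  · rw [Polynomial.finsetSum_coeff, MvPolynomial.eval_eq', map_sum]
    refine Finset.sum_congr rfl fun α hα => ?_
    have := (natDegree_coeff_prod_linear e α Finset.univ).2
    rw [hdeg α hα] at this
    rw [Polynomial.coeff_C_mul, this, map_mul]

/-- The restriction of `F` to the line `z + T e`, as a polynomial in `T`. -/
noncomputable def onLine {d : ℕ} (F : MvPolynomial (Fin d) ℂ) (e z : Fin d → ℂ) : Polynomial ℂ :=
  (alongLine e F).map (MvPolynomial.eval z)

lemma eval_onLine {d : ℕ} (F : MvPolynomial (Fin d) ℂ) (e z : Fin d → ℂ) (T : ℂ) :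
    (onLine F e z).eval T = MvPolynomial.eval (z + T • e) F :=
  eval_map_alongLine e F z T

lemma natDegree_onLine {d n : ℕ} {F : MvPolynomial (Fin d) ℂ} (hF : F.IsHomogeneous n)
    {e : Fin d → ℂ} (he : MvPolynomial.eval e F ≠ 0) (z : Fin d → ℂ) :
    (onLine F e z).natDegree = n := by
  refine Polynomial.natDegree_eq_of_le_of_coeff_ne_zero
    (Polynomial.natDegree_map_le.trans (alongLine_natDegree_coeff hF e).1) ?_
  rw [onLine, Polynomial.coeff_map, (alongLine_natDegree_coeff hF e).2]
  simpa using he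

lemma leadingCoeff_onLine {d n : ℕ} {F : MvPolynomial (Fin d) ℂ} (hF : F.IsHomogeneous n)
    {e : Fin d → ℂ} (he : MvPolynomial.eval e F ≠ 0) (z : Fin d → ℂ) :
    (onLine F e z).leadingCoeff = MvPolynomial.eval e F := by
  rw [Polynomial.leadingCoeff, natDegree_onLine hF he, onLine, Polynomial.coeff_map,
    (alongLine_natDegree_coeff hF e).2]
  simp

lemma onLine_ne_zero {d n : ℕ} {F : MvPolynomial (Fin d) ℂ} (hF : F.IsHomogeneous n)
    {e : Fin d → ℂ} (he : MvPolynomial.eval e F ≠ 0) (z : Fin d → ℂ) : onLine F e z ≠ 0 := by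
  intro h
  have := leadingCoeff_onLine hF he z
  rw [h] at this
  exact he (by simpa using this.symm)

/-- If the hypersurface of `F` is smooth, then `F (z + T e)` has no multiple factor as a polynomial in
`T` over `ℂ[z]`: all partial derivatives of `F` vanish at the zeros of a multiple factor. -/
lemma eq_one_of_mul_self_dvd_alongLine {d : ℕ} (hd : 2 ≤ d) {F : MvPolynomial (Fin d) ℂ}
    (hX : IsSmoothHypersurface F) {e : Fin d → ℂ}
    {p : Polynomial (MvPolynomial (Fin d) ℂ)} (hp : p.Monic) (h : p * p ∣ alongLine e F) :
    p = 1 := by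
  by_contra hp1
  have hdeg : p.natDegree ≠ 0 := fun h0 => hp1 ((Polynomial.Monic.natDegree_eq_zero hp).1 h0)
  obtain ⟨q, hq⟩ := h
  obtain ⟨z, hz⟩ : ∃ z : Fin d → ℂ, z ∉ Submodule.span ℂ {e} := by
    by_contra! hall
    have htop : Submodule.span ℂ {e} = ⊤ := by
      rw [eq_top_iff]; exact fun z _ => hall z
    have h1 : Module.finrank ℂ (Submodule.span ℂ {e}) ≤ 1 := by
      simpa using finrank_span_le_card (R := ℂ) ({e} : Set (Fin d → ℂ))
    rw [htop, finrank_top, Module.finrank_fin_fun] at h1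
    omega
  have hpz : (p.map (MvPolynomial.eval z)).degree ≠ 0 := by
    rw [Polynomial.degree_eq_natDegree (hp.map _).ne_zero, hp.natDegree_map]
    exact_mod_cast hdeg
  obtain ⟨τ, hτ⟩ := IsAlgClosed.exists_root _ hpz
  have hτ' : MvPolynomial.eval z (p.eval (MvPolynomial.C τ)) = 0 := by
    have := hτ
    rw [Polynomial.IsRoot, Polynomial.eval_map, ← MvPolynomial.eval_C (f := z) τ,
      Polynomial.eval₂_hom] at this
    simpa using this
  -- on the translate by `τ e` the polynomial `F` has a squared factor that vanishes at `z`
  have hfac : (fun w => MvPolynomial.eval (w + τ • e) F) = fun w =>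
      MvPolynomial.eval w (p.eval (MvPolynomial.C τ)) *
      MvPolynomial.eval w (p.eval (MvPolynomial.C τ)) *
      MvPolynomial.eval w (q.eval (MvPolynomial.C τ)) := by
    ext w
    rw [← eval_map_alongLine, hq]
    nth_rewrite 1 [← MvPolynomial.eval_C (f := w) τ]
    rw [Polynomial.eval_map, Polynomial.eval₂_hom]
    simp
  have hne : z + τ • e ≠ 0 := by
    intro h0
    apply hz
    rw [eq_neg_of_add_eq_zero_left h0]
    exact Submodule.neg_mem _ (Submodule.smul_mem _ _ (Submodule.mem_span_singleton_self e))
  have hzero : MvPolynomial.eval (z + τ • e) F = 0 := by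
    have := congrFun hfac z
    simp only [hτ'] at this
    simpa using this
  refine hX.fderiv_ne_zero hne hzero ?_
  have h1 : HasFDerivAt (fun w => MvPolynomial.eval (w + τ • e) F)
      (fderiv ℂ (fun w => MvPolynomial.eval w F) (z + τ • e)) z := by
    have := (differentiable_eval F (z + τ • e)).hasFDerivAt
    exact (hasFDerivAt_comp_add_right _).2 this
  rw [hfac] at h1
  have hpd := (differentiable_eval (p.eval (MvPolynomial.C τ)) z).hasFDerivAt
  have hqd := (differentiable_eval (q.eval (MvPolynomial.C τ)) z).hasFDerivAt
  have h2 := (hpd.mul hpd).mul hqd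
  rw [h1.unique h2]
  ext w
  simp [hτ']

/-- The generic line of direction `e` meets the cone over a smooth hypersurface in distinct
points: outside the zeros of the polynomial `r`, the restriction of `F` to the line is
separable. -/
lemma exists_ne_zero_separable {d n : ℕ} (hd : 2 ≤ d) {F : MvPolynomial (Fin d) ℂ}
    (hF : F.IsHomogeneous n) (hX : IsSmoothHypersurface F) {e : Fin d → ℂ}
    (he : MvPolynomial.eval e F ≠ 0) :
    ∃ r : MvPolynomial (Fin d) ℂ, r ≠ 0 ∧
      ∀ z, MvPolynomial.eval z r ≠ 0 → (onLine F e z).Separable := by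
  let R := MvPolynomial (Fin d) ℂ
  let K := FractionRing R
  set u : Polynomial R := Polynomial.C (MvPolynomial.C (MvPolynomial.eval e F)⁻¹) with hu
  have hG : (u * alongLine e F).Monic := by
    refine Polynomial.monic_of_natDegree_le_of_coeff_eq_one n
      ((Polynomial.natDegree_C_mul_le _ _).trans (alongLine_natDegree_coeff hF e).1) ?_
    rw [hu, Polynomial.coeff_C_mul, (alongLine_natDegree_coeff hF e).2, ← map_mul,
      inv_mul_cancel₀ he, map_one]
  have hinj : Function.Injective (algebraMap R K) := IsFractionRing.injective R K
  have : CharZero K := charZero_of_injective_algebraMap hinj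
  -- by Gauss's lemma a double factor over the fraction field comes from one over `R`
  have hsq : Squarefree ((u * alongLine e F).map (algebraMap R K)) := by
    intro p hp
    have hp0 : p ≠ 0 := by
      rintro rfl
      rw [zero_mul, zero_dvd_iff] at hp
      exact (hG.map _).ne_zero hp
    obtain ⟨p', hp'⟩ := IsIntegrallyClosed.eq_map_mul_C_of_dvd K hG ((dvd_mul_right p p).trans hp)
    have hl : p.leadingCoeff ≠ 0 := Polynomial.leadingCoeff_ne_zero.2 hp0
    have hm : (p'.map (algebraMap R K)).Monic := by
      have : p'.map (algebraMap R K) = p * Polynomial.C p.leadingCoeff⁻¹ := by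
        rw [← hp', mul_assoc, ← Polynomial.C_mul, hp', mul_inv_cancel₀ hl]; simp
      rw [this]
      exact Polynomial.monic_mul_leadingCoeff_inv hp0
    have hm' : p'.Monic := Polynomial.monic_of_injective hinj hm
    have hdvd : p' * p' ∣ u * alongLine e F := by
      rw [← Polynomial.map_dvd_map _ hinj (hm'.mul hm'), Polynomial.map_mul]
      refine dvd_trans ?_ hp
      rw [← hp']
      exact mul_dvd_mul (dvd_mul_right _ _) (dvd_mul_right _ _)
    have hdvd' : p' * p' ∣ alongLine e F := by
      have : alongLine e F = Polynomial.C (MvPolynomial.C (MvPolynomial.eval e F)) *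
          (u * alongLine e F) := by
        rw [hu, ← mul_assoc, ← Polynomial.C_mul, ← map_mul, mul_inv_cancel₀ he]; simp
      rw [this]
      exact hdvd.mul_left _
    have h1 := eq_one_of_mul_self_dvd_alongLine hd hX hm' hdvd'
    rw [← hp', h1]
    rw [Polynomial.map_one, one_mul]
    exact Polynomial.isUnit_C.2 (isUnit_iff_ne_zero.2 hl)
  have hsep : ((u * alongLine e F).map (algebraMap R K)).Separable :=
    PerfectField.separable_iff_squarefree.2 hsq
  obtain ⟨a, b, hab⟩ := hsep
  -- clearing denominators in a Bézout identity; it specializes wherever they do not vanish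
  obtain ⟨ca, hca0, hca⟩ := IsLocalization.integerNormalization_spec (nonZeroDivisors R) a
  obtain ⟨cb, hcb0, hcb⟩ := IsLocalization.integerNormalization_spec (nonZeroDivisors R) b
  set A := IsLocalization.integerNormalization (nonZeroDivisors R) a
  set B := IsLocalization.integerNormalization (nonZeroDivisors R) b
  refine ⟨ca * cb, mul_ne_zero (nonZeroDivisors.ne_zero hca0)
    (nonZeroDivisors.ne_zero hcb0), ?_⟩
  have hid : Polynomial.C cb * A * (u * alongLine e F) +
      Polynomial.C ca * B * Polynomial.derivative (u * alongLine e F) =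
      Polynomial.C (ca * cb) := by
    apply Polynomial.map_injective _ hinj
    simp only [Polynomial.map_add, Polynomial.map_mul, Polynomial.map_C, hca, hcb, map_mul,
      ← Polynomial.derivative_map] at hab ⊢
    rw [Algebra.smul_def, Algebra.smul_def] at *
    have e1 : ∀ x : R, algebraMap R (Polynomial K) x = Polynomial.C (algebraMap R K x) := by
      intro x
      rw [IsScalarTower.algebraMap_apply R K (Polynomial K)]; rfl
    simp only [e1]
    linear_combination (Polynomial.C (algebraMap R K ca) * Polynomial.C (algebraMap R K cb)) * hab
  intro z hz
  have h3 := congrArg (Polynomial.map (MvPolynomial.eval z)) hid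
  simp only [Polynomial.map_add, Polynomial.map_mul, Polynomial.map_C,
    ← Polynomial.derivative_map] at h3
  have hsep' : ((u * alongLine e F).map (MvPolynomial.eval z)).Separable := by
    set c := MvPolynomial.eval z (ca * cb) with hc
    refine ⟨Polynomial.C c⁻¹ * (Polynomial.C (MvPolynomial.eval z cb) *
      A.map (MvPolynomial.eval z)), Polynomial.C c⁻¹ * (Polynomial.C (MvPolynomial.eval z ca) *
      B.map (MvPolynomial.eval z)), ?_⟩
    simp only [Polynomial.map_mul]
    have hcc : Polynomial.C c⁻¹ * Polynomial.C c = 1 := by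
      rw [← Polynomial.C_mul, inv_mul_cancel₀ hz, Polynomial.C_1]
    linear_combination (Polynomial.C c⁻¹) * h3 + hcc
  rw [Polynomial.map_mul] at hsep'
  exact hsep'.of_mul_right

/-! ### Sheets of the cone over a smooth hypersurface -/

/-- The cone `{F = 0}` without its vertex. -/
def puncturedCone {d : ℕ} (F : MvPolynomial (Fin d) ℂ) : Set (Fin d → ℂ) :=
  {z | z ≠ 0 ∧ MvPolynomial.eval z F = 0}

/-- `A` is a subset of the punctured cone `{F = 0} \ {0}` that is open and closed in it and
invariant under multiplication by nonzero scalars. -/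
structure IsClopenSubcone {d : ℕ} (F : MvPolynomial (Fin d) ℂ) (A : Set (Fin d → ℂ)) : Prop where
  subset : A ⊆ puncturedCone F
  isOpen : ∀ z ∈ A, ∀ᶠ w in 𝓝 z, w ∈ puncturedCone F → w ∈ A
  isClosed : ∀ z ∈ puncturedCone F \ A, ∀ᶠ w in 𝓝 z, w ∉ A
  smul_mem : ∀ z ∈ A, ∀ c : ℂ, c ≠ 0 → c • z ∈ A

lemma smul_mem_puncturedCone {d n : ℕ} {F : MvPolynomial (Fin d) ℂ} (hF : F.IsHomogeneous n)
    {z : Fin d → ℂ} (hz : z ∈ puncturedCone F) {c : ℂ} (hc : c ≠ 0) : c • z ∈ puncturedCone F :=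
  ⟨smul_ne_zero hc hz.1, by rw [eval_smul_of_isHomogeneous hF, hz.2, mul_zero]⟩

lemma IsClopenSubcone.compl {d n : ℕ} {F : MvPolynomial (Fin d) ℂ} (hF : F.IsHomogeneous n)
    {A : Set (Fin d → ℂ)} (hA : IsClopenSubcone F A) : IsClopenSubcone F (puncturedCone F \ A) where
  subset := Set.sdiff_subset
  isOpen z hz := (hA.isClosed z hz).mono fun _ hw hc => ⟨hc, hw⟩
  isClosed z hz := by
    have hzA : z ∈ A := by
      by_contra h; exact hz.2 ⟨hz.1, h⟩
    exact (hA.isOpen z hzA).mono fun w hw hw' => hw'.2 (hw hw'.1)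
  smul_mem z hz c hc := by
    refine ⟨smul_mem_puncturedCone hF hz.1 hc, fun h => hz.2 ?_⟩
    have := hA.smul_mem _ h c⁻¹ (inv_ne_zero hc)
    rwa [smul_smul, inv_mul_cancel₀ hc, one_smul] at this

/-- The set of `T` such that `z + T e` lies on the cone `{F = 0}`. -/
noncomputable def lineRoots {d : ℕ} (F : MvPolynomial (Fin d) ℂ) (e z : Fin d → ℂ) : Finset ℂ :=
  (onLine F e z).roots.toFinset

open Classical in
/-- The set of `T` such that `z + T e` lies on the part `A` of the cone `{F = 0}`. -/
noncomputable def lineRootsIn {d : ℕ} (F : MvPolynomial (Fin d) ℂ) (e : Fin d → ℂ)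
    (A : Set (Fin d → ℂ)) (z : Fin d → ℂ) : Finset ℂ :=
  (lineRoots F e z).filter fun T => z + T • e ∈ A

lemma mem_lineRootsIn {d : ℕ} {F : MvPolynomial (Fin d) ℂ} {e z : Fin d → ℂ}
    {A : Set (Fin d → ℂ)} {T : ℂ} :
    T ∈ lineRootsIn F e A z ↔ T ∈ lineRoots F e z ∧ z + T • e ∈ A := by
  classical
  exact Finset.mem_filter

section

variable {d n : ℕ} {F : MvPolynomial (Fin d) ℂ} {e : Fin d → ℂ}

lemma mem_lineRoots (hF : F.IsHomogeneous n) (he : MvPolynomial.eval e F ≠ 0) {z : Fin d → ℂ}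
    {T : ℂ} : T ∈ lineRoots F e z ↔ MvPolynomial.eval (z + T • e) F = 0 := by
  rw [lineRoots, Multiset.mem_toFinset, Polynomial.mem_roots (onLine_ne_zero hF he z),
    Polynomial.IsRoot, eval_onLine]

lemma card_lineRoots_le (hF : F.IsHomogeneous n) (he : MvPolynomial.eval e F ≠ 0)
    (z : Fin d → ℂ) : (lineRoots F e z).card ≤ n := by
  rw [← natDegree_onLine hF he z]
  exact (Multiset.toFinset_card_le _).trans (Polynomial.card_roots' _)

lemma card_lineRoots (hF : F.IsHomogeneous n) (he : MvPolynomial.eval e F ≠ 0)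
    {z : Fin d → ℂ} (hz : (onLine F e z).Separable) : (lineRoots F e z).card = n := by
  rw [lineRoots, Multiset.toFinset_card_of_nodup (Polynomial.nodup_roots hz),
    ← natDegree_onLine hF he z]
  exact (IsAlgClosed.splits (onLine F e z)).natDegree_eq_card_roots.symm

lemma eval_derivative_onLine (z : Fin d → ℂ) (T : ℂ) :
    (Polynomial.derivative (onLine F e z)).eval T =
      fderiv ℂ (fun w => MvPolynomial.eval w F) (z + T • e) e := by
  have h1 : HasDerivAt (fun T : ℂ => (onLine F e z).eval T)
      ((Polynomial.derivative (onLine F e z)).eval T) T := (onLine F e z).hasDerivAt T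
  simp only [eval_onLine] at h1
  have h2 : HasDerivAt (fun T : ℂ => z + T • e) e T := by
    simpa using ((hasDerivAt_id T).smul_const e).const_add z
  have h3 := (differentiable_eval F (z + T • e)).hasFDerivAt
  have h4 := h3.comp_hasDerivAt T h2
  exact h1.unique h4

lemma fderiv_apply_ne_zero_of_separable {z : Fin d → ℂ} (hz : (onLine F e z).Separable) {T : ℂ}
    (hT : MvPolynomial.eval (z + T • e) F = 0) :
    fderiv ℂ (fun w => MvPolynomial.eval w F) (z + T • e) e ≠ 0 := by
  rw [← eval_derivative_onLine]
  have := hz.eval₂_derivative_ne_zero (RingHom.id ℂ) (x := T) (by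
    rw [Polynomial.eval₂_id, eval_onLine, hT])
  rwa [Polynomial.eval₂_id] at this

/-- The vertex of the cone is a singular point, since `n ≥ 2`. -/
lemma fderiv_eval_zero (hn : 2 ≤ n) (hF : F.IsHomogeneous n) (v : Fin d → ℂ) :
    fderiv ℂ (fun w => MvPolynomial.eval w F) 0 v = 0 := by
  have h1 : HasDerivAt (fun T : ℂ => T • v) v 0 := by
    simpa using (hasDerivAt_id (0 : ℂ)).smul_const v
  have h2 : HasFDerivAt (fun w => MvPolynomial.eval w F)
      (fderiv ℂ (fun w => MvPolynomial.eval w F) 0) ((0 : ℂ) • v) := by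
    rw [zero_smul]; exact (differentiable_eval F 0).hasFDerivAt
  have h3 := h2.comp_hasDerivAt (0 : ℂ) h1
  have h4 : HasDerivAt (fun T : ℂ => T ^ n * MvPolynomial.eval v F) 0 0 := by
    have := ((hasDerivAt_pow n (0 : ℂ)).mul_const (MvPolynomial.eval v F))
    simpa [zero_pow (show n - 1 ≠ 0 by omega)] using this
  refine h3.unique (h4.congr_of_eventuallyEq (Eventually.of_forall fun T => ?_))
  simp [eval_smul_of_isHomogeneous hF]

lemma add_smul_ne_zero_of_separable (hn : 2 ≤ n) (hF : F.IsHomogeneous n) {z : Fin d → ℂ}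
    (hz : (onLine F e z).Separable) {T : ℂ} (hT : MvPolynomial.eval (z + T • e) F = 0) :
    z + T • e ≠ 0 := by
  intro h
  have := fderiv_apply_ne_zero_of_separable hz hT
  rw [h] at this
  exact this (fderiv_eval_zero hn hF e)

lemma isInvertible_of_apply_one_ne_zero {L : ℂ →L[ℂ] ℂ} (h : L 1 ≠ 0) : L.IsInvertible := by
  refine ⟨ContinuousLinearEquiv.unitsEquivAut ℂ (Units.mk0 _ h), ?_⟩
  ext
  simp

/-- A simple intersection point of the line `z + T e` with the cone moves holomorphically
with `z`. -/
lemma exists_sheet {z₀ : Fin d → ℂ} {τ : ℂ} (hτ : MvPolynomial.eval (z₀ + τ • e) F = 0)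
    (hd : fderiv ℂ (fun w => MvPolynomial.eval w F) (z₀ + τ • e) e ≠ 0) :
    ∃ g : (Fin d → ℂ) → ℂ, g z₀ = τ ∧
      ∀ᶠ z in 𝓝 z₀, DifferentiableAt ℂ g z ∧ MvPolynomial.eval (z + g z • e) F = 0 := by
  let f : (Fin d → ℂ) × ℂ → ℂ := fun q => MvPolynomial.eval (q.1 + q.2 • e) F
  have hf : AnalyticAt ℂ f (z₀, τ) := by
    have h1 : AnalyticAt ℂ (fun q : (Fin d → ℂ) × ℂ => q.1 + q.2 • e) (z₀, τ) :=
      analyticAt_fst.add (analyticAt_snd.smul analyticAt_const)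
    exact (AnalyticOnNhd.eval_mvPolynomial F (z₀ + τ • e) (Set.mem_univ _)).comp_of_eq h1 rfl
  have cdf : ContDiffAt ℂ 1 f (z₀, τ) := hf.contDiffAt
  have hder : (fderiv ℂ f (z₀, τ)) (0, 1) =
      fderiv ℂ (fun w => MvPolynomial.eval w F) (z₀ + τ • e) e := by
    have h2 : HasFDerivAt (fun q : (Fin d → ℂ) × ℂ => q.1 + q.2 • e)
        (ContinuousLinearMap.fst ℂ (Fin d → ℂ) ℂ +
          (ContinuousLinearMap.snd ℂ (Fin d → ℂ) ℂ).smulRight e) (z₀, τ) :=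
      hasFDerivAt_fst.add (hasFDerivAt_snd.smul_const e)
    have h3 := HasFDerivAt.comp (z₀, τ) (differentiable_eval F (z₀ + τ • e)).hasFDerivAt h2
    have h4 : HasFDerivAt f _ (z₀, τ) := h3
    rw [h4.fderiv]
    simp
  have hinv : (fderiv ℂ f (z₀, τ) ∘L .inr ℂ (Fin d → ℂ) ℂ).IsInvertible := by
    apply isInvertible_of_apply_one_ne_zero
    simpa [hder] using hd
  refine ⟨cdf.implicitFunction one_ne_zero hinv, cdf.implicitFunction_apply_self one_ne_zero hinv, ?_⟩
  have h5 : ContDiffAt ℂ 1 _ z₀ := cdf.contDiffAt_implicitFunction one_ne_zero hinv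
  have h6 := h5.eventually (by simp)
  filter_upwards [h6, cdf.eventually_apply_implicitFunction one_ne_zero hinv] with z hz hz'
  refine ⟨hz.differentiableAt one_ne_zero, ?_⟩
  have h7 : f (z₀, τ) = 0 := hτ
  rw [h7] at hz'
  exact hz'

/-- Over a neighbourhood of a point `z₀` whose line of direction `e` meets the cone in distinct
points, the cone consists of disjoint graphs, each of which stays in an open and closed part of
the cone. -/
lemma exists_sheets (hn : 2 ≤ n) (hF : F.IsHomogeneous n) (he : MvPolynomial.eval e F ≠ 0)
    {A : Set (Fin d → ℂ)} (hA : IsClopenSubcone F A) {z₀ : Fin d → ℂ}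
    (hz₀ : (onLine F e z₀).Separable) :
    ∃ g : ℂ → (Fin d → ℂ) → ℂ, ∀ᶠ z in 𝓝 z₀,
      (∀ τ ∈ lineRoots F e z₀, DifferentiableAt ℂ (g τ) z) ∧
      Set.InjOn (fun τ => g τ z) (lineRoots F e z₀) ∧
      lineRootsIn F e A z = (lineRootsIn F e A z₀).image (fun τ => g τ z) ∧
      lineRootsIn F e (puncturedCone F \ A) z =
        (lineRootsIn F e (puncturedCone F \ A) z₀).image (fun τ => g τ z) := by
  classical
  have hex : ∀ τ : ℂ, ∃ g : (Fin d → ℂ) → ℂ, τ ∈ lineRoots F e z₀ → g z₀ = τ ∧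
      ∀ᶠ z in 𝓝 z₀, DifferentiableAt ℂ g z ∧ MvPolynomial.eval (z + g z • e) F = 0 := by
    intro τ
    by_cases hτ : τ ∈ lineRoots F e z₀
    · have h0 := (mem_lineRoots hF he).1 hτ
      obtain ⟨g, hg⟩ := exists_sheet h0 (fderiv_apply_ne_zero_of_separable hz₀ h0)
      exact ⟨g, fun _ => hg⟩
    · exact ⟨0, fun h => absurd h hτ⟩
  choose g hg using hex
  refine ⟨g, ?_⟩
  have hcont : ∀ τ ∈ lineRoots F e z₀, ContinuousAt (g τ) z₀ := fun τ hτ =>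
    ((hg τ hτ).2.self_of_nhds).1.continuousAt
  have hpt : ∀ τ ∈ lineRoots F e z₀,
      Tendsto (fun z => z + g τ z • e) (𝓝 z₀) (𝓝 (z₀ + τ • e)) := by
    intro τ hτ
    have h1 : ContinuousAt (fun z => z + g τ z • e) z₀ :=
      continuousAt_id.add ((hcont τ hτ).smul continuousAt_const)
    have h2 := h1.tendsto
    rwa [(hg τ hτ).1] at h2
  have e1 : ∀ᶠ z in 𝓝 z₀, ∀ τ ∈ lineRoots F e z₀, DifferentiableAt ℂ (g τ) z ∧
      MvPolynomial.eval (z + g τ z • e) F = 0 :=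
    (Filter.eventually_all_finset _).2 fun τ hτ => (hg τ hτ).2
  have e2 : ∀ᶠ z in 𝓝 z₀, ∀ τ ∈ lineRoots F e z₀, ∀ τ' ∈ lineRoots F e z₀, τ ≠ τ' →
      g τ z ≠ g τ' z := by
    refine (Filter.eventually_all_finset _).2 fun τ hτ =>
      (Filter.eventually_all_finset _).2 fun τ' hτ' => ?_
    by_cases h : τ = τ'
    · exact Eventually.of_forall fun z hne => absurd h hne
    · have := ((hcont τ hτ).sub (hcont τ' hτ')).eventually_ne
        (sub_ne_zero.2 (by rwa [(hg τ hτ).1, (hg τ' hτ').1]))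
      exact this.mono fun z hz _ => sub_ne_zero.1 hz
  have e3 : ∀ᶠ z in 𝓝 z₀, ∀ τ ∈ lineRoots F e z₀, z + g τ z • e ∈ puncturedCone F ∧
      (z + g τ z • e ∈ A ↔ z₀ + τ • e ∈ A) := by
    refine (Filter.eventually_all_finset _).2 fun τ hτ => ?_
    have h0 := (mem_lineRoots hF he).1 hτ
    have hne := add_smul_ne_zero_of_separable hn hF hz₀ h0
    have hcone : ∀ᶠ z in 𝓝 z₀, z + g τ z • e ∈ puncturedCone F := by
      filter_upwards [(hpt τ hτ).eventually_ne hne, (hg τ hτ).2] with z h1 h2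
      exact ⟨h1, h2.2⟩
    by_cases hmem : z₀ + τ • e ∈ A
    · filter_upwards [hcone, (hpt τ hτ).eventually (hA.isOpen _ hmem)] with z h1 h2
      exact ⟨h1, fun _ => hmem, fun _ => h2 h1⟩
    · filter_upwards [hcone, (hpt τ hτ).eventually (hA.isClosed _ ⟨⟨hne, h0⟩, hmem⟩)] with z h1 h2
      exact ⟨h1, fun h => absurd h h2, fun h => absurd h hmem⟩
  filter_upwards [e1, e2, e3] with z h1 h2 h3
  have hinj : Set.InjOn (fun τ => g τ z) (lineRoots F e z₀) := by
    intro τ hτ τ' hτ' heq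
    by_contra hne
    exact h2 τ hτ τ' hτ' hne heq
  -- the sheets exhaust the roots, because there are never more than `n` roots
  have himg : lineRoots F e z = (lineRoots F e z₀).image (fun τ => g τ z) := by
    symm
    refine Finset.eq_of_subset_of_card_le ?_ ?_
    · intro w hw
      obtain ⟨τ, hτ, rfl⟩ := Finset.mem_image.1 hw
      exact (mem_lineRoots hF he).2 (h1 τ hτ).2
    · rw [Finset.card_image_of_injOn hinj, card_lineRoots hF he hz₀]
      exact card_lineRoots_le hF he z
  refine ⟨fun τ hτ => (h1 τ hτ).1, hinj, ?_, ?_⟩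
  · ext w
    simp only [mem_lineRootsIn, himg, Finset.mem_image]
    constructor
    · rintro ⟨⟨τ, hτ, rfl⟩, hw⟩
      exact ⟨τ, ⟨hτ, (h3 τ hτ).2.1 hw⟩, rfl⟩
    · rintro ⟨τ, ⟨hτ, hw⟩, rfl⟩
      exact ⟨⟨τ, hτ, rfl⟩, (h3 τ hτ).2.2 hw⟩
  · ext w
    simp only [mem_lineRootsIn, himg, Finset.mem_image, Set.mem_sdiff]
    constructor
    · rintro ⟨⟨τ, hτ, rfl⟩, hw⟩
      have h0 := (mem_lineRoots hF he).1 hτ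
      exact ⟨τ, ⟨hτ, ⟨add_smul_ne_zero_of_separable hn hF hz₀ h0, h0⟩,
        fun h => hw.2 ((h3 τ hτ).2.2 h)⟩, rfl⟩
    · rintro ⟨τ, ⟨hτ, hw⟩, rfl⟩
      exact ⟨⟨τ, hτ, rfl⟩, (h3 τ hτ).1, fun h => hw.2 ((h3 τ hτ).2.1 h)⟩

lemma pow_card_le_norm_prod {η : ℝ} (hη : 0 ≤ η) (s : Multiset ℂ) (hs : ∀ x ∈ s, η ≤ ‖x‖) :
    η ^ s.card ≤ ‖s.prod‖ := by
  induction s using Multiset.induction_on with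
  | empty => simp
  | cons a s ih =>
    rw [Multiset.card_cons, Multiset.prod_cons, norm_mul, pow_succ']
    exact mul_le_mul (hs a (Multiset.mem_cons_self a s))
      (ih fun x hx => hs x (Multiset.mem_cons_of_mem hx)) (by positivity) (norm_nonneg _)

/-- Near a point `a` of the cone, every line of direction `e` meets the cone near `a`: the product
of the roots is `± F z / F e`, which tends to zero as `z` tends to `a`. -/
lemma eventually_exists_root_near (hF : F.IsHomogeneous n) (he : MvPolynomial.eval e F ≠ 0)
    {a : Fin d → ℂ} (ha : MvPolynomial.eval a F = 0) {N : Set (Fin d → ℂ)} (hN : N ∈ 𝓝 a) :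
    ∀ᶠ z in 𝓝 a, ∃ τ : ℂ, MvPolynomial.eval (z + τ • e) F = 0 ∧ z + τ • e ∈ N := by
  have hc : Tendsto (fun q : (Fin d → ℂ) × ℂ => q.1 + q.2 • e) (𝓝 (a, 0)) (𝓝 a) := by
    have : Continuous (fun q : (Fin d → ℂ) × ℂ => q.1 + q.2 • e) := by fun_prop
    have := this.tendsto (a, 0)
    simpa using this
  obtain ⟨U, hU, W, hW, hUW⟩ := mem_nhds_prod_iff.1 (hc hN)
  obtain ⟨η, hη, hηW⟩ := Metric.mem_nhds_iff.1 hW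
  have hsmall : ∀ᶠ z in 𝓝 a, ‖MvPolynomial.eval z F‖ < ‖MvPolynomial.eval e F‖ * η ^ n := by
    have h1 := ((continuous_eval F).norm.tendsto a)
    rw [ha, norm_zero] at h1
    exact h1.eventually (gt_mem_nhds (by positivity))
  filter_upwards [hsmall, hU] with z hz hzU
  by_contra! hcon
  have hroots : ∀ x ∈ (onLine F e z).roots.map (fun a => 0 - a), η ≤ ‖x‖ := by
    intro x hx
    obtain ⟨τ, hτ, rfl⟩ := Multiset.mem_map.1 hx
    rw [Polynomial.mem_roots (onLine_ne_zero hF he z), Polynomial.IsRoot, eval_onLine] at hτ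
    by_contra! hlt
    have hmem : (z, τ) ∈ U ×ˢ W := ⟨hzU, hηW (by simpa using hlt)⟩
    exact hcon τ hτ (hUW hmem)
  have h2 := pow_card_le_norm_prod hη.le _ hroots
  have h3 := (IsAlgClosed.splits (onLine F e z)).eval_eq_prod_roots 0
  rw [Multiset.card_map, ← (IsAlgClosed.splits (onLine F e z)).natDegree_eq_card_roots,
    natDegree_onLine hF he] at h2
  rw [eval_onLine, zero_smul, add_zero, leadingCoeff_onLine hF he] at h3
  rw [h3, norm_mul] at hz
  have := mul_le_mul_of_nonneg_left h2 (norm_nonneg (MvPolynomial.eval e F))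
  linarith

/-- A polynomial function that does not vanish at `w` vanishes at finitely many points of a complex
line through `w`. -/
lemma finite_zeros_on_line {r : MvPolynomial (Fin d) ℂ} {u c : Fin d → ℂ} {s₁ : ℂ}
    (h : MvPolynomial.eval (u + s₁ • c) r ≠ 0) :
    {s : ℂ | MvPolynomial.eval (u + s • c) r = 0}.Finite := by
  have hne : onLine r c u ≠ 0 := by
    intro h0
    apply h
    rw [← eval_onLine, h0, Polynomial.eval_zero]
  refine ((onLine r c u).roots.toFinset.finite_toSet).subset fun s hs => ?_
  simp only [Finset.mem_coe, Multiset.mem_toFinset, Polynomial.mem_roots hne, Polynomial.IsRoot,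
    eval_onLine]
  exact hs

/-- On a complex line, the number of sheets that lie in an open and closed part `A` of the cone is
locally constant off a finite set, hence constant there. -/
lemma card_lineRootsIn_eq (hn : 2 ≤ n) (hF : F.IsHomogeneous n) (he : MvPolynomial.eval e F ≠ 0)
    {A : Set (Fin d → ℂ)} (hA : IsClopenSubcone F A) {r : MvPolynomial (Fin d) ℂ}
    (hr : ∀ z, MvPolynomial.eval z r ≠ 0 → (onLine F e z).Separable) {u c : Fin d → ℂ} {s₁ s₂ : ℂ}
    (h₁ : MvPolynomial.eval (u + s₁ • c) r ≠ 0) (h₂ : MvPolynomial.eval (u + s₂ • c) r ≠ 0) :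
    (lineRootsIn F e A (u + s₁ • c)).card = (lineRootsIn F e A (u + s₂ • c)).card := by
  classical
  have hconn : IsPreconnected {s : ℂ | MvPolynomial.eval (u + s • c) r = 0}ᶜ := by
    refine ((finite_zeros_on_line h₁).countable.isConnected_compl_of_one_lt_rank ?_).isPreconnected
    rw [Complex.rank_real_complex]; exact Cardinal.one_lt_two
  refine hconn.constant (Y := ℕ) (f := fun s => (lineRootsIn F e A (u + s • c)).card) ?_ h₁ h₂
  intro s hs
  apply ContinuousAt.continuousWithinAt
  obtain ⟨g, hg⟩ := exists_sheets hn hF he hA (hr _ hs)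
  have hline : Tendsto (fun s : ℂ => u + s • c) (𝓝 s) (𝓝 (u + s • c)) :=
    (by fun_prop : Continuous fun s : ℂ => u + s • c).tendsto s
  refine tendsto_nhds_of_eventually_eq ?_
  filter_upwards [hline.eventually hg] with t ht
  rw [ht.2.2.1, Finset.card_image_of_injOn]
  exact ht.2.1.mono fun x hx => (mem_lineRootsIn.1 hx).1

/-- A nonempty open and closed part of the cone lies over every generic point. -/
lemma lineRootsIn_nonempty (hn : 2 ≤ n) (hF : F.IsHomogeneous n) (he : MvPolynomial.eval e F ≠ 0)
    {A : Set (Fin d → ℂ)} (hA : IsClopenSubcone F A) (hne : A.Nonempty) {r : MvPolynomial (Fin d) ℂ}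
    (hr : ∀ z, MvPolynomial.eval z r ≠ 0 → (onLine F e z).Separable) {w : Fin d → ℂ}
    (hw : MvPolynomial.eval w r ≠ 0) : (lineRootsIn F e A w).Nonempty := by
  obtain ⟨a, ha⟩ := hne
  have hacone := hA.subset ha
  have hN : {z : Fin d → ℂ | z ∈ puncturedCone F → z ∈ A} ∩ {z | z ≠ 0} ∈ 𝓝 a :=
    inter_mem (hA.isOpen a ha) (isOpen_ne.mem_nhds hacone.1)
  have hw' : MvPolynomial.eval (a + (1 : ℂ) • (w - a)) r ≠ 0 := by simpa using hw
  have hev := eventually_exists_root_near hF he hacone.2 hN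
  have hline : Tendsto (fun s : ℂ => a + s • (w - a)) (𝓝[≠] 0) (𝓝 a) := by
    have : Tendsto (fun s : ℂ => a + s • (w - a)) (𝓝 0) (𝓝 (a + (0 : ℂ) • (w - a))) :=
      (by fun_prop : Continuous fun s : ℂ => a + s • (w - a)).tendsto 0
    rw [zero_smul, add_zero] at this
    exact this.mono_left nhdsWithin_le_nhds
  -- there are generic points on the line from `a` to `w` arbitrarily near to `a`
  have hgood : ∀ᶠ s in 𝓝[≠] (0 : ℂ), MvPolynomial.eval (a + s • (w - a)) r ≠ 0 := by
    have hfin := finite_zeros_on_line hw'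
    have : ({s : ℂ | MvPolynomial.eval (a + s • (w - a)) r = 0} \ {0})ᶜ ∈ 𝓝 (0 : ℂ) :=
      (hfin.subset Set.sdiff_subset).isClosed.isOpen_compl.mem_nhds (by simp)
    rw [eventually_nhdsWithin_iff]
    filter_upwards [this] with s hs hs0 h0
    exact hs ⟨h0, hs0⟩
  obtain ⟨s, hs1, τ, hτ, hτN⟩ := (hgood.and (hline.eventually hev)).exists
  have h1 : τ ∈ lineRootsIn F e A (a + s • (w - a)) := by
    refine mem_lineRootsIn.2 ⟨(mem_lineRoots hF he).2 hτ, hτN.1 ⟨hτN.2, hτ⟩⟩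
  have h2 := card_lineRootsIn_eq hn hF he hA hr hs1 hw'
  rw [← Finset.card_pos, show w = a + (1 : ℂ) • (w - a) by simp, ← h2, Finset.card_pos]
  exact ⟨τ, h1⟩

end

/-! ### Connectedness of the cone over a smooth hypersurface -/

/-- Removable singularities: a function that is holomorphic and bounded off a finite set extends to an
entire function. -/
lemma exists_entire_extension (T : Set ℂ) (hT : T.Finite) : ∀ (g : ℂ → ℂ) (C : ℝ),
    DifferentiableOn ℂ g Tᶜ → (∀ s ∉ T, ‖g s‖ ≤ C) →
      ∃ G : ℂ → ℂ, Differentiable ℂ G ∧ ∀ s ∉ T, G s = g s := by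
  induction T, hT using Set.Finite.induction_on with
  | empty =>
    intro g C hg _
    exact ⟨g, by simpa [differentiableOn_univ] using hg, fun _ _ => rfl⟩
  | @insert c T hc hT ih =>
    intro g C hg hC
    have hnhds : Tᶜ ∈ 𝓝 c := hT.isClosed.isOpen_compl.mem_nhds hc
    have hset : Tᶜ \ {c} = (insert c T)ᶜ := by
      ext x; simp [and_comm]
    have h1 := Complex.differentiableOn_update_limUnder_of_bddAbove (f := g) hnhds
      (by rwa [hset]) ⟨C, by
        rintro _ ⟨x, hx, rfl⟩
        rw [hset] at hx
        exact hC x hx⟩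
    obtain ⟨G, hG, hGg⟩ := ih _ (max C ‖limUnder (𝓝[≠] c) g‖) h1 (by
      intro s hs
      by_cases hsc : s = c
      · subst hsc; simp
      · rw [Function.update_of_ne hsc]
        exact (hC s (by simp [hsc, hs])).trans (le_max_left _ _))
    refine ⟨G, hG, fun s hs => ?_⟩
    simp only [Set.mem_insert_iff, not_or] at hs
    rw [hGg s hs.2, Function.update_of_ne hs.1]

section

variable {d n : ℕ} {F : MvPolynomial (Fin d) ℂ} {e : Fin d → ℂ}

lemma IsClopenSubcone.isClosed_insert_zero {A : Set (Fin d → ℂ)} (hA : IsClopenSubcone F A) :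
    IsClosed (insert 0 A) := by
  rw [← isOpen_compl_iff, isOpen_iff_mem_nhds]
  intro z hz
  simp only [Set.mem_compl_iff, Set.mem_insert_iff, not_or] at hz
  have h0 : ∀ᶠ w in 𝓝 z, w ≠ 0 := isOpen_ne.mem_nhds hz.1
  have h1 : ∀ᶠ w in 𝓝 z, w ∉ A := by
    by_cases hFz : MvPolynomial.eval z F = 0
    · exact hA.isClosed z ⟨⟨hz.1, hFz⟩, hz.2⟩
    · filter_upwards [(continuous_eval F).continuousAt.eventually_ne hFz] with w hw hwA
      exact hw (hA.subset hwA).2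
  filter_upwards [h0, h1] with w h2 h3
  simp [h2, h3]

/-- Two complementary open and closed parts of the cone are separated by a definite angle. -/
lemma exists_separation {A B : Set (Fin d → ℂ)} (hA : IsClopenSubcone F A)
    (hB : IsClopenSubcone F B) (hAB : Disjoint A B) :
    ∃ δ : ℝ, 0 < δ ∧ ∀ p ∈ A, ∀ q ∈ B, δ * ‖p‖ ≤ ‖p - q‖ := by
  have hS : IsCompact (insert 0 A ∩ Metric.sphere 0 1) :=
    (isCompact_sphere _ _).inter_left hA.isClosed_insert_zero
  have hdisj : Disjoint (insert 0 A ∩ Metric.sphere 0 1) (insert 0 B) := by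
    rw [Set.disjoint_left]
    rintro x ⟨hx, hx1⟩ hxB
    have hx0 : x ≠ 0 := by
      rintro rfl; simp at hx1
    exact Set.disjoint_left.1 hAB (hx.resolve_left hx0) (hxB.resolve_left hx0)
  obtain ⟨δ, hδ, h⟩ := Metric.exists_pos_forall_lt_edist hS hB.isClosed_insert_zero hdisj
  refine ⟨δ, hδ, fun p hp q hq => ?_⟩
  have hp0 : p ≠ 0 := (hA.subset hp).1
  have hpn : 0 < ‖p‖ := norm_pos_iff.2 hp0
  have hc : ((‖p‖⁻¹ : ℝ) : ℂ) ≠ 0 := by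
    exact_mod_cast (inv_pos.2 hpn).ne'
  have hn1 : ‖((‖p‖⁻¹ : ℝ) : ℂ) • p‖ = 1 := by
    rw [norm_smul, Complex.norm_real, norm_inv, norm_norm, inv_mul_cancel₀ hpn.ne']
  have h1 := h _ ⟨Set.mem_insert_of_mem _ (hA.smul_mem p hp _ hc), by simpa using hn1⟩
    _ (Set.mem_insert_of_mem _ (hB.smul_mem q hq _ hc))
  rw [edist_dist, dist_eq_norm, ← smul_sub, norm_smul, Complex.norm_real, norm_inv, norm_norm,
    ← ENNReal.ofReal_coe_nnreal] at h1
  have h2 := (ENNReal.ofReal_lt_ofReal_iff_of_nonneg (NNReal.coe_nonneg δ)).1 h1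
  rw [inv_mul_eq_div, lt_div_iff₀ hpn] at h2
  exact h2.le

/-- In dimension at least three there is an affine plane through `u` parallel to `e` that does not
contain the origin; the norm grows linearly on it. -/
lemma exists_norm_ge_on_plane (hd : 3 ≤ d) {u : Fin d → ℂ} (he : e ≠ 0)
    (hu : u ∉ Submodule.span ℂ {e}) :
    ∃ (c : Fin d → ℂ) (κ : ℝ), 0 < κ ∧ ∀ s T : ℂ, κ * max 1 ‖s‖ ≤ ‖u + s • c + T • e‖ := by
  obtain ⟨c, hc⟩ : ∃ c : Fin d → ℂ, c ∉ Submodule.span ℂ (({u, e} : Finset (Fin d → ℂ)) :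
      Set (Fin d → ℂ)) := by
    by_contra! hall
    have htop : Submodule.span ℂ (({u, e} : Finset (Fin d → ℂ)) : Set (Fin d → ℂ)) = ⊤ := by
      rw [eq_top_iff]; exact fun z _ => hall z
    have h1 := finrank_span_finset_le_card (R := ℂ) ({u, e} : Finset (Fin d → ℂ))
    rw [Set.finrank, htop, finrank_top, Module.finrank_fin_fun] at h1
    have := Finset.card_le_two (a := u) (b := e)
    omega
  let L : ℂ × ℂ × ℂ →ₗ[ℂ] (Fin d → ℂ) :=
    { toFun := fun x => x.1 • u + x.2.1 • c + x.2.2 • e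
      map_add' := fun x y => by simp only [Prod.fst_add, Prod.snd_add, add_smul]; abel
      map_smul' := fun a x => by simp [smul_smul] }
  have hker : LinearMap.ker L = ⊥ := by
    rw [LinearMap.ker_eq_bot']
    rintro ⟨a, b, T⟩ h
    have h' : a • u + b • c + T • e = 0 := h
    have hu' : u ∈ Submodule.span ℂ (({u, e} : Finset (Fin d → ℂ)) : Set (Fin d → ℂ)) :=
      Submodule.subset_span (by simp)
    have he' : e ∈ Submodule.span ℂ (({u, e} : Finset (Fin d → ℂ)) : Set (Fin d → ℂ)) :=
      Submodule.subset_span (by simp)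
    have hb : b = 0 := by
      by_contra hb
      apply hc
      rw [← Submodule.smul_mem_iff _ hb]
      have : b • c = -(a • u + T • e) := by
        rw [eq_neg_iff_add_eq_zero, ← h']; abel
      rw [this]
      exact Submodule.neg_mem _ (Submodule.add_mem _ (Submodule.smul_mem _ _ hu')
        (Submodule.smul_mem _ _ he'))
    subst hb
    rw [zero_smul, add_zero] at h'
    have ha : a = 0 := by
      by_contra ha
      apply hu
      rw [← Submodule.smul_mem_iff _ ha, eq_neg_of_add_eq_zero_left h']
      exact Submodule.neg_mem _ (Submodule.smul_mem _ _ (Submodule.mem_span_singleton_self e))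
    subst ha
    rw [zero_smul, zero_add, smul_eq_zero] at h'
    simp [h'.resolve_right he]
  obtain ⟨K, hK, hanti⟩ := L.exists_antilipschitzWith hker
  refine ⟨c, (K : ℝ)⁻¹, inv_pos.2 hK, fun s T => ?_⟩
  have h1 := hanti.le_mul_dist ((1, s, T) : ℂ × ℂ × ℂ) 0
  rw [map_zero, dist_zero_right, dist_zero_right] at h1
  have h2 : L (1, s, T) = u + s • c + T • e := by simp [L]
  rw [h2] at h1
  have h3 : max 1 ‖s‖ ≤ ‖((1, s, T) : ℂ × ℂ × ℂ)‖ := by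
    rw [Prod.norm_mk, Prod.norm_mk, norm_one]
    exact max_le_max le_rfl (le_max_left _ _)
  have hK' : (0 : ℝ) < K := hK
  rw [inv_mul_le_iff₀ hK']
  exact h3.trans h1

/-- The punctured cone over a smooth hypersurface is connected. If it had two complementary open and
closed parts `A` and `B`, then on a generic complex line with parameter `s` the product of the
inverse differences of the roots belonging to `A` and to `B` would extend to an entire function
of `s` without zeros at generic points that tends to zero at infinity. -/
theorem IsClopenSubcone.eq_puncturedCone (hd : 3 ≤ d) (hn : 2 ≤ n) (hF : F.IsHomogeneous n)
    (hX : IsSmoothHypersurface F) (he : MvPolynomial.eval e F ≠ 0) {A : Set (Fin d → ℂ)}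
    (hA : IsClopenSubcone F A) (hne : A.Nonempty) : A = puncturedCone F := by
  classical
  by_contra hneq
  set B := puncturedCone F \ A with hBdef
  have hB : IsClopenSubcone F B := hA.compl hF
  have hBne : B.Nonempty := by
    rw [Set.nonempty_iff_ne_empty]
    intro h
    exact hneq (hA.subset.antisymm (Set.sdiff_eq_empty.1 h))
  have hAB : Disjoint A B := Set.disjoint_sdiff_right
  obtain ⟨r, hr0, hr⟩ := exists_ne_zero_separable (by omega) hF hX he
  obtain ⟨u, hu⟩ : ∃ u, MvPolynomial.eval u r ≠ 0 := by
    by_contra! h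
    exact hr0 (MvPolynomial.funext fun z => by simpa using h z)
  have he0 : e ≠ 0 := by
    rintro rfl
    have := eval_smul_of_isHomogeneous hF 0 (0 : Fin d → ℂ)
    rw [smul_zero, zero_pow (by omega), zero_mul] at this
    exact he this
  have hue : u ∉ Submodule.span ℂ {e} := by
    intro h
    obtain ⟨μ, rfl⟩ := Submodule.mem_span_singleton.1 h
    have h0 : μ • e + (-μ) • e = 0 := by rw [← add_smul, add_neg_cancel, zero_smul]
    refine add_smul_ne_zero_of_separable hn hF (hr _ hu) (T := -μ) ?_ h0
    rw [h0]
    have := eval_smul_of_isHomogeneous hF 0 (0 : Fin d → ℂ)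
    rwa [smul_zero, zero_pow (by omega), zero_mul] at this
  obtain ⟨c, κ, hκ, hnorm⟩ := exists_norm_ge_on_plane hd he0 hue
  obtain ⟨δ, hδ, hsep⟩ := exists_separation hA hB hAB
  have hen : 0 < ‖e‖ := norm_pos_iff.2 he0
  set Q : ℂ → Finset (ℂ × ℂ) := fun s =>
    lineRootsIn F e A (u + s • c) ×ˢ lineRootsIn F e B (u + s • c) with hQ
  set h : ℂ → ℂ := fun s => ∏ x ∈ Q s, (x.1 - x.2)⁻¹ with hh
  have hu0 : MvPolynomial.eval (u + (0 : ℂ) • c) r ≠ 0 := by simpa using hu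
  set T : Set ℂ := {s | MvPolynomial.eval (u + s • c) r = 0} with hT
  have hTfin : T.Finite := finite_zeros_on_line hu0
  set K : ℝ := ‖e‖ / (δ * κ) with hK
  have hK0 : 0 < K := by positivity
  -- the two parts are separated by an angle, so roots in different parts are at distance at least
  -- proportional to the norm
  have hfac : ∀ s, ∀ x ∈ Q s, x.1 - x.2 ≠ 0 ∧ ‖(x.1 - x.2)⁻¹‖ ≤ K / max 1 ‖s‖ := by
    intro s x hx
    obtain ⟨hx1, hx2⟩ := Finset.mem_product.1 hx
    have hp := (mem_lineRootsIn.1 hx1).2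
    have hq := (mem_lineRootsIn.1 hx2).2
    have h1 := hsep _ hp _ hq
    have h2 : u + s • c + x.1 • e - (u + s • c + x.2 • e) = (x.1 - x.2) • e := by
      rw [sub_smul]; abel
    rw [h2, norm_smul] at h1
    have h3 := (mul_le_mul_of_nonneg_left (hnorm s x.1) hδ.le).trans h1
    have hm : (0 : ℝ) < max 1 ‖s‖ := lt_max_of_lt_left one_pos
    have h4 : 0 < ‖x.1 - x.2‖ := by
      by_contra! h5
      have : ‖x.1 - x.2‖ * ‖e‖ ≤ 0 := mul_nonpos_of_nonpos_of_nonneg h5 hen.le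
      have : 0 < δ * (κ * max 1 ‖s‖) := by positivity
      linarith
    refine ⟨norm_pos_iff.1 h4, ?_⟩
    rw [norm_inv, hK, div_div, inv_eq_one_div, div_le_div_iff₀ h4 (by positivity)]
    nlinarith
  have hcard : ∀ s ∉ T, (Q s).card = (Q 0).card := by
    intro s hs
    rw [hQ, Finset.card_product, Finset.card_product,
      card_lineRootsIn_eq hn hF he hA hr hs hu0, card_lineRootsIn_eq hn hF he hB hr hs hu0]
  have hpos : (Q 0).card ≠ 0 := by
    rw [hQ, Finset.card_product]
    exact mul_ne_zero
      (Finset.card_ne_zero.2 (lineRootsIn_nonempty hn hF he hA hne hr hu0))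
      (Finset.card_ne_zero.2 (lineRootsIn_nonempty hn hF he hB hBne hr hu0))
  have hbound : ∀ s ∉ T, ‖h s‖ ≤ (K / max 1 ‖s‖) ^ (Q 0).card := by
    intro s hs
    rw [hh, norm_prod, ← hcard s hs]
    refine (Finset.prod_le_prod (fun x _ => norm_nonneg _) fun x hx => (hfac s x hx).2).trans ?_
    rw [Finset.prod_const]
  have hdiff : DifferentiableOn ℂ h Tᶜ := by
    intro s hs
    apply DifferentiableAt.differentiableWithinAt
    obtain ⟨g, hg⟩ := exists_sheets hn hF he hA (hr _ hs)
    have hline : Tendsto (fun s : ℂ => u + s • c) (𝓝 s) (𝓝 (u + s • c)) :=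
      (by fun_prop : Continuous fun s : ℂ => u + s • c).tendsto s
    have hev := hline.eventually hg
    have heq : h =ᶠ[𝓝 s] fun t => ∏ x ∈ Q s, (g x.1 (u + t • c) - g x.2 (u + t • c))⁻¹ := by
      filter_upwards [hev] with t ht
      have hQt : Q t = (Q s).image (fun x => (g x.1 (u + t • c), g x.2 (u + t • c))) := by
        simp only [hQ]
        rw [ht.2.2.1, ht.2.2.2]
        ext ⟨a, b⟩
        simp only [Finset.mem_product, Finset.mem_image, Prod.exists, Prod.mk.injEq]
        constructor
        · rintro ⟨⟨x, hx, rfl⟩, ⟨y, hy, rfl⟩⟩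
          exact ⟨x, y, ⟨hx, hy⟩, rfl, rfl⟩
        · rintro ⟨x, y, ⟨hx, hy⟩, rfl, rfl⟩
          exact ⟨⟨x, hx, rfl⟩, ⟨y, hy, rfl⟩⟩
      simp only [hh]
      rw [hQt, Finset.prod_image]
      rintro ⟨x, y⟩ hx ⟨x', y'⟩ hx' hxx
      simp only [Prod.mk.injEq] at hxx
      have hm := Finset.mem_product.1 hx
      have hm' := Finset.mem_product.1 hx'
      exact Prod.ext
        (ht.2.1 (mem_lineRootsIn.1 hm.1).1 (mem_lineRootsIn.1 hm'.1).1 hxx.1)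
        (ht.2.1 (mem_lineRootsIn.1 hm.2).1 (mem_lineRootsIn.1 hm'.2).1 hxx.2)
    refine DifferentiableAt.congr_of_eventuallyEq ?_ heq
    have hgl : ∀ τ ∈ lineRoots F e (u + s • c),
        DifferentiableAt ℂ (fun t : ℂ => g τ (u + t • c)) s := by
      intro τ hτ
      have h1 := hev.self_of_nhds.1 τ hτ
      exact DifferentiableAt.comp s h1 (by fun_prop)
    -- at `s` itself the sheets are a permutation of the roots, so the differences do not vanish
    have hne0 : ∀ x ∈ Q s, g x.1 (u + s • c) - g x.2 (u + s • c) ≠ 0 := by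
      intro x hx
      have hm := Finset.mem_product.1 hx
      rw [sub_ne_zero]
      intro hcon
      have hx12 := hev.self_of_nhds.2.1 (mem_lineRootsIn.1 hm.1).1 (mem_lineRootsIn.1 hm.2).1 hcon
      exact (hfac s x hx).1 (sub_eq_zero.2 hx12)
    refine DifferentiableAt.fun_finsetProd fun x hx => ?_
    have hm := Finset.mem_product.1 hx
    exact ((hgl x.1 (mem_lineRootsIn.1 hm.1).1).sub
      (hgl x.2 (mem_lineRootsIn.1 hm.2).1)).inv (hne0 x hx)
  obtain ⟨G, hG, hGh⟩ := exists_entire_extension T hTfin h (K ^ (Q 0).card) hdiff (by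
    intro s hs
    refine (hbound s hs).trans ?_
    gcongr
    exact div_le_self hK0.le (le_max_left _ _))
  have hlim : Tendsto G (cocompact ℂ) (𝓝 0) := by
    have h1 : ∀ᶠ s in cocompact ℂ, s ∉ T := hTfin.isCompact.compl_mem_cocompact
    have h2 : Tendsto (fun s : ℂ => (K / max 1 ‖s‖) ^ (Q 0).card) (cocompact ℂ) (𝓝 0) := by
      have h3 : Tendsto (fun s : ℂ => max 1 ‖s‖) (cocompact ℂ) atTop :=
        tendsto_atTop_mono (fun s => le_max_right _ _) (tendsto_norm_cocompact_atTop)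
      have h4 := (h3.const_div_atTop K).pow (Q 0).card
      rwa [zero_pow hpos] at h4
    refine squeeze_zero_norm' ?_ h2
    filter_upwards [h1] with s hs
    rw [hGh s hs]
    exact hbound s hs
  have hzero := hG.apply_eq_of_tendsto_cocompact 0 hlim
  rw [hGh 0 hu0] at hzero
  exact Finset.prod_ne_zero_iff.2 (fun x hx => inv_ne_zero (hfac 0 x hx).1) hzero

end

/-! ### Propagation of smallness along the cone -/

section

variable {d n : ℕ} {F : MvPolynomial (Fin d) ℂ}

/-- At a smooth point the cone is the image of a hyperplane `L = 0` under a local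
biholomorphism `φ` with inverse `Ψ`. -/
lemma exists_chart {z₀ : Fin d → ℂ} (hz₀ : fderiv ℂ (fun w => MvPolynomial.eval w F) z₀ ≠ 0) :
    ∃ (Ψ φ : (Fin d → ℂ) → (Fin d → ℂ)) (L : (Fin d → ℂ) →L[ℂ] ℂ) (ρ : ℝ)
      (W : Set (Fin d → ℂ)) (y₀ : Fin d → ℂ), 0 < ρ ∧ W ∈ 𝓝 z₀ ∧
      (∀ y ∈ Metric.ball y₀ ρ, DifferentiableAt ℂ φ y ∧ ‖φ y‖ ≤ ‖z₀‖ + 1 ∧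
        (L y = 0 → MvPolynomial.eval (φ y) F = 0)) ∧
      ∀ z ∈ W, Ψ z ∈ Metric.ball y₀ (ρ / 8) ∧ φ (Ψ z) = z ∧
        (MvPolynomial.eval z F = 0 → L (Ψ z) = 0) := by
  set L := fderiv ℂ (fun w => MvPolynomial.eval w F) z₀ with hL
  obtain ⟨v, hv⟩ : ∃ v, L v = 1 := by
    obtain ⟨w, hw⟩ : ∃ w, L w ≠ 0 := by
      by_contra! h; exact hz₀ (ContinuousLinearMap.ext h)
    exact ⟨(L w)⁻¹ • w, by rw [map_smul, smul_eq_mul, inv_mul_cancel₀ hw]⟩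
  -- `Ψ` moves `z` in the direction `v` until `L` takes the value `F z`
  let Ψ : (Fin d → ℂ) → (Fin d → ℂ) := fun z => z + (MvPolynomial.eval z F - L z) • v
  have hΨd : HasFDerivAt Ψ ((ContinuousLinearEquiv.refl ℂ (Fin d → ℂ) : (Fin d → ℂ) ≃L[ℂ] _) :
      (Fin d → ℂ) →L[ℂ] (Fin d → ℂ)) z₀ := by
    have h1 := (hasFDerivAt_id (𝕜 := ℂ) z₀).add
      (((differentiable_eval F z₀).hasFDerivAt.sub L.hasFDerivAt).smul_const v)
    refine HasFDerivAt.congr_fderiv h1 ?_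
    rw [← hL, sub_self]
    ext x
    simp
  have hΨc : ContDiffAt ℂ 1 Ψ z₀ := by
    have h1 : ContDiffAt ℂ 1 (fun z : Fin d → ℂ => MvPolynomial.eval z F) z₀ :=
      (AnalyticOnNhd.eval_mvPolynomial F z₀ (Set.mem_univ _)).contDiffAt
    exact contDiffAt_id.add ((h1.sub L.contDiff.contDiffAt).smul contDiffAt_const)
  have hs := hΨc.hasStrictFDerivAt' hΨd one_ne_zero
  let φ := hs.localInverse Ψ _ z₀
  have hφc : ContDiffAt ℂ 1 φ (Ψ z₀) := hΨc.to_localInverse hΨd one_ne_zero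
  have hLΨ : ∀ z, L (Ψ z) = MvPolynomial.eval z F := by
    intro z
    simp [Ψ, hv]
  have e1 : ∀ᶠ y in 𝓝 (Ψ z₀), DifferentiableAt ℂ φ y :=
    (hφc.eventually (by simp)).mono fun y hy => hy.differentiableAt one_ne_zero
  have e2 : ∀ᶠ y in 𝓝 (Ψ z₀), ‖φ y‖ < ‖z₀‖ + 1 := by
    have := (hs.localInverse_tendsto).norm
    exact this.eventually (gt_mem_nhds (by linarith))
  obtain ⟨ρ, hρ, hball⟩ := Metric.eventually_nhds_iff_ball.1 (e1.and (e2.and hs.eventually_right_inverse))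
  have e3 : ∀ᶠ z in 𝓝 z₀, Ψ z ∈ Metric.ball (Ψ z₀) (ρ / 8) :=
    hΨd.continuousAt.eventually (Metric.ball_mem_nhds _ (by positivity))
  refine ⟨Ψ, φ, L, ρ, _, Ψ z₀, hρ, e3.and hs.eventually_left_inverse, ?_, ?_⟩
  · intro y hy
    obtain ⟨h1, h2, h3⟩ := hball y hy
    refine ⟨h1, h2.le, fun h => ?_⟩
    rw [← hLΨ, h3, h]
  · rintro z ⟨h1, h2⟩
    exact ⟨h1, h2, fun h => by rw [hLΨ, h]⟩

lemma norm_eval_le_pow {m : ℕ} {P : MvPolynomial (Fin d) ℂ} (hF : F.IsHomogeneous n)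
    (hP : P.IsHomogeneous m) {M : ℝ}
    (h1 : ∀ w, MvPolynomial.eval w F = 0 → ‖w‖ ≤ 1 → ‖MvPolynomial.eval w P‖ ≤ M)
    {R : ℝ} (hR : 1 ≤ R) {w : Fin d → ℂ} (hw : MvPolynomial.eval w F = 0) (hwR : ‖w‖ ≤ R) :
    ‖MvPolynomial.eval w P‖ ≤ R ^ m * M := by
  have hR0 : (0 : ℝ) < R := by linarith
  have hRc : (R : ℂ) ≠ 0 := by exact_mod_cast hR0.ne'
  have h2 := h1 ((R : ℂ)⁻¹ • w) (by rw [eval_smul_of_isHomogeneous hF, hw, mul_zero]) (by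
    rw [norm_smul, norm_inv, Complex.norm_real, Real.norm_of_nonneg hR0.le, inv_mul_le_iff₀ hR0]
    simpa using hwR)
  have h3 : w = (R : ℂ) • ((R : ℂ)⁻¹ • w) := by rw [smul_smul, mul_inv_cancel₀ hRc, one_smul]
  rw [h3, eval_smul_of_isHomogeneous hP, norm_mul, norm_pow, Complex.norm_real,
    Real.norm_of_nonneg hR0.le]
  exact mul_le_mul_of_nonneg_left h2 (by positivity)

/-- The homogeneous polynomials that are bounded by `1` on the part of the cone in the unit ball are
controlled near `z` by their size `S P`, up to a factor that is exponential in the degree and an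
interpolation exponent `θ`. -/
def IsControlledAt (F : MvPolynomial (Fin d) ℂ) (S : MvPolynomial (Fin d) ℂ → ℝ)
    (z : Fin d → ℂ) : Prop :=
  ∃ N ∈ 𝓝 z, ∃ C θ : ℝ, 1 ≤ C ∧ 0 < θ ∧ θ ≤ 1 ∧
    ∀ (m : ℕ) (P : MvPolynomial (Fin d) ℂ), P.IsHomogeneous m →
      (∀ w, MvPolynomial.eval w F = 0 → ‖w‖ ≤ 1 → ‖MvPolynomial.eval w P‖ ≤ 1) →
      ∀ w ∈ N, MvPolynomial.eval w F = 0 → ‖MvPolynomial.eval w P‖ ≤ C ^ (m + 1) * S P ^ θ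

variable {S : MvPolynomial (Fin d) ℂ → ℝ}

lemma IsControlledAt.eventually {z : Fin d → ℂ} (h : IsControlledAt F S z) :
    ∀ᶠ w in 𝓝 z, IsControlledAt F S w := by
  obtain ⟨N, hN, C, θ, h⟩ := h
  exact (eventually_mem_nhds_iff.2 hN).mono fun w hw => ⟨N, hw, C, θ, h⟩

lemma IsControlledAt.smul (hF : F.IsHomogeneous n) {z : Fin d → ℂ}
    (h : IsControlledAt F S z) {c : ℂ} (hc : c ≠ 0) : IsControlledAt F S (c • z) := by
  obtain ⟨N, hN, C, θ, hC, hθ, hθ1, h⟩ := h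
  have hcont : Tendsto (fun w : Fin d → ℂ => c⁻¹ • w) (𝓝 (c • z)) (𝓝 z) := by
    have := (continuous_const_smul c⁻¹ : Continuous fun w : Fin d → ℂ => c⁻¹ • w).tendsto (c • z)
    rwa [smul_smul, inv_mul_cancel₀ hc, one_smul] at this
  refine ⟨_, hcont hN, max 1 ‖c‖ * C, θ,
    one_le_mul_of_one_le_of_one_le (le_max_left _ _) hC, hθ, hθ1, ?_⟩
  intro m P hP hP1 w hw hFw
  have h3 := h m P hP hP1 (c⁻¹ • w) hw (by rw [eval_smul_of_isHomogeneous hF, hFw, mul_zero])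
  have hwc : w = c • (c⁻¹ • w) := by rw [smul_smul, mul_inv_cancel₀ hc, one_smul]
  rw [hwc, eval_smul_of_isHomogeneous hP, norm_mul, norm_pow, mul_pow, mul_assoc]
  have h4 : ‖c‖ ^ m ≤ max 1 ‖c‖ ^ (m + 1) :=
    (pow_le_pow_left₀ (norm_nonneg _) (le_max_right _ _) m).trans
      (pow_le_pow_right₀ (le_max_left _ _) (Nat.le_succ m))
  exact mul_le_mul h4 h3 (norm_nonneg _) (by positivity)

/-- Control propagates from every point of the cone sufficiently near to a smooth point `z₀`
to `z₀`, by the three circles inequality on complex lines in a chart. -/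
lemma IsControlledAt.propagate (hF : F.IsHomogeneous n) (hS : ∀ P, 0 ≤ S P) {z₀ : Fin d → ℂ}
    (hz₀ : fderiv ℂ (fun w => MvPolynomial.eval w F) z₀ ≠ 0) :
    ∀ᶠ z₁ in 𝓝 z₀, MvPolynomial.eval z₁ F = 0 → IsControlledAt F S z₁ → IsControlledAt F S z₀ := by
  obtain ⟨Ψ, φ, L, ρ, W, y₀, hρ, hW, hφ, hΨ⟩ := exists_chart hz₀
  filter_upwards [hW] with z₁ hz₁ hFz₁ ⟨N, hN, C, θ, hC, hθ, hθ1, h⟩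
  obtain ⟨hy₁, hφ₁, hL₁⟩ := hΨ z₁ hz₁
  set y₁ := Ψ z₁ with hy₁def
  have hy₁ρ : y₁ ∈ Metric.ball y₀ ρ := Metric.ball_subset_ball (by linarith) hy₁
  have hcont := (hφ y₁ hy₁ρ).1.continuousAt
  have hN' : φ ⁻¹' N ∈ 𝓝 y₁ := hcont (by rwa [hφ₁])
  obtain ⟨η, hη, hηN⟩ := Metric.mem_nhds_iff.1 hN'
  set δ : ℝ := min (1 / 2) (2 * η / ρ) with hδ
  have hδ0 : 0 < δ := lt_min (by norm_num) (by positivity)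
  have hδ1 : δ < 1 := (min_le_left _ _).trans_lt (by norm_num)
  obtain ⟨σ, hσ0, hσ1, hσ⟩ := exists_three_circles hδ0 hδ1
  set R : ℝ := ‖z₀‖ + 1 with hR
  have hR1 : 1 ≤ R := by rw [hR]; linarith [norm_nonneg z₀]
  refine ⟨W, hW, C * R, θ * (1 - σ), one_le_mul_of_one_le_of_one_le hC hR1,
    mul_pos hθ (by linarith), by nlinarith, ?_⟩
  intro m P hP hP1 z hz hFz
  obtain ⟨hy, hφz, hLz⟩ := hΨ z hz
  set y := Ψ z with hydef
  have hdist : ‖y - y₁‖ < ρ / 4 := by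
    have h1 := dist_triangle_right y y₁ y₀
    rw [dist_eq_norm] at h1
    have h2 : dist y y₀ < ρ / 8 := hy
    have h3 : dist y₁ y₀ < ρ / 8 := hy₁
    linarith
  -- the chart maps the disc `‖τ‖ ≤ δ` of the line `y₁ + τ (y - y₁)` into `N`, and `τ = 1` to `z`
  let ℓ : ℂ → (Fin d → ℂ) := fun τ => y₁ + τ • (y - y₁)
  have hℓ : ∀ τ ∈ Metric.ball (0 : ℂ) 3, ℓ τ ∈ Metric.ball y₀ ρ := by
    intro τ hτ
    rw [mem_ball_zero_iff] at hτ
    have h3 : dist y₁ y₀ < ρ / 8 := hy₁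
    have h4 : dist (ℓ τ) y₁ = ‖τ‖ * ‖y - y₁‖ := by
      rw [dist_eq_norm, add_sub_cancel_left, norm_smul]
    have h5 : ‖τ‖ * ‖y - y₁‖ ≤ 3 * (ρ / 4) :=
      mul_le_mul hτ.le hdist.le (norm_nonneg _) (by norm_num)
    have h6 := dist_triangle (ℓ τ) y₁ y₀
    rw [Metric.mem_ball]
    linarith
  have hℓL : ∀ τ, L (ℓ τ) = 0 := by
    intro τ
    simp only [ℓ, map_add, map_smul, map_sub, hL₁ hFz₁, hLz hFz]
    simp
  have hd : DifferentiableOn ℂ (fun τ => MvPolynomial.eval (φ (ℓ τ)) P) (Metric.ball 0 3) := by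
    intro τ hτ
    apply DifferentiableAt.differentiableWithinAt
    have h1 : DifferentiableAt ℂ ℓ τ := by fun_prop
    have h2 : DifferentiableAt ℂ (fun w => MvPolynomial.eval w P) (φ (ℓ τ)) :=
      differentiable_eval P _
    have h3 : DifferentiableAt ℂ (fun τ => φ (ℓ τ)) τ :=
      DifferentiableAt.comp τ (hφ _ (hℓ τ hτ)).1 h1
    have h4 := h2.comp τ h3
    exact h4
  have hM : ∀ τ ∈ Metric.ball (0 : ℂ) 3, ‖MvPolynomial.eval (φ (ℓ τ)) P‖ ≤ R ^ m * 1 := fun τ hτ =>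
    norm_eval_le_pow hF hP hP1 hR1 ((hφ _ (hℓ τ hτ)).2.2 (hℓL τ)) (hφ _ (hℓ τ hτ)).2.1
  have hε : ∀ τ : ℂ, ‖τ‖ ≤ δ → ‖MvPolynomial.eval (φ (ℓ τ)) P‖ ≤ C ^ (m + 1) * S P ^ θ := by
    intro τ hτ
    have hτ3 : τ ∈ Metric.ball (0 : ℂ) 3 := by
      rw [mem_ball_zero_iff]; linarith
    refine h m P hP hP1 _ (hηN ?_) ((hφ _ (hℓ τ hτ3)).2.2 (hℓL τ))
    rw [Metric.mem_ball, dist_eq_norm, add_sub_cancel_left, norm_smul]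
    have h1 : ‖τ‖ * ‖y - y₁‖ ≤ 2 * η / ρ * (ρ / 4) :=
      mul_le_mul (hτ.trans (min_le_right _ _)) hdist.le (norm_nonneg _) (by positivity)
    have h2 : 2 * η / ρ * (ρ / 4) = η / 2 := by field_simp; norm_num
    linarith
  have key := hσ _ _ _ hd hM hε
  have hℓ1 : φ (ℓ 1) = z := by simp only [ℓ, one_smul, add_sub_cancel, hφz]
  rw [hℓ1, mul_one] at key
  refine key.trans ?_
  have hSθ : 0 ≤ S P ^ θ := Real.rpow_nonneg (hS P) θ
  rw [Real.mul_rpow (by positivity) hSθ, ← Real.rpow_mul (hS P), mul_pow, mul_assoc,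
    mul_assoc, mul_comm (S P ^ _)]
  have h1 : (C ^ (m + 1)) ^ (1 - σ) ≤ C ^ (m + 1) :=
    Real.rpow_le_self_of_one_le (one_le_pow₀ hC) (by linarith)
  have h2 : (R ^ m) ^ σ ≤ R ^ (m + 1) :=
    (Real.rpow_le_self_of_one_le (one_le_pow₀ hR1) hσ1.le).trans
      (pow_le_pow_right₀ hR1 (Nat.le_succ m))
  have h3 : 0 ≤ S P ^ (θ * (1 - σ)) := Real.rpow_nonneg (hS P) _
  gcongr

/-- By connectedness, control at one point spreads over the whole cone. -/
lemma IsControlledAt.forall_mem (hd : 3 ≤ d) (hn : 2 ≤ n) (hF : F.IsHomogeneous n)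
    (hX : IsSmoothHypersurface F) {e : Fin d → ℂ} (he : MvPolynomial.eval e F ≠ 0)
    (hS : ∀ P, 0 ≤ S P) {z₀ : Fin d → ℂ} (hz₀ : z₀ ∈ puncturedCone F)
    (h : IsControlledAt F S z₀) : ∀ z ∈ puncturedCone F, IsControlledAt F S z := by
  have hA : IsClopenSubcone F {z | z ∈ puncturedCone F ∧ IsControlledAt F S z} :=
    { subset := fun z hz => hz.1
      isOpen := fun z hz => hz.2.eventually.mono fun w hw hc => ⟨hc, hw⟩
      isClosed := by
        rintro z ⟨hz, hz'⟩
        filter_upwards [IsControlledAt.propagate hF hS (hX.fderiv_ne_zero hz.1 hz.2)] with w hw hw'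
        exact hz' ⟨hz, hw hw'.1.2 hw'.2⟩
      smul_mem := fun z hz c hc => ⟨smul_mem_puncturedCone hF hz.1 hc, hz.2.smul hF hc⟩ }
  have := hA.eq_puncturedCone hd hn hF hX he ⟨z₀, hz₀, h⟩
  intro z hz
  rw [← this] at hz
  exact hz.2

/-- Control at every point of the cone gives a linear estimate of the maximum on the cone in the unit
ball: the interpolation exponent disappears on normalizing the maximum. -/
lemma exists_norm_eval_le_of_isControlledAt (hF : F.IsHomogeneous n)
    (hS : ∀ P, 0 ≤ S P) (hSsmul : ∀ (c : ℂ) P, S (c • P) = ‖c‖ * S P)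
    {z₀ : Fin d → ℂ} (hz₀ : z₀ ∈ puncturedCone F)
    (h : ∀ z ∈ puncturedCone F, IsControlledAt F S z) :
    ∃ C : ℝ, 1 ≤ C ∧ ∀ (m : ℕ) (P : MvPolynomial (Fin d) ℂ), P.IsHomogeneous m →
      ∀ w, MvPolynomial.eval w F = 0 → ‖w‖ ≤ 1 → ‖MvPolynomial.eval w P‖ ≤ C ^ (m + 1) * S P := by
  have hcl : IsClosed {z : Fin d → ℂ | MvPolynomial.eval z F = 0} :=
    isClosed_eq (continuous_eval F) continuous_const
  have hK : IsCompact ({z : Fin d → ℂ | MvPolynomial.eval z F = 0} ∩ Metric.sphere 0 1) :=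
    (isCompact_sphere _ _).inter_left hcl
  obtain ⟨C, θ, hC, hθ, hθ1, hb⟩ : ∃ C θ : ℝ, 1 ≤ C ∧ 0 < θ ∧ θ ≤ 1 ∧
      ∀ (m : ℕ) (P : MvPolynomial (Fin d) ℂ), P.IsHomogeneous m →
      (∀ w, MvPolynomial.eval w F = 0 → ‖w‖ ≤ 1 → ‖MvPolynomial.eval w P‖ ≤ 1) →
      ∀ w ∈ {z : Fin d → ℂ | MvPolynomial.eval z F = 0} ∩ Metric.sphere 0 1,
        ‖MvPolynomial.eval w P‖ ≤ C ^ (m + 1) * S P ^ θ := by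
    refine hK.induction_on (p := fun s => ∃ C θ : ℝ, 1 ≤ C ∧ 0 < θ ∧ θ ≤ 1 ∧
      ∀ (m : ℕ) (P : MvPolynomial (Fin d) ℂ), P.IsHomogeneous m →
      (∀ w, MvPolynomial.eval w F = 0 → ‖w‖ ≤ 1 → ‖MvPolynomial.eval w P‖ ≤ 1) →
      ∀ w ∈ s ∩ ({z : Fin d → ℂ | MvPolynomial.eval z F = 0} ∩ Metric.sphere 0 1),
        ‖MvPolynomial.eval w P‖ ≤ C ^ (m + 1) * S P ^ θ) ?_ ?_ ?_ ?_ |>.imp fun C => ?_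
    · exact ⟨1, 1, le_rfl, one_pos, le_rfl, by simp⟩
    · rintro s t hst ⟨C, θ, h1, h2, h3, h4⟩
      exact ⟨C, θ, h1, h2, h3, fun m P hP hP1 w hw => h4 m P hP hP1 w ⟨hst hw.1, hw.2⟩⟩
    · rintro s t ⟨C, θ, h1, h2, h3, h4⟩ ⟨C', θ', h1', h2', h3', h4'⟩
      refine ⟨max C C', min θ θ', h1.trans (le_max_left _ _), lt_min h2 h2',
        (min_le_left _ _).trans h3, fun m P hP hP1 w hw => ?_⟩
      have hCC : 1 ≤ max C C' := h1.trans (le_max_left _ _)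
      -- when `S P > 1` the bound by `1` is better than what is claimed
      by_cases hS1 : S P ≤ 1
      · have hpow : ∀ a : ℝ, min θ θ' ≤ a → S P ^ a ≤ S P ^ min θ θ' := fun a ha =>
          Real.rpow_le_rpow_of_exponent_ge_of_imp (hS P) hS1 ha
            (fun _ h => absurd h ((lt_min h2 h2').trans_le ha).ne')
        have hSn := hS P
        rcases hw.1 with hs | ht
        · refine (h4 m P hP hP1 w ⟨hs, hw.2⟩).trans ?_
          have := hpow θ (min_le_left _ _)
          have h5 : 0 ≤ S P ^ θ := Real.rpow_nonneg hSn _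
          gcongr
          exact le_max_left _ _
        · refine (h4' m P hP hP1 w ⟨ht, hw.2⟩).trans ?_
          have := hpow θ' (min_le_right _ _)
          have h5 : 0 ≤ S P ^ θ' := Real.rpow_nonneg hSn _
          gcongr
          exact le_max_right _ _
      · push Not at hS1
        have hwn : ‖w‖ ≤ 1 := by
          have := hw.2.2; rw [mem_sphere_zero_iff_norm] at this; exact this.le
        refine (hP1 w hw.2.1 hwn).trans ?_
        exact one_le_mul_of_one_le_of_one_le (one_le_pow₀ hCC)
          (Real.one_le_rpow hS1.le (lt_min h2 h2').le)
    · intro z hz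
      have hz0 : z ≠ 0 := by
        rintro rfl; simpa using hz.2
      obtain ⟨N, hN, C, θ, h1, h2, h3, h4⟩ := h z ⟨hz0, hz.1⟩
      exact ⟨N, mem_nhdsWithin_of_mem_nhds hN, C, θ, h1, h2, h3,
        fun m P hP hP1 w hw => h4 m P hP hP1 w hw.1 hw.2.1⟩
    · rintro ⟨θ, h1, h2, h3, h4⟩
      exact ⟨θ, h1, h2, h3, fun m P hP hP1 w hw => h4 m P hP hP1 w ⟨hw, hw⟩⟩
  -- the estimate on the sphere extends to the ball by homogeneity
  have hb' : ∀ (m : ℕ) (P : MvPolynomial (Fin d) ℂ), P.IsHomogeneous m →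
      (∀ w, MvPolynomial.eval w F = 0 → ‖w‖ ≤ 1 → ‖MvPolynomial.eval w P‖ ≤ 1) →
      ∀ w, MvPolynomial.eval w F = 0 → ‖w‖ ≤ 1 →
        ‖MvPolynomial.eval w P‖ ≤ C ^ (m + 1) * S P ^ θ := by
    intro m P hP hP1 w hw hw1
    obtain ⟨w', hw', c, hc, rfl⟩ : ∃ w' ∈ {z : Fin d → ℂ | MvPolynomial.eval z F = 0} ∩
        Metric.sphere 0 1, ∃ c : ℂ, ‖c‖ ≤ 1 ∧ w = c • w' := by
      have hnormalize : ∀ x : Fin d → ℂ, x ≠ 0 → MvPolynomial.eval x F = 0 →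
          ((‖x‖⁻¹ : ℝ) : ℂ) • x ∈ {z : Fin d → ℂ | MvPolynomial.eval z F = 0} ∩
            Metric.sphere 0 1 := by
        intro x hx hFx
        refine ⟨?_, ?_⟩
        · change MvPolynomial.eval _ F = 0
          rw [eval_smul_of_isHomogeneous hF, hFx, mul_zero]
        · rw [mem_sphere_zero_iff_norm, norm_smul, Complex.norm_real, norm_inv, norm_norm,
            inv_mul_cancel₀ (norm_ne_zero_iff.2 hx)]
      by_cases hw0 : w = 0
      · exact ⟨_, hnormalize z₀ hz₀.1 hz₀.2, 0, by simp, by rw [hw0, zero_smul]⟩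
      · refine ⟨_, hnormalize w hw0 hw, (‖w‖ : ℂ), by simpa using hw1, ?_⟩
        rw [smul_smul, ← Complex.ofReal_mul, mul_inv_cancel₀ (norm_ne_zero_iff.2 hw0)]
        simp
    rw [eval_smul_of_isHomogeneous hP, norm_mul, norm_pow]
    exact (mul_le_of_le_one_left (norm_nonneg _) (pow_le_one₀ (norm_nonneg _) hc)).trans
      (hb m P hP hP1 w' hw')
  have hC0 : 0 < C := by linarith
  -- if the maximum of `P` is `1`, then `1 ≤ C ^ (m + 1) * S P ^ θ`, and a root of order `θ` can be taken
  refine ⟨C ^ (1 / θ), Real.one_le_rpow hC (by positivity), fun m P hP w hw hw1 => ?_⟩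
  have hball : IsCompact ({z : Fin d → ℂ | MvPolynomial.eval z F = 0} ∩ Metric.closedBall 0 1) :=
    (isCompact_closedBall _ _).inter_left hcl
  obtain ⟨w₀, hw₀, hmax⟩ := hball.exists_isMaxOn ⟨w, hw, by simpa using hw1⟩
    (continuous_eval P).norm.continuousOn
  set M := ‖MvPolynomial.eval w₀ P‖ with hM
  have hle : ∀ x, MvPolynomial.eval x F = 0 → ‖x‖ ≤ 1 → ‖MvPolynomial.eval x P‖ ≤ M :=
    fun x hx hx1 => hmax ⟨hx, by simpa using hx1⟩
  refine (hle w hw hw1).trans ?_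
  rcases (norm_nonneg (MvPolynomial.eval w₀ P)).eq_or_lt with hM0 | hM0
  · rw [hM, ← hM0]
    exact mul_nonneg (by positivity) (hS P)
  · have hMc : ‖((M⁻¹ : ℝ) : ℂ)‖ = M⁻¹ := by
      rw [Complex.norm_real, Real.norm_of_nonneg (inv_nonneg.2 hM0.le)]
    have h1 := hb' m (((M⁻¹ : ℝ) : ℂ) • P)
      (by rw [MvPolynomial.smul_eq_C_mul]; simpa using (MvPolynomial.isHomogeneous_C _ _).mul hP)
      (fun x hx hx1 => by
        rw [MvPolynomial.smul_eval, norm_mul, hMc, inv_mul_le_iff₀ hM0, mul_one]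
        exact hle x hx hx1) w₀ hw₀.1 (by simpa using hw₀.2)
    rw [MvPolynomial.smul_eval, norm_mul, hMc, ← hM, inv_mul_cancel₀ hM0.ne', hSsmul, hMc] at h1
    have hSP := hS P
    have h2 := Real.rpow_le_rpow zero_le_one h1 (by positivity : (0 : ℝ) ≤ 1 / θ)
    rw [Real.one_rpow, Real.mul_rpow (by positivity) (by positivity), ← Real.rpow_mul (by positivity),
      mul_one_div_cancel hθ.ne', Real.rpow_one, ← Real.rpow_natCast, ← Real.rpow_mul hC0.le,
      mul_comm ((m + 1 : ℕ) : ℝ), Real.rpow_mul hC0.le, Real.rpow_natCast, inv_mul_eq_div,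
      mul_div_assoc', le_div_iff₀ hM0, one_mul] at h2
    exact h2

end

/-! ### From the mean square on a real cuboid to a complex neighbourhood -/

lemma norm_ofReal_pi {k : ℕ} (x : Fin k → ℝ) : ‖(fun j => (x j : ℂ))‖ = ‖x‖ := by
  simp [Pi.norm_def]

/-- A bounded holomorphic function is Lipschitz along real directions, so its value at a real point
is bounded by its mean square over the cuboid: a value `a` persists, up to a factor of two, on a
cube whose side is proportional to `a`. -/
lemma norm_pow_le_integral {k : ℕ} {f : (Fin k → ℂ) → ℂ} {t₀ : Fin k → ℂ} {ρ M : ℝ} (hρ : 0 < ρ)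
    (hf : DifferentiableOn ℂ f (Metric.ball t₀ (4 * ρ)))
    (hM : ∀ t ∈ Metric.ball t₀ (4 * ρ), ‖f t‖ ≤ M) {x : Fin k → ℝ} (hx : ‖x‖ ≤ ρ / 2) :
    ‖f (shift t₀ x)‖ ^ (k + 2) ≤ 4 * (3 / (2 * ρ)) ^ k * M ^ k *
      ∫ s in Set.Icc (0 : Fin k → ℝ) (fun _ => 2 * ρ), ‖f (shift (fun j => t₀ j - ρ) s)‖ ^ 2 := by
  set I := ∫ s in Set.Icc (0 : Fin k → ℝ) (fun _ => 2 * ρ), ‖f (shift (fun j => t₀ j - ρ) s)‖ ^ 2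
    with hI
  have hsh : ∀ (t : Fin k → ℂ) (y : Fin k → ℝ), shift t y = t + fun j => (y j : ℂ) := fun t y => rfl
  have hmem : ∀ y : Fin k → ℝ, ‖y‖ < 4 * ρ → shift t₀ y ∈ Metric.ball t₀ (4 * ρ) := by
    intro y hy
    rw [Metric.mem_ball, dist_eq_norm, hsh, add_sub_cancel_left, norm_ofReal_pi]
    exact hy
  set a := ‖f (shift t₀ x)‖ with ha
  have haM : a ≤ M := hM _ (hmem x (by linarith))
  have ha0 : 0 ≤ a := norm_nonneg _
  have hI0 : 0 ≤ I := integral_nonneg fun s => by positivity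
  rcases ha0.eq_or_lt with h0 | ha0
  · rw [← h0, zero_pow (by omega)]
    have : 0 ≤ M := h0 ▸ haM
    positivity
  have hM0 : 0 < M := ha0.trans_le haM
  set β := a * ρ / (3 * M) with hβ
  have hβ0 : 0 < β := by positivity
  have hβρ : β ≤ ρ / 3 := by
    rw [hβ, div_le_div_iff₀ (by positivity) (by norm_num)]
    nlinarith
  have hlow : ∀ y ∈ Metric.ball x β, a / 2 ≤ ‖f (shift t₀ y)‖ := by
    intro y hy
    rw [Metric.mem_ball, dist_eq_norm] at hy
    by_cases hyx : y = x
    · rw [hyx, ← ha]; linarith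
    have hv : 0 < ‖y - x‖ := norm_pos_iff.2 (sub_ne_zero.2 hyx)
    let v : Fin k → ℂ := fun j => ((y - x) j : ℂ)
    have hvn : ‖v‖ = ‖y - x‖ := norm_ofReal_pi (y - x)
    set g : ℂ → ℂ := fun τ => f (shift t₀ x + τ • v) with hg
    have hgm : ∀ τ ∈ Metric.ball (0 : ℂ) (2 * ρ / ‖y - x‖),
        shift t₀ x + τ • v ∈ Metric.ball t₀ (4 * ρ) := by
      intro τ hτ
      rw [mem_ball_zero_iff, lt_div_iff₀ hv] at hτ
      rw [Metric.mem_ball, dist_eq_norm, hsh]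
      have h1 : t₀ + (fun j => (x j : ℂ)) + τ • v - t₀ = (fun j => (x j : ℂ)) + τ • v := by abel
      rw [h1]
      refine (norm_add_le _ _).trans_lt ?_
      rw [norm_ofReal_pi, norm_smul, hvn]
      linarith
    have hgd : DifferentiableOn ℂ g (Metric.ball 0 (2 * ρ / ‖y - x‖)) := by
      refine hf.comp (f := fun τ : ℂ => shift t₀ x + τ • v) ?_ hgm
      fun_prop
    have h0 : g 0 = f (shift t₀ x) := by simp [hg]
    have h1 : g 1 = f (shift t₀ y) := by
      simp only [hg, one_smul, hsh]
      congr 1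
      ext j
      simp [v]
    have hlip := Complex.dist_le_div_mul_dist_of_mapsTo_ball (f := g) (c := 0)
      (R₁ := 2 * ρ / ‖y - x‖) (R₂ := 3 * M) (z := 1) hgd (by
        intro τ hτ
        rw [Metric.mem_closedBall, dist_eq_norm]
        refine (norm_sub_le _ _).trans ?_
        have h2 : ‖g τ‖ ≤ M := hM _ (hgm τ hτ)
        have h3 : ‖g 0‖ ≤ M := by rw [h0]; exact haM
        linarith) (by
        rw [mem_ball_zero_iff, norm_one, lt_div_iff₀ hv]
        linarith)
    rw [dist_zero_right, norm_one, mul_one, h0, h1, dist_eq_norm] at hlip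
    have h4 : 3 * M / (2 * ρ / ‖y - x‖) ≤ a / 2 := by
      have h5 : 3 * M / (2 * ρ / ‖y - x‖) = 3 * M * ‖y - x‖ / (2 * ρ) := by field_simp
      rw [h5, div_le_div_iff₀ (by positivity) (by norm_num)]
      have h6 : ‖y - x‖ * (3 * M) ≤ a * ρ := by
        rw [hβ, lt_div_iff₀ (by positivity)] at hy
        exact hy.le
      nlinarith
    have h7 := norm_sub_norm_le (f (shift t₀ x)) (f (shift t₀ y))
    rw [norm_sub_rev] at h7
    linarith
  -- the cube around `x`, as seen from the corner of the cuboid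
  set w : Fin k → ℝ := fun j => x j + ρ with hw
  have hballsub : Metric.ball w β ⊆ Set.Icc (0 : Fin k → ℝ) (fun _ => 2 * ρ) := by
    intro s hs
    rw [Metric.mem_ball, dist_pi_lt_iff hβ0] at hs
    refine ⟨fun j => ?_, fun j => ?_⟩ <;>
    · have h1 := hs j
      have h2 : |x j| ≤ ρ / 2 := (norm_le_pi_norm x j).trans hx
      rw [Real.dist_eq, abs_lt] at h1
      rw [abs_le] at h2
      simp only [hw] at h1
      simp only [Pi.zero_apply]
      linarith [h1.1, h1.2, h2.1, h2.2]
  have hlow' : ∀ s ∈ Metric.ball w β, a / 2 ≤ ‖f (shift (fun j => t₀ j - ρ) s)‖ := by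
    intro s hs
    have h1 := hlow (fun j => s j - ρ) (by
      rw [Metric.mem_ball, dist_pi_lt_iff hβ0] at hs ⊢
      intro j
      have := hs j
      rw [Real.dist_eq] at this ⊢
      simp only [hw] at this
      rwa [show s j - ρ - x j = s j - (x j + ρ) by ring])
    have h2 : shift t₀ (fun j => s j - ρ) = shift (fun j => t₀ j - ρ) s := by
      ext j; simp [shift]; ring
    rwa [h2] at h1
  have hcont : ContinuousOn (fun s : Fin k → ℝ => ‖f (shift (fun j => t₀ j - ρ) s)‖ ^ 2)
      (Set.Icc (0 : Fin k → ℝ) (fun _ => 2 * ρ)) := by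
    have hsc : Continuous fun s : Fin k → ℝ => shift (fun j => t₀ j - (ρ : ℂ)) s := by
      unfold shift; fun_prop
    refine ((hf.continuousOn.comp hsc.continuousOn ?_).norm).pow 2
    intro s hs
    have h2 : shift (fun j => t₀ j - (ρ : ℂ)) s = shift t₀ (fun j => s j - ρ) := by
      ext j; simp [shift]; ring
    change shift (fun j => t₀ j - (ρ : ℂ)) s ∈ _
    rw [h2]
    apply hmem
    refine lt_of_le_of_lt ((pi_norm_le_iff_of_nonneg hρ.le).2 fun j => ?_) (by linarith : ρ < 4 * ρ)
    rw [Real.norm_eq_abs, abs_le]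
    have h3 := hs.1 j
    have h4 := hs.2 j
    simp only [Pi.zero_apply] at h3
    constructor <;> linarith
  have hint := hcont.integrableOn_compact (μ := volume) isCompact_Icc
  have hvol : volume.real (Metric.ball w β) = (2 * β) ^ k := by
    rw [Measure.real, Real.volume_pi_ball _ hβ0, ENNReal.toReal_ofReal (by positivity)]
    simp
  have hkey : (a / 2) ^ 2 * (2 * β) ^ k ≤ I := by
    have h1 : ∫ s in Metric.ball w β, (a / 2) ^ 2 ≤
        ∫ s in Metric.ball w β, ‖f (shift (fun j => t₀ j - ρ) s)‖ ^ 2 := by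
      refine setIntegral_mono_on ?_ (hint.mono_set hballsub) measurableSet_ball fun s hs => ?_
      · exact integrableOn_const (by rw [Real.volume_pi_ball _ hβ0]; exact ENNReal.ofReal_ne_top)
      · have := hlow' s hs
        gcongr
    rw [setIntegral_const, hvol, smul_eq_mul, mul_comm] at h1
    exact h1.trans (setIntegral_mono_set hint (Eventually.of_forall fun s => by positivity)
      (Eventually.of_forall hballsub))
  have h1 : a ^ (k + 2) = 4 * (3 / (2 * ρ)) ^ k * M ^ k * ((a / 2) ^ 2 * (2 * β) ^ k) := by
    have h2 : (3 / (2 * ρ)) ^ k * M ^ k * (2 * β) ^ k = a ^ k := by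
      rw [← mul_pow, ← mul_pow]
      congr 1
      rw [hβ]; field_simp
    calc a ^ (k + 2) = a ^ k * a ^ 2 := pow_add _ _ _
      _ = 4 * (a / 2) ^ 2 * ((3 / (2 * ρ)) ^ k * M ^ k * (2 * β) ^ k) := by rw [h2]; ring
      _ = _ := by ring
  rw [h1]
  gcongr

/-- The bound by the mean square extends to a complex neighbourhood: a point `x + i y` lies on the
complexification of the real line through `x` of direction `y`. -/
lemma norm_pow_le_integral_complex {k : ℕ} {f : (Fin k → ℂ) → ℂ} {t₀ : Fin k → ℂ} {ρ M : ℝ}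
    (hρ : 0 < ρ) (hf : DifferentiableOn ℂ f (Metric.ball t₀ (4 * ρ)))
    (hM : ∀ t ∈ Metric.ball t₀ (4 * ρ), ‖f t‖ ≤ M) {t : Fin k → ℂ} (ht : ‖t - t₀‖ ≤ ρ / 8) :
    ‖f t‖ ^ (2 * (k + 2)) ≤ 4 * (3 / (2 * ρ)) ^ k * M ^ (2 * k + 2) *
      ∫ s in Set.Icc (0 : Fin k → ℝ) (fun _ => 2 * ρ), ‖f (shift (fun j => t₀ j - ρ) s)‖ ^ 2 := by
  set I := ∫ s in Set.Icc (0 : Fin k → ℝ) (fun _ => 2 * ρ), ‖f (shift (fun j => t₀ j - ρ) s)‖ ^ 2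
    with hI
  have hI0 : 0 ≤ I := integral_nonneg fun s => by positivity
  have hM0 : 0 ≤ M := (norm_nonneg _).trans (hM t₀ (Metric.mem_ball_self (by positivity)))
  set x : Fin k → ℝ := fun j => (t j - t₀ j).re with hx
  set y : Fin k → ℝ := fun j => (t j - t₀ j).im with hy
  have hxn : ‖x‖ ≤ ρ / 8 := (pi_norm_le_iff_of_nonneg (by positivity)).2 fun j =>
    (Complex.abs_re_le_norm _).trans ((norm_le_pi_norm (t - t₀) j).trans ht)
  have hyn : ‖y‖ ≤ ρ / 8 := (pi_norm_le_iff_of_nonneg (by positivity)).2 fun j =>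
    (Complex.abs_im_le_norm _).trans ((norm_le_pi_norm (t - t₀) j).trans ht)
  let ℓ : ℂ → (Fin k → ℂ) := fun τ => t₀ + (fun j => (x j : ℂ)) + τ • (fun j => (y j : ℂ))
  have hℓ : ∀ τ ∈ Metric.ball (0 : ℂ) 4, ℓ τ ∈ Metric.ball t₀ (4 * ρ) := by
    intro τ hτ
    rw [mem_ball_zero_iff] at hτ
    rw [Metric.mem_ball, dist_eq_norm, show ℓ τ - t₀ = (fun j => (x j : ℂ)) +
      τ • (fun j => (y j : ℂ)) by simp only [ℓ]; abel]
    refine (norm_add_le _ _).trans_lt ?_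
    rw [norm_smul, norm_ofReal_pi, norm_ofReal_pi]
    have : ‖τ‖ * ‖y‖ ≤ 4 * (ρ / 8) := mul_le_mul hτ.le hyn (norm_nonneg _) (by norm_num)
    linarith
  have hd : DifferentiableOn ℂ (fun τ => f (ℓ τ)) (Metric.ball 0 4) := by
    refine hf.comp (f := ℓ) ?_ hℓ
    fun_prop
  set q : ℝ := 4 * (3 / (2 * ρ)) ^ k * M ^ k * I with hq
  have hq0 : 0 ≤ q := by positivity
  have hreal : ∀ u : ℝ, |u| ≤ 1 → ‖f (ℓ u)‖ ≤ q ^ (1 / ((k + 2 : ℕ) : ℝ)) := by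
    intro u hu
    have h1 := norm_pow_le_integral hρ hf hM (x := x + u • y) (by
      refine (norm_add_le _ _).trans ?_
      rw [norm_smul, Real.norm_eq_abs]
      have : |u| * ‖y‖ ≤ 1 * (ρ / 8) := mul_le_mul hu hyn (norm_nonneg _) zero_le_one
      linarith)
    have h2 : shift t₀ (x + u • y) = ℓ u := by
      ext j; simp [shift, ℓ]; ring
    rw [h2] at h1
    have h3 := Real.rpow_le_rpow (by positivity) h1
      (by positivity : (0 : ℝ) ≤ 1 / ((k + 2 : ℕ) : ℝ))
    rwa [one_div, Real.pow_rpow_inv_natCast (norm_nonneg _) (by omega), ← one_div] at h3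
  have key := norm_apply_I_le hd (fun τ hτ => hM _ (hℓ τ hτ)) hreal
  have hℓI : ℓ Complex.I = t := by
    ext j
    have : (t j - t₀ j) = ((t j - t₀ j).re : ℂ) + ((t j - t₀ j).im : ℂ) * Complex.I :=
      (Complex.re_add_im _).symm
    simp only [ℓ, Pi.add_apply, Pi.smul_apply, smul_eq_mul, hx, hy]
    linear_combination -this
  rw [hℓI] at key
  have h4 := pow_le_pow_left₀ (norm_nonneg _) key (2 * (k + 2))
  refine h4.trans (le_of_eq ?_)
  have hsq : ∀ b : ℝ, 0 ≤ b → (b ^ (1 / 2 : ℝ)) ^ 2 = b := by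
    intro b hb
    rw [← Real.sqrt_eq_rpow, Real.sq_sqrt hb]
  rw [pow_mul, mul_pow, hsq _ (Real.rpow_nonneg hq0 _), hsq _ hM0, mul_pow, one_div,
    Real.rpow_inv_natCast_pow hq0 (by omega), hq]
  ring

/-! ### The uniformized part of the cone -/

section

variable {d n : ℕ} {F : MvPolynomial (Fin d) ℂ} {D : Set (Fin (d - 1) → ℂ)}
  {ξ : (Fin (d - 1) → ℂ) → (Fin d → ℂ)}

/-- The multiples of the points `ξ t`, with `t` near `t₀`, fill a neighbourhood of `ξ t₀` in
the cone. -/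
lemma IsUniformization.eventually_eq_smul (hd : 1 ≤ d) (hF : F.IsHomogeneous n)
    (hX : IsSmoothHypersurface F) (hξ : IsUniformization F D ξ) {t₀ : Fin (d - 1) → ℂ}
    (ht₀ : t₀ ∈ D) {T : Set (Fin (d - 1) → ℂ)} (hT : T ∈ 𝓝 t₀) :
    ∀ᶠ z in 𝓝 (ξ t₀), MvPolynomial.eval z F = 0 → ∃ t ∈ T, ∃ μ : ℂ, ‖μ‖ ≤ 2 ∧ z = μ • ξ t := by
  set L := fderiv ℂ (fun w => MvPolynomial.eval w F) (ξ t₀) with hL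
  have hL0 : L ≠ 0 := hX.fderiv_ne_zero (hξ.ne_zero t₀ ht₀) (hξ.mem_hypersurface t₀ ht₀)
  obtain ⟨v, hv⟩ : ∃ v, L v = 1 := by
    obtain ⟨w, hw⟩ : ∃ w, L w ≠ 0 := by
      by_contra! h; exact hL0 (ContinuousLinearMap.ext h)
    exact ⟨(L w)⁻¹ • w, by rw [map_smul, smul_eq_mul, inv_mul_cancel₀ hw]⟩
  have hξs : HasStrictFDerivAt ξ (fderiv ℂ ξ t₀) t₀ := (hξ.analytic t₀ ht₀).hasStrictFDerivAt
  have hFξ := (differentiable_eval F (ξ t₀)).hasFDerivAt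
  -- `L` vanishes on the tangent space of the cone
  have hLξ : L (ξ t₀) = 0 := by
    have h1 : HasDerivAt (fun μ : ℂ => μ • ξ t₀) (ξ t₀) 1 := by
      simpa using (hasDerivAt_id (1 : ℂ)).smul_const (ξ t₀)
    have h2 : HasFDerivAt (fun w => MvPolynomial.eval w F) L ((1 : ℂ) • ξ t₀) := by
      rw [one_smul]; exact hFξ
    have h3 := h2.comp_hasDerivAt (1 : ℂ) h1
    have h4 : HasDerivAt (fun _ : ℂ => (0 : ℂ)) 0 1 := hasDerivAt_const (1 : ℂ) (0 : ℂ)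
    refine h3.unique (h4.congr_of_eventuallyEq (Eventually.of_forall fun μ => ?_))
    simp [eval_smul_of_isHomogeneous hF, hξ.mem_hypersurface t₀ ht₀]
  have hLd : ∀ τ, L (fderiv ℂ ξ t₀ τ) = 0 := by
    intro τ
    have h1 := hFξ.comp t₀ hξs.hasFDerivAt
    have h2 : HasFDerivAt (fun _ : Fin (d - 1) → ℂ => (0 : ℂ))
        (0 : (Fin (d - 1) → ℂ) →L[ℂ] ℂ) t₀ := hasFDerivAt_const _ _
    have h3 := h1.unique (h2.congr_of_eventuallyEq (by
      filter_upwards [hξ.isOpen.mem_nhds ht₀] with t ht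
      exact hξ.mem_hypersurface t ht))
    exact congrArg (fun A : (Fin (d - 1) → ℂ) →L[ℂ] ℂ => A τ) h3
  set W := Submodule.span ℂ {ξ t₀} ⊔ (fderiv ℂ ξ t₀).range with hW
  have hWker : W ≤ L.ker := by
    refine sup_le ?_ ?_
    · rw [Submodule.span_le, Set.singleton_subset_iff]
      exact hLξ
    · rintro _ ⟨τ, rfl⟩
      exact hLd τ
  have htop : W ⊔ Submodule.span ℂ {v} = ⊤ := by
    apply Submodule.eq_top_of_finrank_eq
    have h1 : W < W ⊔ Submodule.span ℂ {v} := by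
      refine lt_of_le_of_ne le_sup_left fun h => ?_
      have hvW : v ∈ W := by
        rw [h]; exact Submodule.mem_sup_right (Submodule.mem_span_singleton_self v)
      have : L v = 0 := hWker hvW
      rw [hv] at this
      exact one_ne_zero this
    have h2 := Submodule.finrank_lt_finrank_of_lt h1
    have h3 := hξ.finrank_tangent t₀ ht₀
    rw [h3] at h2
    have h4 := Submodule.finrank_le (W ⊔ Submodule.span ℂ {v})
    rw [Module.finrank_fin_fun] at h4 ⊢
    omega
  -- `Θ (μ, t, b) = μ ξ(t) + b v` is open at `(1, t₀, 0)`, as its derivative is surjective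
  let Θ : (ℂ × (Fin (d - 1) → ℂ)) × ℂ → (Fin d → ℂ) := fun q => q.1.1 • ξ q.1.2 + q.2 • v
  let q₀ : (ℂ × (Fin (d - 1) → ℂ)) × ℂ := ((1, t₀), 0)
  have hΘ₀ : Θ q₀ = ξ t₀ := by simp [Θ, q₀]
  let A₁ : ((ℂ × (Fin (d - 1) → ℂ)) × ℂ) →L[ℂ] ℂ :=
    (ContinuousLinearMap.fst ℂ ℂ (Fin (d - 1) → ℂ)) ∘L
      (ContinuousLinearMap.fst ℂ (ℂ × (Fin (d - 1) → ℂ)) ℂ)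
  let A₂ : ((ℂ × (Fin (d - 1) → ℂ)) × ℂ) →L[ℂ] (Fin (d - 1) → ℂ) :=
    (ContinuousLinearMap.snd ℂ ℂ (Fin (d - 1) → ℂ)) ∘L
      (ContinuousLinearMap.fst ℂ (ℂ × (Fin (d - 1) → ℂ)) ℂ)
  let A₃ : ((ℂ × (Fin (d - 1) → ℂ)) × ℂ) →L[ℂ] ℂ :=
    ContinuousLinearMap.snd ℂ (ℂ × (Fin (d - 1) → ℂ)) ℂ
  have hp1 : HasStrictFDerivAt (fun q : (ℂ × (Fin (d - 1) → ℂ)) × ℂ => q.1.1) A₁ q₀ :=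
    A₁.hasStrictFDerivAt
  have hp2 : HasStrictFDerivAt (fun q : (ℂ × (Fin (d - 1) → ℂ)) × ℂ => q.1.2) A₂ q₀ :=
    A₂.hasStrictFDerivAt
  have hp3 : HasStrictFDerivAt (fun q : (ℂ × (Fin (d - 1) → ℂ)) × ℂ => q.2) A₃ q₀ :=
    A₃.hasStrictFDerivAt
  have hξq : HasStrictFDerivAt (fun q : (ℂ × (Fin (d - 1) → ℂ)) × ℂ => ξ q.1.2)
      ((fderiv ℂ ξ t₀) ∘L A₂) q₀ := HasStrictFDerivAt.comp q₀ hξs hp2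
  set A : ((ℂ × (Fin (d - 1) → ℂ)) × ℂ) →L[ℂ] (Fin d → ℂ) :=
    A₁.smulRight (ξ t₀) + (fderiv ℂ ξ t₀) ∘L A₂ + A₃.smulRight v with hA
  have hΘ : HasStrictFDerivAt Θ A q₀ := by
    refine ((hp1.smul hξq).add (hp3.smul_const v)).congr_fderiv ?_
    ext1 <;> ext <;> simp [A, A₁, A₂, A₃, q₀]
  have hAapp : ∀ a τ b, A ((a, τ), b) = a • ξ t₀ + fderiv ℂ ξ t₀ τ + b • v := by
    intro a τ b
    simp [A, A₁, A₂, A₃]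
  have hrange : A.range = ⊤ := by
    rw [eq_top_iff, ← htop, hW]
    refine sup_le (sup_le ?_ ?_) ?_
    · rw [Submodule.span_le, Set.singleton_subset_iff]
      exact ⟨((1, 0), 0), by simpa using hAapp 1 0 0⟩
    · rintro _ ⟨τ, rfl⟩
      exact ⟨((0, τ), 0), by simpa using hAapp 0 τ 0⟩
    · rw [Submodule.span_le, Set.singleton_subset_iff]
      exact ⟨((0, 0), 1), by simpa using hAapp 0 0 1⟩
  have hmap := hΘ.map_nhds_eq_of_surj hrange
  rw [hΘ₀] at hmap
  -- near the base point `F (z + b v)` differs from `F z + b` by less than `‖b‖`, so of the points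
  -- `μ ξ(t) + b v` only those with `b = 0` lie on the cone
  have hlo := (hasStrictFDerivAt_eval F (ξ t₀)).isLittleO.def
    (show (0 : ℝ) < 1 / (2 * (‖v‖ + 1)) by positivity)
  have hc1 : Tendsto Θ (𝓝 q₀) (𝓝 (ξ t₀)) := by
    have := hΘ.continuousAt.tendsto
    rwa [hΘ₀] at this
  have hc2 : Tendsto (fun q : (ℂ × (Fin (d - 1) → ℂ)) × ℂ => q.1.1 • ξ q.1.2) (𝓝 q₀)
      (𝓝 (ξ t₀)) := by
    have h1 : Tendsto (fun q : (ℂ × (Fin (d - 1) → ℂ)) × ℂ => q.1.1 • ξ q.1.2) (𝓝 q₀)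
        (𝓝 ((1 : ℂ) • ξ t₀)) := (hp1.smul hξq).continuousAt.tendsto
    rwa [one_smul] at h1
  have e1 := (hc1.prodMk_nhds hc2).eventually hlo
  have e2 : ∀ᶠ q in 𝓝 q₀, q.1.2 ∈ T ∩ D :=
    hp2.continuousAt (inter_mem hT (hξ.isOpen.mem_nhds ht₀))
  have e3 : ∀ᶠ q in 𝓝 q₀, ‖q.1.1‖ < 2 := by
    have h1 := hp1.continuousAt.tendsto.norm
    exact h1.eventually (gt_mem_nhds (by simp [q₀]))
  rw [← hmap, eventually_map]
  filter_upwards [e1, e2, e3] with q h1 h2 h3 hz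
  refine ⟨q.1.2, h2.1, q.1.1, h3.le, ?_⟩
  have h4 : MvPolynomial.eval (q.1.1 • ξ q.1.2) F = 0 := by
    rw [eval_smul_of_isHomogeneous hF, hξ.mem_hypersurface _ h2.2, mul_zero]
  have h5 : Θ q - q.1.1 • ξ q.1.2 = q.2 • v := by simp [Θ]
  rw [h4, hz, h5, ← hL, map_smul, hv, smul_eq_mul, mul_one, sub_zero, zero_sub, norm_neg,
    norm_smul] at h1
  have h6 : q.2 = 0 := by
    by_contra hne
    have hpos : 0 < ‖q.2‖ := norm_pos_iff.2 hne
    have h7 : 1 / (2 * (‖v‖ + 1)) * (‖q.2‖ * ‖v‖) < ‖q.2‖ := by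
      rw [one_div, inv_mul_lt_iff₀ (by positivity)]
      nlinarith [norm_nonneg v]
    linarith
  simp [Θ, h6]

/-- The `L²` norm of `P ∘ ξ` over the cuboid with corner `c` and side lengths `r`. -/
noncomputable def cuboidNorm (ξ : (Fin (d - 1) → ℂ) → (Fin d → ℂ)) (c : Fin (d - 1) → ℂ)
    (r : Fin (d - 1) → ℝ) (P : MvPolynomial (Fin d) ℂ) : ℝ :=
  √(∫ s in Set.Icc (0 : Fin (d - 1) → ℝ) r, ‖MvPolynomial.eval (ξ (shift c s)) P‖ ^ 2)

lemma cuboidNorm_smul (ξ : (Fin (d - 1) → ℂ) → (Fin d → ℂ)) (c : Fin (d - 1) → ℂ)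
    (r : Fin (d - 1) → ℝ) (a : ℂ) (P : MvPolynomial (Fin d) ℂ) :
    cuboidNorm ξ c r (a • P) = ‖a‖ * cuboidNorm ξ c r P := by
  rw [cuboidNorm, cuboidNorm]
  simp only [MvPolynomial.smul_eval, norm_mul, mul_pow]
  rw [integral_const_mul, Real.sqrt_mul (by positivity), Real.sqrt_sq (norm_nonneg a)]

/-- Homogeneous polynomials are controlled at `ξ t₀` by their mean square on a small cuboid. -/
lemma IsUniformization.isControlledAt (hd : 1 ≤ d) (hF : F.IsHomogeneous n)
    (hX : IsSmoothHypersurface F) (hξ : IsUniformization F D ξ) {t₀ : Fin (d - 1) → ℂ}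
    {ρ : ℝ} (hρ : 0 < ρ) (hball : Metric.closedBall t₀ (4 * ρ) ⊆ D) :
    IsControlledAt F (cuboidNorm ξ (fun j => t₀ j - ρ) (fun _ => 2 * ρ)) (ξ t₀) := by
  have ht₀ : t₀ ∈ D := hball (Metric.mem_closedBall_self (by positivity))
  obtain ⟨R, hR⟩ := (isCompact_closedBall t₀ (4 * ρ)).exists_bound_of_continuousOn
    (hξ.analytic.continuousOn.mono hball)
  set R' := max 1 R with hR'
  have hR'1 : 1 ≤ R' := le_max_left _ _
  set B : ℝ := max 1 (4 * (3 / (2 * ρ)) ^ (d - 1)) with hB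
  have hB1 : 1 ≤ B := le_max_left _ _
  have hT : Metric.closedBall t₀ (ρ / 8) ∈ 𝓝 t₀ := Metric.closedBall_mem_nhds _ (by positivity)
  refine ⟨_, hξ.eventually_eq_smul hd hF hX ht₀ hT, 2 * (B * R'), 1 / ((d - 1 + 2 : ℕ) : ℝ),
    by nlinarith, by positivity, ?_, ?_⟩
  · rw [div_le_one (by positivity)]
    exact_mod_cast (by omega : 1 ≤ d - 1 + 2)
  intro m P hP hP1 w hw hFw
  obtain ⟨t, ht, μ, hμ, rfl⟩ := hw hFw
  set f : (Fin (d - 1) → ℂ) → ℂ := fun t => MvPolynomial.eval (ξ t) P with hf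
  have hfd : DifferentiableOn ℂ f (Metric.ball t₀ (4 * ρ)) := by
    refine (differentiable_eval P).comp_differentiableOn ?_
    exact hξ.analytic.differentiableOn.mono (Metric.ball_subset_closedBall.trans hball)
  have hfM : ∀ t ∈ Metric.ball t₀ (4 * ρ), ‖f t‖ ≤ R' ^ m := by
    intro t ht
    have ht' := Metric.ball_subset_closedBall ht
    have := norm_eval_le_pow hF hP hP1 hR'1 (hξ.mem_hypersurface t (hball ht'))
      ((hR t ht').trans (le_max_right _ _))
    rwa [mul_one] at this
  set Sq := cuboidNorm ξ (fun j => t₀ j - ρ) (fun _ => 2 * ρ) P with hSq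
  have hSq0 : 0 ≤ Sq := Real.sqrt_nonneg _
  have hint : (∫ s in Set.Icc (0 : Fin (d - 1) → ℝ) (fun _ => 2 * ρ),
      ‖f (shift (fun j => t₀ j - ρ) s)‖ ^ 2) = Sq ^ 2 := by
    rw [hSq, cuboidNorm, Real.sq_sqrt (integral_nonneg fun s => by positivity)]
  have h1 := norm_pow_le_integral_complex hρ hfd hfM (t := t) (by
    rw [← dist_eq_norm]; exact ht)
  rw [hint] at h1
  have h2 : ‖f t‖ ≤ B * R' ^ m * Sq ^ (1 / ((d - 1 + 2 : ℕ) : ℝ)) := by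
    have hS' : (Sq ^ (1 / ((d - 1 + 2 : ℕ) : ℝ))) ^ (d - 1 + 2) = Sq := by
      rw [one_div, Real.rpow_inv_natCast_pow hSq0 (by omega)]
    have hSn : 0 ≤ Sq ^ (1 / ((d - 1 + 2 : ℕ) : ℝ)) := Real.rpow_nonneg hSq0 _
    refine le_of_pow_le_pow_left₀ (n := 2 * (d - 1 + 2)) (by omega) (by positivity) (h1.trans ?_)
    have h3 : (B * R' ^ m * Sq ^ (1 / ((d - 1 + 2 : ℕ) : ℝ))) ^ (2 * (d - 1 + 2)) =
        B ^ (2 * (d - 1 + 2)) * (R' ^ m) ^ (2 * (d - 1 + 2)) * Sq ^ 2 := by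
      rw [mul_pow, mul_pow, mul_comm 2 (d - 1 + 2), pow_mul (Sq ^ _), hS']
    rw [h3]
    have h4 : 4 * (3 / (2 * ρ)) ^ (d - 1) ≤ B ^ (2 * (d - 1 + 2)) :=
      (le_max_right _ _).trans (le_self_pow₀ hB1 (by omega))
    have h5 : (R' ^ m) ^ (2 * (d - 1) + 2) ≤ (R' ^ m) ^ (2 * (d - 1 + 2)) :=
      pow_le_pow_right₀ (one_le_pow₀ hR'1) (by omega)
    gcongr
  rw [eval_smul_of_isHomogeneous hP, norm_mul, norm_pow]
  have hSn : 0 ≤ Sq ^ (1 / ((d - 1 + 2 : ℕ) : ℝ)) := Real.rpow_nonneg hSq0 _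
  have h6 : ‖μ‖ ^ m ≤ 2 ^ (m + 1) :=
    (pow_le_pow_left₀ (norm_nonneg _) hμ m).trans (pow_le_pow_right₀ (by norm_num) (Nat.le_succ m))
  have h7 : B * R' ^ m ≤ (B * R') ^ (m + 1) := by
    rw [mul_pow]
    exact mul_le_mul (le_self_pow₀ hB1 (by omega)) (pow_le_pow_right₀ hR'1 (Nat.le_succ m))
      (by positivity) (by positivity)
  calc ‖μ‖ ^ m * ‖f t‖ ≤ 2 ^ (m + 1) * (B * R' ^ m * Sq ^ (1 / ((d - 1 + 2 : ℕ) : ℝ))) := by gcongr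
    _ ≤ 2 ^ (m + 1) * ((B * R') ^ (m + 1) * Sq ^ (1 / ((d - 1 + 2 : ℕ) : ℝ))) := by gcongr
    _ = _ := by rw [mul_pow 2]; ring

end

/-! ### Reduction of polynomials modulo `F` -/

section

variable {d n : ℕ} {F : MvPolynomial (Fin d) ℂ} {e : Fin d → ℂ}

/-- The roots of `F (z + T e)` are bounded by a multiple of `‖z‖`, as `F` has no zeros near `e`. -/
lemma exists_norm_root_le (hF : F.IsHomogeneous n) (he : MvPolynomial.eval e F ≠ 0) :
    ∃ C : ℝ, 0 < C ∧ ∀ (z : Fin d → ℂ) (T : ℂ), MvPolynomial.eval (z + T • e) F = 0 →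
      ‖T‖ ≤ C * ‖z‖ := by
  have h1 : ∀ᶠ w in 𝓝 e, MvPolynomial.eval w F ≠ 0 :=
    (continuous_eval F).continuousAt.eventually_ne he
  obtain ⟨δ, hδ, hball⟩ := Metric.eventually_nhds_iff_ball.1 h1
  refine ⟨δ⁻¹, inv_pos.2 hδ, fun z T hT => ?_⟩
  by_contra! hlt
  have hT0 : T ≠ 0 := by
    rintro rfl
    rw [norm_zero] at hlt
    have : 0 ≤ δ⁻¹ * ‖z‖ := by positivity
    linarith
  refine hball (T⁻¹ • (z + T • e)) ?_ (by rw [eval_smul_of_isHomogeneous hF, hT, mul_zero])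
  rw [Metric.mem_ball, dist_eq_norm, smul_add, smul_smul, inv_mul_cancel₀ hT0, one_smul,
    add_sub_cancel_right, norm_smul, norm_inv, inv_mul_lt_iff₀ (norm_pos_iff.2 hT0)]
  rw [inv_mul_lt_iff₀ hδ] at hlt
  linarith

lemma onLine_eq_nodal (hF : F.IsHomogeneous n) (he : MvPolynomial.eval e F ≠ 0) {z : Fin d → ℂ}
    (hz : (onLine F e z).Separable) :
    onLine F e z = Polynomial.C (MvPolynomial.eval e F) * Lagrange.nodal (lineRoots F e z) id := by
  conv_lhs => rw [(IsAlgClosed.splits (onLine F e z)).eq_prod_roots]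
  rw [leadingCoeff_onLine hF he, Lagrange.nodal, lineRoots, Finset.prod, Multiset.toFinset_val,
    Multiset.dedup_eq_self.2 (Polynomial.nodup_roots hz)]
  rfl

/-- The remainder of `P (z + T e)` on division by `F (z + T e)`, as polynomials in `T` over `ℂ[z]`; the
divisor is made monic by the constant factor `1 / F e`. -/
noncomputable def lineRemainder (F : MvPolynomial (Fin d) ℂ) (e : Fin d → ℂ)
    (P : MvPolynomial (Fin d) ℂ) : Polynomial (MvPolynomial (Fin d) ℂ) :=
  alongLine e P %ₘ
    (Polynomial.C (MvPolynomial.C (MvPolynomial.eval e F)⁻¹) * alongLine e F)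

lemma monic_alongLine (hF : F.IsHomogeneous n) (he : MvPolynomial.eval e F ≠ 0) :
    (Polynomial.C (MvPolynomial.C (MvPolynomial.eval e F)⁻¹) * alongLine e F).Monic := by
  refine Polynomial.monic_of_natDegree_le_of_coeff_eq_one n
    ((Polynomial.natDegree_C_mul_le _ _).trans (alongLine_natDegree_coeff hF e).1) ?_
  rw [Polynomial.coeff_C_mul, (alongLine_natDegree_coeff hF e).2, ← map_mul,
    inv_mul_cancel₀ he, map_one]

lemma exists_eq_coeff_lineRemainder_add (P : MvPolynomial (Fin d) ℂ) : ∃ Q, P = (lineRemainder F e P).coeff 0 + F * Q := by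
  have h := Polynomial.modByMonic_add_div (alongLine e P)
    (q := Polynomial.C (MvPolynomial.C (MvPolynomial.eval e F)⁻¹) * alongLine e F)
  have h1 := congrArg (fun p => Polynomial.coeff p 0) h
  simp only [Polynomial.coeff_add, Polynomial.mul_coeff_zero, coeff_zero_alongLine,
    Polynomial.coeff_C_zero] at h1
  refine ⟨MvPolynomial.C (MvPolynomial.eval e F)⁻¹ * (alongLine e P /ₘ
    (Polynomial.C (MvPolynomial.C (MvPolynomial.eval e F)⁻¹) * alongLine e F)).coeff 0, ?_⟩
  conv_lhs => rw [← h1]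
  rw [lineRemainder]
  ring

lemma degree_map_lineRemainder_lt (hF : F.IsHomogeneous n)
    (he : MvPolynomial.eval e F ≠ 0) (P : MvPolynomial (Fin d) ℂ) (z : Fin d → ℂ) :
    ((lineRemainder F e P).map (MvPolynomial.eval z)).degree < n := by
  refine lt_of_le_of_lt Polynomial.degree_map_le ?_
  have hm := monic_alongLine hF he
  refine lt_of_lt_of_le (Polynomial.degree_modByMonic_lt _ hm) ?_
  exact Polynomial.degree_le_of_natDegree_le
    ((Polynomial.natDegree_C_mul_le _ _).trans (alongLine_natDegree_coeff hF e).1)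

lemma eval_map_lineRemainder (P : MvPolynomial (Fin d) ℂ) {z : Fin d → ℂ} {T : ℂ}
    (hT : MvPolynomial.eval (z + T • e) F = 0) :
    ((lineRemainder F e P).map (MvPolynomial.eval z)).eval T = MvPolynomial.eval (z + T • e) P := by
  have h := Polynomial.modByMonic_add_div (alongLine e P)
    (q := Polynomial.C (MvPolynomial.C (MvPolynomial.eval e F)⁻¹) * alongLine e F)
  have h1 := congrArg (fun p => (Polynomial.map (MvPolynomial.eval z) p).eval T) h
  simp only [Polynomial.map_add, Polynomial.map_mul, Polynomial.eval_add, Polynomial.eval_mul,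
    eval_map_alongLine, hT, mul_zero, zero_mul, add_zero] at h1
  exact h1

/-- At generic points the remainder at `T = 0` scales like a homogeneous polynomial of degree `m`,
although it need not be given by one a priori. -/
lemma eval_smul_coeff_lineRemainder (hF : F.IsHomogeneous n)
    (he : MvPolynomial.eval e F ≠ 0) {m : ℕ} {P : MvPolynomial (Fin d) ℂ} (hP : P.IsHomogeneous m)
    {z : Fin d → ℂ} (hz : (onLine F e z).Separable) (c : ℂ) :
    MvPolynomial.eval (c • z) ((lineRemainder F e P).coeff 0) =
      c ^ m * MvPolynomial.eval z ((lineRemainder F e P).coeff 0) := by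
  have h1 : ((lineRemainder F e P).map (MvPolynomial.eval (c • z))).comp
      (Polynomial.C c * Polynomial.X) =
      Polynomial.C (c ^ m) * (lineRemainder F e P).map (MvPolynomial.eval z) := by
    refine Polynomial.eq_of_degrees_lt_of_eval_finset_eq (lineRoots F e z) ?_ ?_ ?_
    · rw [card_lineRoots hF he hz]
      have h2 := degree_map_lineRemainder_lt hF he P (c • z)
      rw [Polynomial.degree_lt_iff_coeff_zero] at h2 ⊢
      intro k hk
      rw [Polynomial.comp_C_mul_X_coeff, h2 k hk, zero_mul]
    · rw [card_lineRoots hF he hz]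
      have h2 := degree_map_lineRemainder_lt hF he P z
      rw [Polynomial.degree_lt_iff_coeff_zero] at h2 ⊢
      intro k hk
      rw [Polynomial.coeff_C_mul, h2 k hk, mul_zero]
    · intro T hT
      have hT' := (mem_lineRoots hF he).1 hT
      have h3 : c • z + (c * T) • e = c • (z + T • e) := by rw [smul_add, smul_smul]
      have h4 : MvPolynomial.eval (c • z + (c * T) • e) F = 0 := by
        rw [h3, eval_smul_of_isHomogeneous hF, hT', mul_zero]
      rw [Polynomial.eval_comp, Polynomial.eval_mul, Polynomial.eval_C, Polynomial.eval_X,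
        eval_map_lineRemainder P h4, Polynomial.eval_mul, Polynomial.eval_C,
        eval_map_lineRemainder P hT', h3, eval_smul_of_isHomogeneous hP]
  have h2 := congrArg (fun p => Polynomial.coeff p 0) h1
  simpa only [Polynomial.comp_C_mul_X_coeff, Polynomial.coeff_C_mul, pow_zero, mul_one,
    Polynomial.coeff_map] using h2

/-- Where a polynomial scales like a homogeneous one of degree `m`, it agrees with its homogeneous
component of that degree. -/
lemma eval_homogeneousComponent_eq {m : ℕ} {P : MvPolynomial (Fin d) ℂ} {z : Fin d → ℂ}
    (h : ∀ c : ℂ, MvPolynomial.eval (c • z) P = c ^ m * MvPolynomial.eval z P) :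
    MvPolynomial.eval z (MvPolynomial.homogeneousComponent m P) = MvPolynomial.eval z P := by
  set p : Polynomial ℂ := ∑ k ∈ Finset.range (P.totalDegree + 1),
    Polynomial.C (MvPolynomial.eval z (MvPolynomial.homogeneousComponent k P)) * Polynomial.X ^ k
    with hp
  have hpe : ∀ c, p.eval c = MvPolynomial.eval (c • z) P := by
    intro c
    conv_rhs => rw [← MvPolynomial.sum_homogeneousComponent P]
    rw [hp, Polynomial.eval_finsetSum, map_sum]
    refine Finset.sum_congr rfl fun k _ => ?_
    rw [eval_smul_of_isHomogeneous (MvPolynomial.homogeneousComponent_isHomogeneous k P)]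
    rw [Polynomial.eval_mul, Polynomial.eval_C, Polynomial.eval_pow, Polynomial.eval_X, mul_comm]
  have hpq : p = Polynomial.C (MvPolynomial.eval z P) * Polynomial.X ^ m := by
    refine Polynomial.funext fun c => ?_
    rw [hpe, h]
    rw [Polynomial.eval_mul, Polynomial.eval_C, Polynomial.eval_pow, Polynomial.eval_X, mul_comm]
  have h1 := congrArg (fun q => Polynomial.coeff q m) hpq
  simp only [hp, Polynomial.finsetSum_coeff, Polynomial.coeff_C_mul, Polynomial.coeff_X_pow] at h1
  simp only [mul_ite, mul_one, mul_zero, Finset.sum_ite_eq, Finset.mem_range, if_true] at h1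
  rw [← h1]
  split_ifs with hm
  · rfl
  · rw [MvPolynomial.homogeneousComponent_eq_zero _ _ (by omega), map_zero]

lemma exists_homogeneousComponent_mul (hF : F.IsHomogeneous n) (m : ℕ)
    (Q : MvPolynomial (Fin d) ℂ) :
    ∃ Q', MvPolynomial.homogeneousComponent m (F * Q) = F * Q' := by
  conv => enter [1, Q', 1]; rw [← MvPolynomial.sum_homogeneousComponent Q]
  rw [Finset.mul_sum, map_sum]
  refine ⟨∑ k ∈ Finset.range (Q.totalDegree + 1), if n + k = m then
    MvPolynomial.homogeneousComponent k Q else 0, ?_⟩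
  rw [Finset.mul_sum]
  refine Finset.sum_congr rfl fun k _ => ?_
  have h1 : (F * MvPolynomial.homogeneousComponent k Q).IsHomogeneous (n + k) :=
    hF.mul (MvPolynomial.homogeneousComponent_isHomogeneous k Q)
  rw [MvPolynomial.homogeneousComponent_of_mem ((MvPolynomial.mem_homogeneousSubmodule _ _).2 h1)]
  by_cases h : n + k = m
  · rw [if_pos h.symm, if_pos h]
  · rw [if_neg (Ne.symm h), if_neg h, mul_zero]

/-- A homogeneous polynomial bounded by `K` on a ball of radius `η` is bounded by `K η⁻ᵐ` on the
unit ball: apply the maximum principle to `σ ↦ P (σ z₀ + v)` on the disc of radius `1 / η`. -/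
lemma norm_eval_le_of_ball {m : ℕ} {P : MvPolynomial (Fin d) ℂ} (hP : P.IsHomogeneous m)
    {z₀ : Fin d → ℂ} {η K : ℝ} (hη : 0 < η)
    (h : ∀ z ∈ Metric.closedBall z₀ η, ‖MvPolynomial.eval z P‖ ≤ K) {v : Fin d → ℂ}
    (hv : ‖v‖ ≤ 1) : ‖MvPolynomial.eval v P‖ ≤ η⁻¹ ^ m * K := by
  have hd : Differentiable ℂ (fun σ : ℂ => MvPolynomial.eval (σ • z₀ + v) P) := by
    intro σ
    have h2 : DifferentiableAt ℂ (fun w => MvPolynomial.eval w P) (σ • z₀ + v) :=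
      differentiable_eval P _
    have h3 : DifferentiableAt ℂ (fun σ : ℂ => σ • z₀ + v) σ := by fun_prop
    have h4 := h2.comp σ h3
    exact h4
  have key := Complex.norm_le_of_forall_mem_frontier_norm_le (z := 0)
    (U := Metric.ball (0 : ℂ) η⁻¹) (C := η⁻¹ ^ m * K) Metric.isBounded_ball hd.diffContOnCl ?_
    (subset_closure (Metric.mem_ball_self (inv_pos.2 hη)))
  · simpa using key
  · intro σ hσ
    rw [frontier_ball _ (inv_pos.2 hη).ne', mem_sphere_zero_iff_norm] at hσ
    have hσ0 : σ ≠ 0 := by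
      rintro rfl
      rw [norm_zero] at hσ
      exact (inv_pos.2 hη).ne hσ
    have h1 : σ • z₀ + v = σ • (z₀ + σ⁻¹ • v) := by
      rw [smul_add, smul_smul, mul_inv_cancel₀ hσ0, one_smul]
    rw [h1, eval_smul_of_isHomogeneous hP, norm_mul, norm_pow, hσ]
    have h2 : z₀ + σ⁻¹ • v ∈ Metric.closedBall z₀ η := by
      rw [Metric.mem_closedBall, dist_eq_norm, add_sub_cancel_left, norm_smul, norm_inv, hσ, inv_inv]
      exact mul_le_of_le_one_right hη.le hv
    exact mul_le_mul_of_nonneg_left (h _ h2) (by have := inv_pos.2 hη; positivity)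

/-- Lagrange interpolation bounds the value at `0` of a polynomial of degree less than the number
of nodes. -/
lemma norm_eval_zero_le {s : Finset ℂ} {p : Polynomial ℂ} (hp : p.degree < s.card) {T κ M : ℝ}
    (hκ : 0 < κ) (hT1 : 1 ≤ T) (hM : 0 ≤ M) (hT : ∀ x ∈ s, ‖x‖ ≤ T)
    (hs : ∀ x ∈ s, κ ≤ ‖∏ y ∈ s.erase x, (x - y)‖) (hpM : ∀ x ∈ s, ‖p.eval x‖ ≤ M) :
    ‖p.eval 0‖ ≤ s.card * (M * (T ^ s.card / κ)) := by
  have h1 : p = Lagrange.interpolate s id (fun x => p.eval x) :=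
    Lagrange.eq_interpolate_of_eval_eq _ Function.injective_id.injOn hp fun _ _ => rfl
  rw [h1, Lagrange.interpolate_apply, Polynomial.eval_finsetSum]
  refine (norm_sum_le _ _).trans ?_
  rw [← nsmul_eq_mul]
  refine Finset.sum_le_card_nsmul _ _ _ fun x hx => ?_
  rw [Polynomial.eval_mul, Polynomial.eval_C, norm_mul]
  refine mul_le_mul (hpM x hx) ?_ (norm_nonneg _) hM
  rw [Lagrange.basis, Polynomial.eval_prod]
  have h2 : ∀ y ∈ s.erase x, Polynomial.eval 0 (Lagrange.basisDivisor (id x) (id y)) =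
      (0 - y) * (x - y)⁻¹ := by
    intro y _
    simp [Lagrange.basisDivisor, mul_comm]
  rw [Finset.prod_congr rfl h2, Finset.prod_mul_distrib, Finset.prod_inv_distrib, norm_mul, norm_inv,
    ← div_eq_mul_inv]
  have h3 : ‖∏ y ∈ s.erase x, (0 - y)‖ ≤ T ^ s.card := by
    rw [norm_prod]
    refine (Finset.prod_le_prod (fun y _ => norm_nonneg _)
      (fun y hy => ?_ : ∀ y ∈ s.erase x, ‖0 - y‖ ≤ T)).trans ?_
    · rw [zero_sub, norm_neg]; exact hT y (Finset.mem_of_mem_erase hy)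
    · rw [Finset.prod_const]
      exact pow_le_pow_right₀ hT1 (Finset.card_le_card (Finset.erase_subset _ _))
  exact div_le_div₀ (by positivity) h3 hκ (hs x hx)

/-- Modulo `F`, a homogeneous polynomial `P` is equivalent to one whose maximum over the whole unit
ball is bounded by the maximum of `P` over the cone in the unit ball, up to a factor that is
exponential in the degree. -/
lemma exists_reduction (hd : 2 ≤ d) (hn : 1 ≤ n) (hF : F.IsHomogeneous n)
    (hX : IsSmoothHypersurface F) (he : MvPolynomial.eval e F ≠ 0) :
    ∃ C : ℝ, 1 ≤ C ∧ ∀ (m : ℕ) (P : MvPolynomial (Fin d) ℂ), P.IsHomogeneous m →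
      ∃ P' : MvPolynomial (Fin d) ℂ, P'.IsHomogeneous m ∧ (∃ Q, P = P' + F * Q) ∧
        ∀ M : ℝ, (∀ w, MvPolynomial.eval w F = 0 → ‖w‖ ≤ 1 → ‖MvPolynomial.eval w P‖ ≤ M) →
          ∀ v, ‖v‖ ≤ 1 → ‖MvPolynomial.eval v P'‖ ≤ C ^ (m + 1) * M := by
  obtain ⟨r, hr0, hr⟩ := exists_ne_zero_separable hd hF hX he
  obtain ⟨z₀, hz₀⟩ : ∃ u, MvPolynomial.eval u r ≠ 0 := by
    by_contra! h
    exact hr0 (MvPolynomial.funext fun z => by simpa using h z)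
  obtain ⟨η, hη, hball⟩ := Metric.nhds_basis_closedBall.mem_iff.1
    ((continuous_eval r).continuousAt.eventually_ne hz₀)
  have hsep : ∀ z ∈ Metric.closedBall z₀ η, (onLine F e z).Separable := fun z hz => hr z (hball hz)
  obtain ⟨C₀, hC₀, hroot⟩ := exists_norm_root_le hF he
  set T : ℝ := max 1 (C₀ * (‖z₀‖ + η)) with hT
  have hT1 : 1 ≤ T := le_max_left _ _
  have hzn : ∀ z ∈ Metric.closedBall z₀ η, ‖z‖ ≤ ‖z₀‖ + η := by
    intro z hz
    rw [Metric.mem_closedBall, dist_eq_norm] at hz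
    have := norm_le_norm_add_norm_sub z₀ z
    rw [norm_sub_rev] at hz
    linarith
  have hrootT : ∀ z ∈ Metric.closedBall z₀ η, ∀ τ : ℂ, MvPolynomial.eval (z + τ • e) F = 0 →
      ‖τ‖ ≤ T := fun z hz τ hτ =>
    (hroot z τ hτ).trans ((mul_le_mul_of_nonneg_left (hzn z hz) hC₀.le).trans (le_max_right _ _))
  -- a lower bound for the derivative at the roots, by compactness
  obtain ⟨κ, hκ, hκb⟩ : ∃ κ : ℝ, 0 < κ ∧ ∀ z ∈ Metric.closedBall z₀ η, ∀ τ : ℂ,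
      MvPolynomial.eval (z + τ • e) F = 0 →
        κ ≤ ‖fderiv ℂ (fun w => MvPolynomial.eval w F) (z + τ • e) e‖ := by
    have hct : Continuous fun q : (Fin d → ℂ) × ℂ => q.1 + q.2 • e := by fun_prop
    have hcomp : IsCompact ((Metric.closedBall z₀ η ×ˢ Metric.closedBall (0 : ℂ) T) ∩
        {q : (Fin d → ℂ) × ℂ | MvPolynomial.eval (q.1 + q.2 • e) F = 0}) :=
      ((isCompact_closedBall _ _).prod (isCompact_closedBall _ _)).inter_right
        (isClosed_eq ((continuous_eval F).comp hct) continuous_const)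
    have hfc : Continuous fun q : (Fin d → ℂ) × ℂ =>
        ‖fderiv ℂ (fun w => MvPolynomial.eval w F) (q.1 + q.2 • e) e‖ := by
      have h1 : ∀ w : Fin d → ℂ, fderiv ℂ (fun w => MvPolynomial.eval w F) w e =
          ∑ i, MvPolynomial.eval w (MvPolynomial.pderiv i F) * e i := by
        intro w
        rw [(hasFDerivAt_eval F w).fderiv]
        simp [sum_apply]
      simp only [h1]
      exact (continuous_finsetSum _ fun i _ =>
        ((continuous_eval _).comp hct).mul continuous_const).norm
    by_cases hne : ((Metric.closedBall z₀ η ×ˢ Metric.closedBall (0 : ℂ) T) ∩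
        {q : (Fin d → ℂ) × ℂ | MvPolynomial.eval (q.1 + q.2 • e) F = 0}).Nonempty
    · obtain ⟨q, hq, hmin⟩ := hcomp.exists_isMinOn hne hfc.continuousOn
      refine ⟨_, norm_pos_iff.2 (fderiv_apply_ne_zero_of_separable (hsep q.1 hq.1.1) hq.2), ?_⟩
      intro z hz τ hτ
      have hτT : τ ∈ Metric.closedBall (0 : ℂ) T := by
        rw [mem_closedBall_zero_iff]; exact hrootT z hz τ hτ
      have hmem : ((z, τ) : (Fin d → ℂ) × ℂ) ∈
          (Metric.closedBall z₀ η ×ˢ Metric.closedBall (0 : ℂ) T) ∩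
            {q : (Fin d → ℂ) × ℂ | MvPolynomial.eval (q.1 + q.2 • e) F = 0} := ⟨⟨hz, hτT⟩, hτ⟩
      exact hmin hmem
    · refine ⟨1, one_pos, fun z hz τ hτ => absurd ⟨(z, τ), ⟨hz, ?_⟩, hτ⟩ hne⟩
      rw [mem_closedBall_zero_iff]; exact hrootT z hz τ hτ
  have hFe : 0 < ‖MvPolynomial.eval e F‖ := norm_pos_iff.2 he
  set R : ℝ := max 1 (‖z₀‖ + η + T * ‖e‖) with hR
  have hR1 : 1 ≤ R := le_max_left _ _
  set K : ℝ := n * (T ^ n / (κ / ‖MvPolynomial.eval e F‖)) with hK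
  have hK0 : 0 ≤ K := by positivity
  refine ⟨max 1 K * (R * max 1 η⁻¹), one_le_mul_of_one_le_of_one_le (le_max_left _ _)
    (one_le_mul_of_one_le_of_one_le hR1 (le_max_left _ _)), fun m P hP => ?_⟩
  set P₀ := (lineRemainder F e P).coeff 0 with hP₀
  obtain ⟨Q, hQ⟩ := exists_eq_coeff_lineRemainder_add (F := F) (e := e) P
  obtain ⟨Q', hQ'⟩ := exists_homogeneousComponent_mul hF m Q
  have hP'h := MvPolynomial.homogeneousComponent_isHomogeneous m P₀
  refine ⟨MvPolynomial.homogeneousComponent m P₀, hP'h, ⟨Q', ?_⟩, ?_⟩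
  · rw [← hQ', ← map_add, ← hQ,
      MvPolynomial.homogeneousComponent_of_mem ((MvPolynomial.mem_homogeneousSubmodule _ _).2 hP),
      if_pos rfl]
  intro M hM v hv
  have hM0 : 0 ≤ M := by
    refine (norm_nonneg _).trans (hM 0 ?_ (by simp))
    have := eval_smul_of_isHomogeneous hF 0 (0 : Fin d → ℂ)
    rwa [smul_zero, zero_pow (by omega), zero_mul] at this
  have hbound : ∀ z ∈ Metric.closedBall z₀ η,
      ‖MvPolynomial.eval z (MvPolynomial.homogeneousComponent m P₀)‖ ≤ K * (R ^ m * M) := by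
    intro z hz
    rw [eval_homogeneousComponent_eq (eval_smul_coeff_lineRemainder hF he hP (hsep z hz))]
    have hcard := card_lineRoots hF he (hsep z hz)
    have h1 := norm_eval_zero_le (s := lineRoots F e z)
      (p := (lineRemainder F e P).map (MvPolynomial.eval z)) (T := T)
      (κ := κ / ‖MvPolynomial.eval e F‖) (M := R ^ m * M)
      (by rw [hcard]; exact degree_map_lineRemainder_lt hF he P z) (by positivity) hT1
      (by positivity) (fun τ hτ => hrootT z hz τ ((mem_lineRoots hF he).1 hτ)) ?_ ?_
    · rw [hcard, ← Polynomial.coeff_zero_eq_eval_zero, Polynomial.coeff_map] at h1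
      refine h1.trans (le_of_eq ?_)
      rw [hK]; ring
    · intro τ hτ
      have h2 := hκb z hz τ ((mem_lineRoots hF he).1 hτ)
      rw [← eval_derivative_onLine, onLine_eq_nodal hF he (hsep z hz), Polynomial.derivative_C_mul,
        Polynomial.eval_mul, Polynomial.eval_C, norm_mul] at h2
      have h3 := Lagrange.eval_nodal_derivative_eval_node_eq (v := (id : ℂ → ℂ)) hτ
      simp only [id] at h3
      rw [h3, Lagrange.eval_nodal] at h2
      rw [div_le_iff₀ hFe]
      simpa [mul_comm] using h2
    · intro τ hτ
      have hτ' := (mem_lineRoots hF he).1 hτ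
      rw [eval_map_lineRemainder P hτ']
      refine norm_eval_le_pow hF hP hM hR1 hτ' ((norm_add_le _ _).trans ?_)
      rw [norm_smul]
      refine le_trans ?_ (le_max_right _ _)
      have := mul_le_mul_of_nonneg_right (hrootT z hz τ hτ') (norm_nonneg e)
      linarith [hzn z hz]
  refine (norm_eval_le_of_ball hP'h hη hbound hv).trans ?_
  have h5 : K ≤ max 1 K ^ (m + 1) := (le_max_right _ _).trans (le_self_pow₀ (le_max_left _ _) (by omega))
  have h6 : R ^ m ≤ R ^ (m + 1) := pow_le_pow_right₀ hR1 (Nat.le_succ m)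
  have h7 : η⁻¹ ^ m ≤ max 1 η⁻¹ ^ (m + 1) :=
    (pow_le_pow_left₀ (inv_pos.2 hη).le (le_max_right _ _) m).trans
      (pow_le_pow_right₀ (le_max_left _ _) (Nat.le_succ m))
  have h8 : 0 < η⁻¹ := inv_pos.2 hη
  rw [mul_pow, mul_pow]
  calc η⁻¹ ^ m * (K * (R ^ m * M)) ≤
      max 1 η⁻¹ ^ (m + 1) * (max 1 K ^ (m + 1) * (R ^ (m + 1) * M)) := by gcongr
    _ = _ := by ring

end

/-! ### Constant-coefficient differential operators acting on analytic functions -/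

section

variable {d : ℕ} {Ω : Set (Fin d → ℝ)} {f g : (Fin d → ℝ) → ℂ}

lemma partialDeriv_eqOn_fderiv (hf : AnalyticOnNhd ℝ f Ω) (i : Fin d) :
    Set.EqOn (partialDeriv i f) (fun x => fderiv ℝ f x (Pi.single i 1)) Ω :=
  fun x hx => (hf x hx).differentiableAt.lineDeriv_eq_fderiv

lemma partialDeriv_congr (hΩ : IsOpen Ω) (h : Set.EqOn f g Ω) (i : Fin d) :
    Set.EqOn (partialDeriv i f) (partialDeriv i g) Ω := fun _ hx =>
  (h.eventuallyEq_of_mem (hΩ.mem_nhds hx)).lineDeriv_eq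

lemma analyticOnNhd_partialDeriv (hΩ : IsOpen Ω) (hf : AnalyticOnNhd ℝ f Ω) (i : Fin d) :
    AnalyticOnNhd ℝ (partialDeriv i f) Ω :=
  AnalyticOnNhd.congr hΩ
    (fun x hx => ((ContinuousLinearMap.apply ℝ ℂ (Pi.single i (1 : ℝ))).analyticAt _).comp
      (hf.fderiv x hx)) (partialDeriv_eqOn_fderiv hf i).symm

lemma partialDeriv_comm (hΩ : IsOpen Ω) (hf : AnalyticOnNhd ℝ f Ω) (i j : Fin d) :
    Set.EqOn (partialDeriv i (partialDeriv j f)) (partialDeriv j (partialDeriv i f)) Ω := by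
  have key : ∀ i j : Fin d, ∀ x ∈ Ω, partialDeriv i (partialDeriv j f) x =
      fderiv ℝ (fderiv ℝ f) x (Pi.single i 1) (Pi.single j 1) := by
    intro i j x hx
    rw [partialDeriv_congr hΩ (partialDeriv_eqOn_fderiv hf j) i hx]
    have h1 : HasFDerivAt (fderiv ℝ f) (fderiv ℝ (fderiv ℝ f) x) x :=
      (hf.fderiv x hx).differentiableAt.hasFDerivAt
    have h2 := h1.clm_apply (hasFDerivAt_const (Pi.single j (1 : ℝ) : Fin d → ℝ) x)
    rw [partialDeriv, h2.differentiableAt.lineDeriv_eq_fderiv, h2.fderiv]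
    simp
  intro x hx
  rw [key i j x hx, key j i x hx]
  exact ((hf x hx).contDiffAt (n := 2)).isSymmSndFDerivAt (by simp) _ _

lemma iterate_partialDeriv_congr (hΩ : IsOpen Ω) (h : Set.EqOn f g Ω) (i : Fin d) (k : ℕ) :
    Set.EqOn ((partialDeriv i)^[k] f) ((partialDeriv i)^[k] g) Ω := by
  induction k with
  | zero => exact h
  | succ k ih =>
    rw [Function.iterate_succ_apply', Function.iterate_succ_apply']
    exact partialDeriv_congr hΩ ih i

lemma analyticOnNhd_iterate_partialDeriv (hΩ : IsOpen Ω) (hf : AnalyticOnNhd ℝ f Ω) (i : Fin d)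
    (k : ℕ) : AnalyticOnNhd ℝ ((partialDeriv i)^[k] f) Ω := by
  induction k with
  | zero => exact hf
  | succ k ih =>
    rw [Function.iterate_succ_apply']
    exact analyticOnNhd_partialDeriv hΩ ih i

lemma iterate_partialDeriv_comm (hΩ : IsOpen Ω) (hf : AnalyticOnNhd ℝ f Ω) (i j : Fin d) (k : ℕ) :
    Set.EqOn ((partialDeriv i)^[k] (partialDeriv j f)) (partialDeriv j ((partialDeriv i)^[k] f))
      Ω := by
  induction k with
  | zero => exact fun _ _ => rfl
  | succ k ih =>
    rw [Function.iterate_succ_apply', Function.iterate_succ_apply']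
    exact (partialDeriv_congr hΩ ih i).trans
      (partialDeriv_comm hΩ (analyticOnNhd_iterate_partialDeriv hΩ hf i k) i j)

lemma analyticOnNhd_foldr_partialDeriv (hΩ : IsOpen Ω) (hf : AnalyticOnNhd ℝ f Ω)
    (α : Fin d →₀ ℕ) (l : List (Fin d)) :
    AnalyticOnNhd ℝ (l.foldr (fun i g => (partialDeriv i)^[α i] g) f) Ω := by
  induction l with
  | nil => exact hf
  | cons a l ih => exact analyticOnNhd_iterate_partialDeriv hΩ ih a _

lemma foldr_partialDeriv_add_single (hΩ : IsOpen Ω) (hf : AnalyticOnNhd ℝ f Ω) (α : Fin d →₀ ℕ)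
    {i : Fin d} {l : List (Fin d)} (hl : l.Nodup) (hi : i ∈ l) :
    Set.EqOn (l.foldr (fun j g => (partialDeriv j)^[(α + Finsupp.single i 1 : Fin d →₀ ℕ) j] g) f)
      (partialDeriv i (l.foldr (fun j g => (partialDeriv j)^[α j] g) f)) Ω := by
  induction l with
  | nil => simp at hi
  | cons a l ih =>
    rw [List.foldr_cons, List.foldr_cons]
    rw [List.nodup_cons] at hl
    by_cases h : a = i
    · subst h
      have h1 : l.foldr (fun j g => (partialDeriv j)^[(α + Finsupp.single a 1 : Fin d →₀ ℕ) j] g) f =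
          l.foldr (fun j g => (partialDeriv j)^[α j] g) f := by
        refine List.foldr_ext _ _ _ fun j hj g => ?_
        have : a ≠ j := fun h => hl.1 (h ▸ hj)
        simp [this]
      rw [h1, Finsupp.add_apply, Finsupp.single_eq_same, Function.iterate_succ_apply']
      exact fun _ _ => rfl
    · have hi' : i ∈ l := by
        rcases List.mem_cons.1 hi with h' | h'
        · exact absurd h'.symm h
        · exact h'
      have h1 : (α + Finsupp.single i 1 : Fin d →₀ ℕ) a = α a := by
        simp [Ne.symm h]
      rw [h1]
      exact (iterate_partialDeriv_congr hΩ (ih hl.2 hi') a _).trans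
        (iterate_partialDeriv_comm hΩ (analyticOnNhd_foldr_partialDeriv hΩ hf α l) a i _)

lemma analyticOnNhd_iteratedPartial (hΩ : IsOpen Ω) (hf : AnalyticOnNhd ℝ f Ω) (α : Fin d →₀ ℕ) :
    AnalyticOnNhd ℝ (iteratedPartial α f) Ω :=
  analyticOnNhd_foldr_partialDeriv hΩ hf α _

lemma iteratedPartial_add_single (hΩ : IsOpen Ω) (hf : AnalyticOnNhd ℝ f Ω) (α : Fin d →₀ ℕ)
    (i : Fin d) : Set.EqOn (iteratedPartial (α + Finsupp.single i 1 : Fin d →₀ ℕ) f)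
      (partialDeriv i (iteratedPartial α f)) Ω :=
  foldr_partialDeriv_add_single hΩ hf α (List.nodup_finRange d) (List.mem_finRange i)

/-- The linear functional `P ↦ P(∂) f (x)` on polynomials. -/
noncomputable def diffOpAt (f : (Fin d → ℝ) → ℂ) (x : Fin d → ℝ) : MvPolynomial (Fin d) ℂ →ₗ[ℂ] ℂ :=
  (MvPolynomial.basisMonomials (Fin d) ℂ).constr ℂ fun α => iteratedPartial α f x

lemma diffOpAt_monomial (f : (Fin d → ℝ) → ℂ) (x : Fin d → ℝ) (α : Fin d →₀ ℕ) (a : ℂ) :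
    diffOpAt f x (MvPolynomial.monomial α a) = a * iteratedPartial α f x := by
  have h : MvPolynomial.monomial α a = a • MvPolynomial.basisMonomials (Fin d) ℂ α := by
    rw [MvPolynomial.coe_basisMonomials, MvPolynomial.smul_monomial, smul_eq_mul, mul_one]
  rw [h, map_smul, diffOpAt, Module.Basis.constr_basis, smul_eq_mul]

lemma diffOpAt_apply (f : (Fin d → ℝ) → ℂ) (x : Fin d → ℝ) (P : MvPolynomial (Fin d) ℂ) :
    diffOpAt f x P = diffOp P f x := by
  conv_lhs => rw [P.as_sum]
  rw [map_sum, diffOp]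
  exact Finset.sum_congr rfl fun α _ => diffOpAt_monomial f x α _

lemma analyticOnNhd_diffOp (hΩ : IsOpen Ω) (hf : AnalyticOnNhd ℝ f Ω)
    (P : MvPolynomial (Fin d) ℂ) : AnalyticOnNhd ℝ (diffOp P f) Ω := by
  intro x hx
  exact Finset.analyticAt_fun_sum _ fun α _ =>
    analyticAt_const.mul (analyticOnNhd_iteratedPartial hΩ hf α x hx)

/-- Composition of differential operators: `(P Xᵢ)(∂) = ∂ᵢ P(∂)` on analytic functions. -/
lemma diffOp_mul_X (hΩ : IsOpen Ω) (hf : AnalyticOnNhd ℝ f Ω) (P : MvPolynomial (Fin d) ℂ)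
    (i : Fin d) : Set.EqOn (diffOp (P * MvPolynomial.X i) f) (partialDeriv i (diffOp P f)) Ω := by
  intro x hx
  have h1 : ∀ α : Fin d →₀ ℕ, DifferentiableAt ℝ
      (fun x => P.coeff α * iteratedPartial α f x) x := fun α =>
    (analyticAt_const.mul (analyticOnNhd_iteratedPartial hΩ hf α x hx)).differentiableAt
  have h2 : partialDeriv i (diffOp P f) x =
      ∑ α ∈ P.support, P.coeff α * partialDeriv i (iteratedPartial α f) x := by
    rw [partialDeriv_eqOn_fderiv (analyticOnNhd_diffOp hΩ hf P) i hx]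
    have h3 : fderiv ℝ (diffOp P f) x =
        ∑ α ∈ P.support, fderiv ℝ (fun x => P.coeff α * iteratedPartial α f x) x :=
      fderiv_fun_sum fun α _ => h1 α
    simp only [h3, sum_apply]
    refine Finset.sum_congr rfl fun α _ => ?_
    have h4 := analyticOnNhd_iteratedPartial hΩ hf α
    rw [partialDeriv_eqOn_fderiv h4 i hx, fderiv_const_mul (h4 x hx).differentiableAt]
    simp
  rw [h2, ← diffOpAt_apply]
  conv_lhs => rw [P.as_sum]
  rw [Finset.sum_mul, map_sum]
  refine Finset.sum_congr rfl fun α _ => ?_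
  rw [MvPolynomial.X, MvPolynomial.monomial_mul, mul_one, diffOpAt_monomial,
    iteratedPartial_add_single hΩ hf α i hx]

lemma diffOp_mul_eq_zero (hΩ : IsOpen Ω) (hf : AnalyticOnNhd ℝ f Ω) {P : MvPolynomial (Fin d) ℂ}
    (hP : ∀ x ∈ Ω, diffOp P f x = 0) (Q : MvPolynomial (Fin d) ℂ) :
    ∀ x ∈ Ω, diffOp (P * Q) f x = 0 := by
  induction Q using MvPolynomial.induction_on with
  | C a =>
    intro x hx
    rw [mul_comm, ← MvPolynomial.smul_eq_C_mul, ← diffOpAt_apply, map_smul, diffOpAt_apply, hP x hx,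
      smul_zero]
  | add Q R hQ hR =>
    intro x hx
    rw [mul_add, ← diffOpAt_apply, map_add, diffOpAt_apply, diffOpAt_apply, hQ x hx, hR x hx,
      add_zero]
  | mul_X Q i hQ =>
    intro x hx
    rw [← mul_assoc, diffOp_mul_X hΩ hf _ i hx,
      partialDeriv_congr hΩ (g := fun _ => 0) hQ i hx]
    simp [partialDeriv, lineDeriv]

lemma fderiv_iteratedFDeriv_apply (hf : AnalyticOnNhd ℝ f Ω) {x : Fin d → ℝ} (hx : x ∈ Ω) (m : ℕ)
    (v : Fin m → Fin d → ℝ) (y : Fin d → ℝ) :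
    fderiv ℝ (fun x => iteratedFDeriv ℝ m f x v) x y =
      iteratedFDeriv ℝ (m + 1) f x (Fin.cons y v : Fin (m + 1) → Fin d → ℝ) := by
  have h1 : HasFDerivAt (iteratedFDeriv ℝ m f) (fderiv ℝ (iteratedFDeriv ℝ m f) x) x :=
    ((hf.iteratedFDeriv m) x hx).differentiableAt.hasFDerivAt
  have h2 : HasFDerivAt (fun x => iteratedFDeriv ℝ m f x v)
      ((ContinuousMultilinearMap.apply ℝ (fun _ : Fin m => Fin d → ℝ) ℂ v).comp
        (fderiv ℝ (iteratedFDeriv ℝ m f) x)) x :=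
    (ContinuousMultilinearMap.apply ℝ (fun _ : Fin m => Fin d → ℝ) ℂ v).hasFDerivAt.comp x h1
  rw [h2.fderiv, iteratedFDeriv_succ_apply_left]
  simp

lemma analyticOnNhd_iteratedFDeriv_apply (hf : AnalyticOnNhd ℝ f Ω) (m : ℕ)
    (v : Fin m → Fin d → ℝ) : AnalyticOnNhd ℝ (fun x => iteratedFDeriv ℝ m f x v) Ω :=
  fun x hx => ((ContinuousMultilinearMap.apply ℝ (fun _ : Fin m => Fin d → ℝ) ℂ v).analyticAt _).comp
    (hf.iteratedFDeriv m x hx)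

/-- A partial derivative of order `m` is the `m`-th Fréchet derivative at suitable unit vectors. -/
lemma exists_iteratedPartial_eq (hΩ : IsOpen Ω) (hf : AnalyticOnNhd ℝ f Ω) (m : ℕ)
    (α : Fin d →₀ ℕ) (hα : α.degree = m) : ∃ v : Fin m → Fin d → ℝ, (∀ j, ‖v j‖ ≤ 1) ∧
      Set.EqOn (iteratedPartial α f) (fun x => iteratedFDeriv ℝ m f x v) Ω := by
  induction m generalizing α with
  | zero =>
    have h0 : α = 0 := (Finsupp.degree_eq_zero_iff α).1 hα
    refine ⟨0, fun j => j.elim0, fun x _ => ?_⟩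
    have : ∀ l : List (Fin d), l.foldr (fun i g => (partialDeriv i)^[(0 : Fin d →₀ ℕ) i] g) f = f := by
      intro l
      induction l with
      | nil => rfl
      | cons a l ih => rw [List.foldr_cons, ih]; rfl
    rw [h0, iteratedPartial, this]
    simp
  | succ m ih =>
    obtain ⟨i, hi⟩ : ∃ i, α i ≠ 0 := by
      by_contra! h
      have : α = 0 := Finsupp.ext h
      simp [this] at hα
    have hle : Finsupp.single i 1 ≤ α := by
      rw [Finsupp.single_le_iff]; omega
    have hsum : α - Finsupp.single i 1 + Finsupp.single i 1 = α := tsub_add_cancel_of_le hle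
    obtain ⟨v, hv, hv'⟩ := ih (α - Finsupp.single i 1) (by
      have := congrArg Finsupp.degree hsum
      rw [map_add, hα, Finsupp.degree_single] at this
      omega)
    refine ⟨Fin.cons (Pi.single i 1) v, fun j => ?_, fun x hx => ?_⟩
    · refine Fin.cases ?_ (fun j => ?_) j
      · rw [Fin.cons_zero, Pi.norm_single, norm_one]
      · simpa using hv j
    · rw [← hsum, iteratedPartial_add_single hΩ hf _ i hx, partialDeriv_congr hΩ hv' i hx,
        partialDeriv_eqOn_fderiv (analyticOnNhd_iteratedFDeriv_apply hf m v) i hx]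
      exact fderiv_iteratedFDeriv_apply hf hx m v _

/-- The operator with symbol `(y₁X₁ + ⋯ + y_dX_d)ᵐ` is the `m`-th derivative in the direction `y`. -/
lemma diffOp_linear_pow (hΩ : IsOpen Ω) (hf : AnalyticOnNhd ℝ f Ω) (y : Fin d → ℝ) (m : ℕ) :
    Set.EqOn (diffOp ((∑ i, MvPolynomial.C (y i : ℂ) * MvPolynomial.X i) ^ m) f)
      (fun x => iteratedFDeriv ℝ m f x fun _ => y) Ω := by
  induction m with
  | zero =>
    intro x hx
    rw [pow_zero, ← MvPolynomial.C_1, ← MvPolynomial.monomial_zero', ← diffOpAt_apply,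
      diffOpAt_monomial, one_mul]
    obtain ⟨v, -, hv⟩ := exists_iteratedPartial_eq hΩ hf 0 0 (by simp)
    rw [hv hx]
    simp
  | succ m ih =>
    intro x hx
    set P : MvPolynomial (Fin d) ℂ := (∑ i, MvPolynomial.C (y i : ℂ) * MvPolynomial.X i) ^ m with hP
    have h1 : (∑ i, MvPolynomial.C (y i : ℂ) * MvPolynomial.X i) ^ (m + 1) =
        ∑ i, (y i : ℂ) • (P * MvPolynomial.X i) := by
      rw [pow_succ, ← hP, Finset.mul_sum]
      refine Finset.sum_congr rfl fun i _ => ?_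
      rw [MvPolynomial.smul_eq_C_mul]; ring
    have h2 : (Fin.cons y fun _ => y : Fin (m + 1) → Fin d → ℝ) = fun _ => y := by
      funext j; refine Fin.cases rfl (fun _ => rfl) j
    have h3 := fderiv_iteratedFDeriv_apply hf hx m (fun _ => y) y
    rw [h2] at h3
    have hy : y = ∑ i, y i • (Pi.single i 1 : Fin d → ℝ) := by
      funext j; simp [Finset.sum_apply, Pi.single_apply]
    have h4 : fderiv ℝ (diffOp P f) x = fderiv ℝ (fun x => iteratedFDeriv ℝ m f x fun _ => y) x :=
      (ih.eventuallyEq_of_mem (hΩ.mem_nhds hx)).fderiv_eq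
    simp only
    rw [h1, ← diffOpAt_apply, map_sum, ← h3, ← h4]
    conv_rhs => rw [hy]
    rw [map_sum]
    refine Finset.sum_congr rfl fun i _ => ?_
    rw [map_smul, map_smul, diffOpAt_apply, diffOp_mul_X hΩ hf P i hx,
      partialDeriv_eqOn_fderiv (analyticOnNhd_diffOp hΩ hf P) i hx, smul_eq_mul, Complex.real_smul]

/-- Cauchy's estimates for the partial derivatives of an analytic function. -/
lemma exists_norm_iteratedPartial_le (hΩ : IsOpen Ω) (hf : AnalyticOnNhd ℝ f Ω) {p : Fin d → ℝ}
    (hp : p ∈ Ω) : ∃ C : ℝ, 1 ≤ C ∧ ∀ (m : ℕ) (α : Fin d →₀ ℕ), α.degree = m →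
      ‖iteratedPartial α f p‖ ≤ m.factorial * C ^ (m + 1) := by
  obtain ⟨q, r, hq⟩ := hf p hp
  obtain ⟨ρ, hρ0, hρ⟩ : ∃ ρ : NNReal, 0 < ρ ∧ (ρ : ENNReal) < q.radius := by
    obtain ⟨ρ, h1, h2⟩ := ENNReal.lt_iff_exists_nnreal_btwn.1 (hq.r_pos.trans_le hq.r_le)
    exact ⟨ρ, by simpa using h1, h2⟩
  obtain ⟨K, hK, hb⟩ := q.norm_le_div_pow_of_pos_of_lt_radius hρ0 hρ
  have hρ0' : (0 : ℝ) < ρ := hρ0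
  refine ⟨max 1 (max K (ρ : ℝ)⁻¹), le_max_left _ _, fun m α hα => ?_⟩
  obtain ⟨v, hv, hv'⟩ := exists_iteratedPartial_eq hΩ hf m α hα
  rw [hv' hp]
  simp only
  rw [hq.iteratedFDeriv_eq_sum_of_completeSpace]
  refine (norm_sum_le _ _).trans ?_
  have h1 : ∀ σ ∈ (Finset.univ : Finset (Equiv.Perm (Fin m))),
      ‖q m (fun i => v (σ i))‖ ≤ max 1 (max K (ρ : ℝ)⁻¹) ^ (m + 1) := by
    intro σ _
    refine ((q m).le_opNorm _).trans ?_
    have h2 : ∏ i, ‖v (σ i)‖ ≤ 1 := Finset.prod_le_one (fun _ _ => norm_nonneg _) fun i _ => hv _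
    refine (mul_le_of_le_one_right (norm_nonneg _) h2).trans ((hb m).trans ?_)
    rw [div_eq_mul_inv, ← inv_pow, pow_succ']
    gcongr
    · exact (le_max_left _ _).trans (le_max_right _ _)
    · exact (le_max_right _ _).trans (le_max_right _ _)
  refine (Finset.sum_le_card_nsmul _ _ _ h1).trans (le_of_eq ?_)
  rw [Finset.card_univ, Fintype.card_perm, Fintype.card_fin, nsmul_eq_mul]

/-- A monomial of degree `m` has exponents in `{0, …, m}`, and `m + 1 ≤ 2ᵐ`. -/
lemma card_support_le {m : ℕ} {P : MvPolynomial (Fin d) ℂ} (hP : P.IsHomogeneous m) :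
    P.support.card ≤ (2 ^ d) ^ m := by
  have h1 : P.support.card ≤ (Fintype.piFinset fun _ : Fin d => Finset.range (m + 1)).card := by
    refine Finset.card_le_card_of_injOn (fun α i => α i) (fun α hα => ?_)
      (fun α _ β _ h => Finsupp.ext (congrFun h))
    rw [Finset.mem_coe, Fintype.mem_piFinset]
    intro i
    rw [Finset.mem_range, Nat.lt_succ_iff, hP.degree_eq_sum_deg_support hα]
    exact Finsupp.le_degree i α
  refine h1.trans ?_
  rw [Fintype.card_piFinset_const, Finset.card_range, ← pow_mul, mul_comm, pow_mul]
  exact Nat.pow_le_pow_left (Nat.lt_two_pow_self) d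

end

/-! ### Representation of the Taylor coefficients by square-integrable kernels -/

/-- A linear functional on a finite-dimensional space that is bounded by a Hilbert seminorm is
given by the inner product with a vector. -/
lemma exists_inner_eq {W H : Type*} [AddCommGroup W] [Module ℂ W] [FiniteDimensional ℂ W]
    [NormedAddCommGroup H] [InnerProductSpace ℂ H] (T : W →ₗ[ℂ] H) (ℓ : W →ₗ[ℂ] ℂ) {K : ℝ}
    (hK : 0 ≤ K) (h : ∀ w, ‖ℓ w‖ ≤ K * ‖T w‖) :
    ∃ q, ‖T q‖ ≤ K ∧ ∀ w, inner ℂ (T q) (T w) = ℓ w := by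
  obtain ⟨s, hs⟩ := T.rangeRestrict.exists_rightInverse_of_surjective T.range_rangeRestrict
  have hs' : ∀ y, T (s y) = y := fun y => congrArg Subtype.val (LinearMap.congr_fun hs y)
  have hℓ : ∀ w, ℓ (s (T.rangeRestrict w)) = ℓ w := by
    intro w
    have h1 : T (s (T.rangeRestrict w) - w) = 0 := by
      rw [map_sub, hs', sub_eq_zero]; rfl
    have h2 := h (s (T.rangeRestrict w) - w)
    rw [h1, norm_zero, mul_zero, norm_le_zero_iff, map_sub, sub_eq_zero] at h2
    exact h2
  obtain ⟨y, hy⟩ : ∃ y : T.range, ∀ z : T.range, inner ℂ y z = ℓ (s z) := by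
    refine ⟨(InnerProductSpace.toDual ℂ T.range).symm (LinearMap.toContinuousLinearMap (ℓ ∘ₗ s)),
      fun z => ?_⟩
    rw [InnerProductSpace.toDual_symm_apply]
    rfl
  have key : ∀ w, inner ℂ (T (s y)) (T w) = ℓ w := by
    intro w
    rw [hs', ← hℓ w, ← hy, Submodule.coe_inner]
    rfl
  refine ⟨s y, ?_, key⟩
  by_cases h0 : ‖T (s y)‖ = 0
  · rw [h0]; exact hK
  · have h1 := h (s y)
    rw [← key, inner_self_eq_norm_sq_to_K, norm_pow, pow_two] at h1
    refine le_of_mul_le_mul_right ?_ (lt_of_le_of_ne (norm_nonneg _) (Ne.symm h0))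
    simpa using h1

section

variable {d n : ℕ} {F : MvPolynomial (Fin d) ℂ}

lemma continuous_shift {k : ℕ} (c : Fin k → ℂ) : Continuous (shift c) := by
  unfold shift
  fun_prop

/-- On homogeneous polynomials of degree `m`, a functional bounded by the mean square over the
cuboid is represented by a polynomial of the same kind. -/
lemma exists_polynomial_kernel {ξ : (Fin (d - 1) → ℂ) → (Fin d → ℂ)} {c : Fin (d - 1) → ℂ}
    {r : Fin (d - 1) → ℝ} (hξ : ContinuousOn ξ (cuboid c r)) (m : ℕ)
    (ℓ : MvPolynomial (Fin d) ℂ →ₗ[ℂ] ℂ) {K : ℝ} (hK : 0 ≤ K)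
    (h : ∀ P : MvPolynomial (Fin d) ℂ, P.IsHomogeneous m → ‖ℓ P‖ ≤ K * cuboidNorm ξ c r P) :
    ∃ Q : MvPolynomial (Fin d) ℂ, Q.IsHomogeneous m ∧ cuboidNorm ξ c r Q ≤ K ∧
      ∀ P : MvPolynomial (Fin d) ℂ, P.IsHomogeneous m →
        ∫ s in Set.Icc 0 r, star (MvPolynomial.eval (ξ (shift c s)) Q) *
          MvPolynomial.eval (ξ (shift c s)) P = ℓ P := by
  have hmem : ∀ P : MvPolynomial (Fin d) ℂ, MemLp (fun s => MvPolynomial.eval (ξ (shift c s)) P) 2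
      (volume.restrict (Set.Icc (0 : Fin (d - 1) → ℝ) r)) := by
    intro P
    have hc : ContinuousOn (fun s => MvPolynomial.eval (ξ (shift c s)) P) (Set.Icc 0 r) :=
      (continuous_eval P).comp_continuousOn
        (hξ.comp (continuous_shift c).continuousOn (Set.mapsTo_image _ _))
    obtain ⟨M, hM⟩ := isCompact_Icc.exists_bound_of_continuousOn hc
    have : IsFiniteMeasure (volume.restrict (Set.Icc (0 : Fin (d - 1) → ℝ) r)) :=
      ⟨by rw [Measure.restrict_apply_univ]; exact isCompact_Icc.measure_lt_top⟩
    exact MemLp.of_bound (hc.aestronglyMeasurable measurableSet_Icc) M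
      (ae_restrict_of_forall_mem measurableSet_Icc hM)
  let T : MvPolynomial.homogeneousSubmodule (Fin d) ℂ m →ₗ[ℂ]
      Lp ℂ 2 (volume.restrict (Set.Icc (0 : Fin (d - 1) → ℝ) r)) :=
    { toFun := fun P => (hmem P).toLp
      map_add' := fun P Q => by
        rw [← MemLp.toLp_add]
        exact MemLp.toLp_congr _ _ (Eventually.of_forall fun s => by simp)
      map_smul' := fun a P => by
        rw [RingHom.id_apply, ← MemLp.toLp_const_smul]
        exact MemLp.toLp_congr _ _ (Eventually.of_forall fun s => by simp) }
  have hinner : ∀ P Q : MvPolynomial.homogeneousSubmodule (Fin d) ℂ m, inner ℂ (T Q) (T P) =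
      ∫ s in Set.Icc 0 r, star (MvPolynomial.eval (ξ (shift c s)) Q.1) *
          MvPolynomial.eval (ξ (shift c s)) P.1 := by
    intro P Q
    rw [L2.inner_def]
    refine integral_congr_ae ?_
    filter_upwards [(hmem P).coeFn_toLp, (hmem Q).coeFn_toLp] with s h1 h2
    change inner ℂ ((hmem Q).toLp _ s) ((hmem P).toLp _ s) = _
    rw [h1, h2, RCLike.inner_apply, mul_comm]
    rfl
  have hnorm : ∀ P : MvPolynomial.homogeneousSubmodule (Fin d) ℂ m,
      ‖T P‖ = cuboidNorm ξ c r P.1 := by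
    intro P
    rw [cuboidNorm, eq_comm, Real.sqrt_eq_iff_mul_self_eq (integral_nonneg fun s => by positivity)
      (norm_nonneg _)]
    have h1 := inner_self_eq_norm_mul_norm (𝕜 := ℂ) (T P)
    have h2 : ∀ s, star (MvPolynomial.eval (ξ (shift c s)) P.1) *
        MvPolynomial.eval (ξ (shift c s)) P.1 =
        ((‖MvPolynomial.eval (ξ (shift c s)) P.1‖ ^ 2 : ℝ) : ℂ) := by
      intro s
      rw [Complex.star_def, Complex.conj_mul']
      norm_cast
    rw [hinner] at h1
    simp only [h2] at h1
    rw [integral_complex_ofReal] at h1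
    simpa using h1
  have : FiniteDimensional ℂ (MvPolynomial.homogeneousSubmodule (Fin d) ℂ m) :=
    Module.Finite.iff_fg.2 (MvPolynomial.homogeneousSubmodule_fg _ _ m)
  obtain ⟨Q, hQ, hQ'⟩ := exists_inner_eq T
    (ℓ ∘ₗ (MvPolynomial.homogeneousSubmodule (Fin d) ℂ m).subtype) hK
    (fun P => by rw [hnorm]; exact h P.1 P.2)
  refine ⟨Q.1, Q.2, by rw [← hnorm]; exact hQ, fun P hP => ?_⟩
  rw [← hinner ⟨P, hP⟩ Q, hQ' ⟨P, hP⟩]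
  rfl

/-- The homogeneous parts of `P(∂) V (p)` are bounded, up to factors exponential in the degree, by
the mean square of `P` over the cuboid: the values of `P` on the cone determine `P(∂) V`. -/
lemma exists_norm_diffOp_le (hd : 3 ≤ d) (hn : 2 ≤ n) (hF : F.IsHomogeneous n)
    (hX : IsSmoothHypersurface F) {e : Fin d → ℂ} (he : MvPolynomial.eval e F ≠ 0)
    {S : MvPolynomial (Fin d) ℂ → ℝ} {A : ℝ} (hA : 1 ≤ A) (hS0 : ∀ P, 0 ≤ S P)
    (hS : ∀ (m : ℕ) (P : MvPolynomial (Fin d) ℂ), P.IsHomogeneous m →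
      ∀ w, MvPolynomial.eval w F = 0 → ‖w‖ ≤ 1 → ‖MvPolynomial.eval w P‖ ≤ A ^ (m + 1) * S P)
    {Ω : Set (Fin d → ℝ)} (hΩ : IsOpen Ω) {V : (Fin d → ℝ) → ℂ} (hV : AnalyticOnNhd ℝ V Ω)
    (hFV : ∀ x ∈ Ω, diffOp F V x = 0) {p : Fin d → ℝ} (hp : p ∈ Ω) :
    ∃ C : ℝ, 1 ≤ C ∧ ∀ (m : ℕ) (P : MvPolynomial (Fin d) ℂ), P.IsHomogeneous m →
      ‖diffOpAt V p P‖ ≤ m.factorial * (C ^ (m + 1) * S P) := by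
  obtain ⟨B, hB, hred⟩ := exists_reduction (by omega) (by omega) hF hX he
  obtain ⟨K, hK, hder⟩ := exists_norm_iteratedPartial_le hΩ hV hp
  have h2d : (1 : ℝ) ≤ 2 ^ d := one_le_pow₀ one_le_two
  refine ⟨2 ^ d * (B * A * K), one_le_mul_of_one_le_of_one_le h2d
    (one_le_mul_of_one_le_of_one_le (one_le_mul_of_one_le_of_one_le hB hA) hK), fun m P hP => ?_⟩
  obtain ⟨P', hP', ⟨Q, hQ⟩, hb⟩ := hred m P hP
  have h1 : diffOpAt V p P = diffOpAt V p P' := by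
    rw [hQ, map_add, diffOpAt_apply _ _ (F * Q), diffOp_mul_eq_zero hΩ hV hFV Q p hp, add_zero]
  have hcoeff := norm_mvCoeff_le_of_norm_eval_le P' (hb _ (hS m P hP))
  have hSP := hS0 P
  rw [h1, diffOpAt_apply, diffOp]
  refine (norm_sum_le _ _).trans ?_
  have h2 : ∀ α ∈ P'.support, ‖P'.coeff α * iteratedPartial α V p‖ ≤
      B ^ (m + 1) * (A ^ (m + 1) * S P) * (m.factorial * K ^ (m + 1)) := by
    intro α hα
    rw [norm_mul]
    have hdeg : α.degree = m := (hP'.degree_eq_sum_deg_support hα).symm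
    exact mul_le_mul (hcoeff α) (hder m α hdeg) (norm_nonneg _) (by positivity)
  refine (Finset.sum_le_card_nsmul _ _ _ h2).trans ?_
  rw [nsmul_eq_mul]
  have h3 : (P'.support.card : ℝ) ≤ (2 ^ d) ^ (m + 1) := by
    refine le_trans (b := (((2 ^ d) ^ m : ℕ) : ℝ)) (by exact_mod_cast card_support_le hP') ?_
    push_cast
    exact pow_le_pow_right₀ h2d (Nat.le_succ m)
  refine (mul_le_mul_of_nonneg_right h3 (by positivity)).trans (le_of_eq ?_)
  simp only [mul_pow]
  ring

/-- The homogeneous Taylor polynomials of a solution are represented by kernels which are complex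
conjugates of polynomials on the cone, of exponentially bounded size. -/
lemma exists_kernels (hd : 3 ≤ d) (hn : 2 ≤ n) (hF : F.IsHomogeneous n)
    (hX : IsSmoothHypersurface F) {e : Fin d → ℂ} (he : MvPolynomial.eval e F ≠ 0)
    {ξ : (Fin (d - 1) → ℂ) → (Fin d → ℂ)} {c : Fin (d - 1) → ℂ} {r : Fin (d - 1) → ℝ}
    (hξ : ContinuousOn ξ (cuboid c r)) (hξF : ∀ t ∈ cuboid c r, MvPolynomial.eval (ξ t) F = 0)
    {A : ℝ} (hA : 1 ≤ A)
    (hS : ∀ (m : ℕ) (P : MvPolynomial (Fin d) ℂ), P.IsHomogeneous m → ∀ w,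
      MvPolynomial.eval w F = 0 → ‖w‖ ≤ 1 →
        ‖MvPolynomial.eval w P‖ ≤ A ^ (m + 1) * cuboidNorm ξ c r P)
    {Ω : Set (Fin d → ℝ)} (hΩ : IsOpen Ω) {V : (Fin d → ℝ) → ℂ} (hV : AnalyticOnNhd ℝ V Ω)
    (hFV : ∀ x ∈ Ω, diffOp F V x = 0) {p : Fin d → ℝ} (hp : p ∈ Ω) :
    ∃ (C : ℝ) (Q : ℕ → MvPolynomial (Fin d) ℂ), 1 ≤ C ∧ (∀ m, (Q m).IsHomogeneous m) ∧
      (∀ m α, ‖(Q m).coeff α‖ ≤ C ^ (m + 1)) ∧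
      ∀ m y, ∫ s in Set.Icc 0 r, star (MvPolynomial.eval (ξ (shift c s)) (Q m)) *
        linForm (ξ (shift c s)) y ^ m =
          (m.factorial : ℂ)⁻¹ * iteratedFDeriv ℝ m V p fun _ => y := by
  have hS0 : ∀ P, 0 ≤ cuboidNorm ξ c r P := fun P => Real.sqrt_nonneg _
  obtain ⟨B, hB, hred⟩ := exists_reduction (by omega) (by omega) hF hX he
  obtain ⟨K, hK, hbd⟩ := exists_norm_diffOp_le hd hn hF hX he hA hS0 hS hΩ hV hFV hp
  have key : ∀ m, ∃ Q : MvPolynomial (Fin d) ℂ, Q.IsHomogeneous m ∧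
      (∀ α, ‖Q.coeff α‖ ≤ (B * (A * K)) ^ (m + 1)) ∧
      ∀ y, ∫ s in Set.Icc 0 r, star (MvPolynomial.eval (ξ (shift c s)) Q) *
        linForm (ξ (shift c s)) y ^ m =
          (m.factorial : ℂ)⁻¹ * iteratedFDeriv ℝ m V p fun _ => y := by
    intro m
    have hfac : (0 : ℝ) < m.factorial := by exact_mod_cast m.factorial_pos
    obtain ⟨Q, hQ, hQK, hQP⟩ := exists_polynomial_kernel hξ m
      ((m.factorial : ℂ)⁻¹ • diffOpAt V p) (K := K ^ (m + 1)) (by positivity) (by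
        intro P hP
        rw [LinearMap.smul_apply, norm_smul, norm_inv, Complex.norm_natCast,
          inv_mul_le_iff₀ hfac]
        exact hbd m P hP)
    -- reducing the kernel modulo `F` changes none of its values on the cone
    obtain ⟨Q', hQ', ⟨R, hR⟩, hb⟩ := hred m Q hQ
    refine ⟨Q', hQ', fun α => ?_, fun y => ?_⟩
    · refine (norm_mvCoeff_le_of_norm_eval_le Q' (hb _ (hS m Q hQ)) α).trans ?_
      rw [mul_pow, mul_pow]
      gcongr
    · have hlin : ∀ z : Fin d → ℂ, MvPolynomial.eval z
          ((∑ i, MvPolynomial.C (y i : ℂ) * MvPolynomial.X i) ^ m) = linForm z y ^ m := by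
        intro z
        rw [map_pow, map_sum, linForm]
        simp [mul_comm]
      have hhom : ((∑ i, MvPolynomial.C (y i : ℂ) * MvPolynomial.X i) ^ m :
          MvPolynomial (Fin d) ℂ).IsHomogeneous m := by
        have h1 : (∑ i, MvPolynomial.C (y i : ℂ) * MvPolynomial.X i :
            MvPolynomial (Fin d) ℂ).IsHomogeneous 1 :=
          MvPolynomial.IsHomogeneous.sum _ _ _ fun i _ => by
            simpa using (MvPolynomial.isHomogeneous_C (Fin d) (y i : ℂ)).mul
              (MvPolynomial.isHomogeneous_X ℂ i)
        simpa using h1.pow m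
      have h2 := hQP _ hhom
      rw [LinearMap.smul_apply, diffOpAt_apply, diffOp_linear_pow hΩ hV y m hp, smul_eq_mul] at h2
      rw [← h2]
      refine setIntegral_congr_fun measurableSet_Icc fun s hs => ?_
      rw [hlin, hR, map_add, map_mul, hξF _ (Set.mem_image_of_mem _ hs), zero_mul, add_zero]
  choose Q h1 h2 h3 using key
  exact ⟨B * (A * K), Q, one_le_mul_of_one_le_of_one_le hB (one_le_mul_of_one_le_of_one_le hA hK),
    h1, h2, h3⟩

end

/-! ### Power series with homogeneous polynomial terms -/

section

variable {d : ℕ}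

lemma exists_prod_eq_monomial (m : ℕ) (α : Fin d →₀ ℕ) (hα : α.degree = m) :
    ∃ v : Fin m → Fin d, ∀ z : Fin d → ℂ, ∏ j, z (v j) = ∏ i, z i ^ α i := by
  induction m generalizing α with
  | zero =>
    have h0 : α = 0 := (Finsupp.degree_eq_zero_iff α).1 hα
    exact ⟨Fin.elim0, fun z => by simp [h0]⟩
  | succ m ih =>
    obtain ⟨i, hi⟩ : ∃ i, α i ≠ 0 := by
      by_contra! h
      have : α = 0 := Finsupp.ext h
      simp [this] at hα
    have hle : Finsupp.single i 1 ≤ α := by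
      rw [Finsupp.single_le_iff]; omega
    have hsum : α - Finsupp.single i 1 + Finsupp.single i 1 = α := tsub_add_cancel_of_le hle
    obtain ⟨v, hv⟩ := ih (α - Finsupp.single i 1) (by
      have := congrArg Finsupp.degree hsum
      rw [map_add, hα, Finsupp.degree_single] at this
      omega)
    refine ⟨Fin.cons i v, fun z => ?_⟩
    rw [Fin.prod_univ_succ]
    simp only [Fin.cons_zero, Fin.cons_succ]
    rw [hv]
    conv_rhs => rw [← hsum]
    simp only [Finsupp.add_apply, pow_add, Finset.prod_mul_distrib]
    rw [mul_comm]
    congr 1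
    rw [Finset.prod_eq_single i] <;> simp +contextual [eq_comm]

/-- A homogeneous polynomial is the restriction to the diagonal of a multilinear map, whose norm is
bounded by the sum of the absolute values of the coefficients. -/
lemma exists_multilinear_of_isHomogeneous {m : ℕ} {P : MvPolynomial (Fin d) ℂ}
    (hP : P.IsHomogeneous m) {B : ℝ} (hB : ∀ α, ‖P.coeff α‖ ≤ B) :
    ∃ φ : (Fin d → ℂ) [×m]→L[ℂ] ℂ, (∀ z, φ (fun _ => z) = MvPolynomial.eval z P) ∧
      ‖φ‖ ≤ (2 ^ d) ^ m * B := by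
  have hB0 : 0 ≤ B := (norm_nonneg _).trans (hB 0)
  have h1 : ∀ α : Fin d →₀ ℕ, ∃ φ : (Fin d → ℂ) [×m]→L[ℂ] ℂ, ‖φ‖ ≤ 1 ∧
      (α.degree = m → ∀ z, φ (fun _ => z) = ∏ i, z i ^ α i) := by
    intro α
    by_cases hα : α.degree = m
    · obtain ⟨v, hv⟩ := exists_prod_eq_monomial m α hα
      refine ⟨(ContinuousMultilinearMap.mkPiAlgebra ℂ (Fin m) ℂ).compContinuousLinearMap
        fun j => ContinuousLinearMap.proj (v j), ?_, fun _ z => ?_⟩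
      · refine ContinuousMultilinearMap.opNorm_le_bound zero_le_one fun w => ?_
        simp only [ContinuousMultilinearMap.compContinuousLinearMap_apply,
          ContinuousMultilinearMap.mkPiAlgebra_apply, ContinuousLinearMap.proj_apply, one_mul]
        rw [norm_prod]
        exact Finset.prod_le_prod (fun _ _ => norm_nonneg _) fun j _ => norm_le_pi_norm (w j) (v j)
      · simp [hv z]
    · exact ⟨0, by simp, fun h => absurd h hα⟩
  choose φ hφ hφ' using h1
  refine ⟨∑ α ∈ P.support, P.coeff α • φ α, fun z => ?_, ?_⟩
  · rw [MvPolynomial.eval_eq', sum_apply]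
    refine Finset.sum_congr rfl fun α hα => ?_
    rw [smul_apply, hφ' α (hP.degree_eq_sum_deg_support hα).symm, smul_eq_mul]
  · refine (norm_sum_le _ _).trans ((Finset.sum_le_card_nsmul _ _ B fun α _ => ?_).trans ?_)
    · rw [norm_smul]
      exact (mul_le_of_le_one_right (norm_nonneg _) (hφ α)).trans (hB α)
    · rw [nsmul_eq_mul]
      refine mul_le_mul_of_nonneg_right ?_ hB0
      exact_mod_cast card_support_le hP

/-- Homogeneous polynomials with exponentially bounded coefficients are the terms of a convergent
power series. -/
lemma exists_powerSeries {C : ℝ} (hC : 1 ≤ C) {P : ℕ → MvPolynomial (Fin d) ℂ}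
    (hP : ∀ m, (P m).IsHomogeneous m) (hb : ∀ m α, ‖(P m).coeff α‖ ≤ C ^ (m + 1)) :
    ∃ (R : ℝ) (H : (Fin d → ℂ) → ℂ), 0 < R ∧ AnalyticOnNhd ℂ H (Metric.ball 0 R) ∧
      (∀ z ∈ Metric.ball (0 : Fin d → ℂ) R, HasSum (fun m => MvPolynomial.eval z (P m)) (H z)) ∧
      ∀ z ∈ Metric.ball (0 : Fin d → ℂ) R, ∀ m, ‖MvPolynomial.eval z (P m)‖ ≤ C * (1 / 2) ^ m := by
  choose φ hφ hφ' using fun m => exists_multilinear_of_isHomogeneous (hP m) (hb m)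
  have hC0 : 0 < C := by linarith
  -- half the radius at which the bounds for the terms are geometric of ratio one
  set R : ℝ := (2 * (2 ^ d * C))⁻¹ with hR
  have hR0 : 0 < R := by positivity
  have hbound : ∀ m, ‖φ m‖ * R ^ m ≤ C * (1 / 2) ^ m := by
    intro m
    refine (mul_le_mul_of_nonneg_right (hφ' m) (by positivity)).trans (le_of_eq ?_)
    have h1 : (2 ^ d * C * R) ^ m = (1 / 2 : ℝ) ^ m := by
      congr 1; rw [hR]; field_simp
    rw [← h1, mul_pow, mul_pow, pow_succ]; ring
  let p : FormalMultilinearSeries ℂ (Fin d → ℂ) ℂ := φ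
  obtain ⟨R', hR'⟩ : ∃ R' : NNReal, (R' : ℝ) = R := ⟨⟨R, hR0.le⟩, rfl⟩
  have hrad : (R' : ENNReal) ≤ p.radius := by
    refine p.le_radius_of_bound C fun m => ?_
    rw [hR']
    refine (hbound m).trans ?_
    exact mul_le_of_le_one_right hC0.le (pow_le_one₀ (by norm_num) (by norm_num))
  have hball : Metric.ball (0 : Fin d → ℂ) R ⊆ Metric.eball 0 p.radius := by
    intro z hz
    refine Metric.eball_subset_eball hrad ?_
    rw [Metric.eball_coe, hR']
    exact hz
  have hp : HasFPowerSeriesOnBall p.sum p 0 p.radius :=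
    p.hasFPowerSeriesOnBall (lt_of_lt_of_le (by
      rw [ENNReal.coe_pos, ← NNReal.coe_pos, hR']; exact hR0) hrad)
  refine ⟨R, p.sum, hR0, fun z hz => hp.analyticOnNhd z (hball hz), fun z hz => ?_,
    fun z hz m => ?_⟩
  · have h1 := hp.hasSum (hball hz)
    rw [zero_add] at h1
    simpa only [p, hφ] using h1
  · rw [← hφ]
    refine ((φ m).le_opNorm _).trans (le_trans ?_ (hbound m))
    rw [Finset.prod_const, Finset.card_univ, Fintype.card_fin]
    rw [mem_ball_zero_iff] at hz
    gcongr

/-! ### Complex conjugates of holomorphic maps -/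

lemma norm_star_pi {k : ℕ} (z : Fin k → ℂ) : ‖star z‖ = ‖z‖ := by
  simp [Pi.norm_def]

/-- The multilinear map `v ↦ conj (φ (conj v))`. -/
noncomputable def conjMultilinear {k l m : ℕ} (φ : (Fin k → ℂ) [×m]→L[ℂ] (Fin l → ℂ)) :
    (Fin k → ℂ) [×m]→L[ℂ] (Fin l → ℂ) :=
  MultilinearMap.mkContinuous
    { toFun := fun v => star (φ fun i => star (v i))
      map_update_add' := fun v i x y => by
        have h : ∀ x, (fun j => star (Function.update v i x j)) =
            Function.update (fun j => star (v j)) i (star x) := fun x => by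
          funext j; by_cases hj : j = i
          · subst hj; simp
          · simp [hj]
        simp only [h, star_add, ContinuousMultilinearMap.map_update_add]
      map_update_smul' := fun v i a x => by
        have h : ∀ x, (fun j => star (Function.update v i x j)) =
            Function.update (fun j => star (v j)) i (star x) := fun x => by
          funext j; by_cases hj : j = i
          · subst hj; simp
          · simp [hj]
        simp only [h, star_smul, ContinuousMultilinearMap.map_update_smul, star_star] } ‖φ‖ fun v => by
    change ‖star (φ fun i => star (v i))‖ ≤ _
    rw [norm_star_pi]
    refine (φ.le_opNorm _).trans (le_of_eq ?_)
    simp only [norm_star_pi]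

/-- The conjugate `z ↦ conj (f (conj z))` of a holomorphic map is holomorphic. -/
lemma analyticAt_conj_conj {k l : ℕ} {f : (Fin k → ℂ) → (Fin l → ℂ)} {z : Fin k → ℂ}
    (hf : AnalyticAt ℂ f (star z)) : AnalyticAt ℂ (fun w => star (f (star w))) z := by
  obtain ⟨p, r, hp⟩ := hf
  refine ⟨fun m => conjMultilinear (p m), r, ⟨?_, hp.r_pos, fun {y} hy => ?_⟩⟩
  · refine hp.r_le.trans (FormalMultilinearSeries.radius_le_of_le fun m => ?_)
    exact MultilinearMap.mkContinuous_norm_le _ (norm_nonneg _) _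
  · have h1 : star y ∈ Metric.eball (0 : Fin k → ℂ) r := by
      rw [Metric.mem_eball, edist_zero_right, ← ofReal_norm, norm_star_pi, ofReal_norm]
      simpa using hy
    have h2 := (hp.hasSum h1).star
    rw [← star_add] at h2
    exact h2

end

/-! ### Summation of the plane waves -/

section

variable {d : ℕ}

lemma IsSmoothHypersurface.exists_eval_ne_zero (hd : 1 ≤ d) {F : MvPolynomial (Fin d) ℂ}
    (hX : IsSmoothHypersurface F) : ∃ e, MvPolynomial.eval e F ≠ 0 := by
  by_contra! h
  have h0 : F = 0 := MvPolynomial.funext fun z => by simpa using h z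
  have h1 : (fun _ => 1 : Fin d → ℂ) ≠ 0 := fun h => one_ne_zero (congrFun h ⟨0, hd⟩)
  obtain ⟨i, hi⟩ := hX _ h1 (h _)
  simp [h0] at hi

lemma linForm_sub (z : Fin d → ℂ) (x y : Fin d → ℝ) :
    linForm z (x - y) = linForm z x - linForm z y := by
  simp [linForm, mul_sub, Finset.sum_sub_distrib]

lemma norm_linForm_le (z : Fin d → ℂ) (x : Fin d → ℝ) : ‖linForm z x‖ ≤ d * (‖z‖ * ‖x‖) := by
  refine (norm_sum_le _ _).trans ((Finset.sum_le_card_nsmul _ _ (‖z‖ * ‖x‖) fun i _ => ?_).trans ?_)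
  · rw [norm_mul, Complex.norm_real]
    exact mul_le_mul (norm_le_pi_norm z i) (norm_le_pi_norm x i) (norm_nonneg _) (norm_nonneg _)
  · simp

lemma cuboid_subset_closedBall {k : ℕ} (t₀ : Fin k → ℂ) {ρ : ℝ} (hρ : 0 ≤ ρ) :
    cuboid (fun j => t₀ j - ρ) (fun _ => 2 * ρ) ⊆ Metric.closedBall t₀ ρ := by
  rintro _ ⟨s, hs, rfl⟩
  rw [Metric.mem_closedBall, dist_eq_norm, pi_norm_le_iff_of_nonneg hρ]
  intro j
  have h1 : (shift (fun j => t₀ j - ρ) s - t₀) j = ((s j - ρ : ℝ) : ℂ) := by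
    simp [shift]
    ring
  have h2 := hs.1 j
  have h3 := hs.2 j
  simp only [Pi.zero_apply] at h2
  rw [h1, Complex.norm_real, Real.norm_eq_abs, abs_le]
  constructor <;> linarith

lemma isCompact_cuboid {k : ℕ} (c : Fin k → ℂ) (r : Fin k → ℝ) : IsCompact (cuboid c r) :=
  isCompact_Icc.image (continuous_shift c)

lemma eval_star_map (z : Fin d → ℂ) (Q : MvPolynomial (Fin d) ℂ) :
    MvPolynomial.eval (star z) (MvPolynomial.map (starRingEnd ℂ) Q) =
      star (MvPolynomial.eval z Q) :=
  (MvPolynomial.map_eval (starRingEnd ℂ) z Q).symm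

lemma shift_add_star_sub {k : ℕ} (c : Fin k → ℂ) (s : Fin k → ℝ) :
    c + star (shift c s - c) = shift c s := by
  funext j
  simp [shift]

end

end PlaneWave

open PlaneWave

theorem mainTheorem2 (d n : ℕ) (hd : 4 ≤ d) (hn : 2 ≤ n)
    (F : MvPolynomial (Fin d) ℂ) (hF : F.IsHomogeneous n)
    (hX : PlaneWave.IsSmoothHypersurface F)
    (D : Set (Fin (d - 1) → ℂ)) (ξ : (Fin (d - 1) → ℂ) → (Fin d → ℂ))
    (hξ : PlaneWave.IsUniformization F D ξ)
    (Ω : Set (Fin d → ℝ)) (hΩ : IsOpen Ω)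
    (V : (Fin d → ℝ) → ℂ) (hV : AnalyticOnNhd ℝ V Ω)
    (hFV : ∀ x ∈ Ω, PlaneWave.diffOp F V x = 0)
    (p : Fin d → ℝ) (hp : p ∈ Ω) :
    ∃ U : Set (Fin d → ℝ), IsOpen U ∧ p ∈ U ∧ U ⊆ Ω ∧
      ∃ (c : Fin (d - 1) → ℂ) (r : Fin (d - 1) → ℝ),
        (∀ j, 0 < r j) ∧ PlaneWave.cuboid c r ⊆ D ∧
        ∃ Φ : ℂ × (Fin (d - 1) → ℂ) → ℂ,
          AnalyticOnNhd ℂ Φ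
            {q | ∃ x ∈ U, ∃ t ∈ PlaneWave.cuboid c r, q = (PlaneWave.linForm (ξ t) x, t)} ∧
          ∀ x ∈ U, V x =
            PlaneWave.cuboidIntegral c r (fun t => Φ (PlaneWave.linForm (ξ t) x, t)) := by
  obtain ⟨e, he⟩ := hX.exists_eval_ne_zero (by omega)
  obtain ⟨t₀, ht₀⟩ := hξ.nonempty
  obtain ⟨ε, hε, hεD⟩ := Metric.isOpen_iff.1 hξ.isOpen t₀ ht₀
  obtain ⟨ρ, hρ, hρε⟩ : ∃ ρ : ℝ, 0 < ρ ∧ 4 * ρ < ε := ⟨ε / 8, by positivity, by linarith⟩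
  have hball : Metric.closedBall t₀ (4 * ρ) ⊆ D :=
    (Metric.closedBall_subset_ball hρε).trans hεD
  have hctrl := hξ.isControlledAt (by omega) hF hX hρ hball
  have hcub := cuboid_subset_closedBall t₀ hρ.le
  set c : Fin (d - 1) → ℂ := fun j => t₀ j - ρ with hc
  set r : Fin (d - 1) → ℝ := fun _ => 2 * ρ with hr
  have hcD : cuboid c r ⊆ D :=
    hcub.trans ((Metric.closedBall_subset_closedBall (by linarith)).trans hball)
  have hξc : ContinuousOn ξ (cuboid c r) := hξ.analytic.continuousOn.mono hcD
  have hz₀ : ξ t₀ ∈ puncturedCone F := ⟨hξ.ne_zero t₀ ht₀, hξ.mem_hypersurface t₀ ht₀⟩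
  have hS0 : ∀ P : MvPolynomial (Fin d) ℂ, 0 ≤ cuboidNorm ξ c r P := fun _ => Real.sqrt_nonneg _
  obtain ⟨A, hA, hS⟩ := exists_norm_eval_le_of_isControlledAt hF hS0 (cuboidNorm_smul ξ c r) hz₀
    (hctrl.forall_mem (by omega) hn hF hX he hS0 hz₀)
  obtain ⟨C, Q, hC, hQ, hQC, hQV⟩ := exists_kernels (by omega) hn hF hX he hξc
    (fun t ht => hξ.mem_hypersurface t (hcD ht)) hA hS hΩ hV hFV hp
  obtain ⟨R, H, hR, hH, hsum, hle⟩ := exists_powerSeries hC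
    (P := fun m => MvPolynomial.map (starRingEnd ℂ) (Q m)) (fun m => (hQ m).map _)
    (fun m α => by
      rw [MvPolynomial.coeff_map, RCLike.norm_conj]
      exact hQC m α)
  obtain ⟨M₀, hM₀⟩ := (isCompact_cuboid c r).exists_bound_of_continuousOn hξc
  set M := max 1 M₀ with hM
  have hM1 : 1 ≤ M := le_max_left _ _
  have hMb : ∀ t ∈ cuboid c r, ‖ξ t‖ ≤ M := fun t ht => (hM₀ t ht).trans (le_max_right _ _)
  obtain ⟨q, R₁, hq⟩ := hV p hp
  obtain ⟨δ₁, hδ₁, hδ₁b⟩ : ∃ δ : ℝ, 0 < δ ∧ Metric.ball (0 : Fin d → ℝ) δ ⊆ Metric.eball 0 R₁ :=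
    Metric.mem_nhds_iff.1 (Metric.eball_mem_nhds _ hq.r_pos)
  obtain ⟨δ₂, hδ₂, hδ₂Ω⟩ := Metric.isOpen_iff.1 hΩ p hp
  have hd0 : (0 : ℝ) < d := by exact_mod_cast (by omega : 0 < d)
  set δ := min (min δ₁ δ₂) (R / (d * M ^ 2)) with hδ
  have hδ0 : 0 < δ := lt_min (lt_min hδ₁ hδ₂) (by positivity)
  have hsmall : ∀ x ∈ Metric.ball p δ, ∀ t ∈ cuboid c r,
      linForm (ξ t) (x - p) • star (ξ t) ∈ Metric.ball (0 : Fin d → ℂ) R := by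
    intro x hx t ht
    rw [Metric.mem_ball, dist_eq_norm] at hx
    have h1 : ‖x - p‖ < R / (d * M ^ 2) := hx.trans_le (min_le_right _ _)
    rw [lt_div_iff₀ (by positivity)] at h1
    rw [mem_ball_zero_iff, norm_smul, norm_star_pi]
    calc ‖linForm (ξ t) (x - p)‖ * ‖ξ t‖ ≤ d * (‖ξ t‖ * ‖x - p‖) * ‖ξ t‖ := by
          gcongr; exact norm_linForm_le _ _
      _ ≤ d * (M * ‖x - p‖) * M := by
          have := hMb t ht
          gcongr
      _ = ‖x - p‖ * (d * M ^ 2) := by ring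
      _ < R := h1
  -- the holomorphic function of `t` that agrees with the conjugate of `ξ` on the cuboid
  set ξbar : (Fin (d - 1) → ℂ) → (Fin d → ℂ) := fun t => star (ξ (c + star (t - c))) with hξbar
  have hξbar_eq : ∀ t ∈ cuboid c r, ξbar t = star (ξ t) := by
    rintro _ ⟨s, hs, rfl⟩
    rw [hξbar]
    simp only [shift_add_star_sub]
  have hξbar_an : ∀ t ∈ cuboid c r, AnalyticAt ℂ ξbar t := by
    rintro _ ⟨s, hs, rfl⟩
    have h1 : AnalyticAt ℂ (fun w => ξ (c + w)) (star (shift c s - c)) := by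
      refine AnalyticAt.fun_comp (g := ξ) ?_ (by fun_prop)
      rw [shift_add_star_sub]
      exact hξ.analytic _ (hcD (Set.mem_image_of_mem _ hs))
    exact AnalyticAt.fun_comp (g := fun w => star (ξ (c + star w))) (analyticAt_conj_conj h1)
      (by fun_prop)
  refine ⟨Metric.ball p δ, Metric.isOpen_ball, Metric.mem_ball_self hδ0,
    (Metric.ball_subset_ball ((min_le_left _ _).trans (min_le_right _ _))).trans hδ₂Ω, c, r,
    fun _ => by positivity, hcD,
    fun q => H ((q.1 - linForm (ξ q.2) p) • ξbar q.2), ?_, fun x hx => ?_⟩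
  · rintro _ ⟨x, hx, t, ht, rfl⟩
    refine AnalyticAt.fun_comp (g := H) (hH _ ?_) ?_
    · simp only
      rw [hξbar_eq t ht, ← linForm_sub]
      exact hsmall x hx t ht
    · have h1 : AnalyticAt ℂ (fun q : ℂ × (Fin (d - 1) → ℂ) => ξ q.2) (linForm (ξ t) x, t) :=
        (hξ.analytic t (hcD ht)).fun_comp (f := Prod.snd) analyticAt_snd
      have h2 : AnalyticAt ℂ (fun q : ℂ × (Fin (d - 1) → ℂ) => ξbar q.2) (linForm (ξ t) x, t) :=
        (hξbar_an t ht).fun_comp (f := Prod.snd) analyticAt_snd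
      refine (analyticAt_fst.sub ?_).smul h2
      unfold linForm
      refine Finset.analyticAt_fun_sum _ fun i _ => AnalyticAt.mul ?_ analyticAt_const
      exact ((ContinuousLinearMap.proj (R := ℂ) (φ := fun _ : Fin d => ℂ) i).analyticAt _).fun_comp h1
  · have hxp : x - p ∈ Metric.eball (0 : Fin d → ℝ) R₁ := by
      refine hδ₁b ?_
      rw [Metric.mem_ball, dist_eq_norm] at hx
      rw [mem_ball_zero_iff]
      exact hx.trans_le ((min_le_left _ _).trans (min_le_left _ _))
    have hV1 := hq.hasSum_iteratedFDeriv hxp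
    rw [add_sub_cancel] at hV1
    -- the plane wave of degree `m`
    set g : ℕ → (Fin (d - 1) → ℝ) → ℂ := fun m s =>
      star (MvPolynomial.eval (ξ (shift c s)) (Q m)) * linForm (ξ (shift c s)) (x - p) ^ m with hg
    have hg_eval : ∀ m s, g m s = MvPolynomial.eval
        (linForm (ξ (shift c s)) (x - p) • star (ξ (shift c s)))
          (MvPolynomial.map (starRingEnd ℂ) (Q m)) := by
      intro m s
      rw [eval_smul_of_isHomogeneous ((hQ m).map _), eval_star_map, mul_comm]
    have hvol : volume (Set.Icc (0 : Fin (d - 1) → ℝ) r) ≠ ⊤ := isCompact_Icc.measure_lt_top.ne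
    have hg_le : ∀ m, ∀ s ∈ Set.Icc (0 : Fin (d - 1) → ℝ) r, ‖g m s‖ ≤ C * (1 / 2) ^ m := by
      intro m s hs
      rw [hg_eval]
      exact hle _ (hsmall x hx _ (Set.mem_image_of_mem _ hs)) m
    have hg_int : ∀ m, Integrable (g m) (volume.restrict (Set.Icc 0 r)) := by
      intro m
      have h1 : ContinuousOn (fun s => ξ (shift c s)) (Set.Icc 0 r) :=
        hξc.comp (continuous_shift c).continuousOn (Set.mapsTo_image _ _)
      refine ContinuousOn.integrableOn_compact isCompact_Icc ?_
      refine ContinuousOn.mul ((continuous_eval (Q m)).comp_continuousOn h1).star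
        (ContinuousOn.pow ?_ m)
      refine continuousOn_finsetSum _ fun i _ => ContinuousOn.mul ?_ continuousOn_const
      exact (continuous_apply i).comp_continuousOn h1
    have hsummable : Summable fun m => ∫ s in Set.Icc 0 r, ‖g m s‖ := by
      refine Summable.of_nonneg_of_le (fun m => integral_nonneg fun s => norm_nonneg _)
        (fun m => ?_) ((summable_geometric_two.mul_left C).mul_right
          (volume.real (Set.Icc (0 : Fin (d - 1) → ℝ) r)))
      have h1 := norm_setIntegral_le_of_norm_le_const (f := fun s => ‖g m s‖)
        (C := C * (1 / 2) ^ m) hvol.lt_top (fun s hs => by rw [norm_norm]; exact hg_le m s hs)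
      exact (le_abs_self _).trans h1
    have h1 := hasSum_integral_of_summable_integral_norm hg_int hsummable
    have h2 : ∀ m, ∫ s in Set.Icc 0 r, g m s =
        (m.factorial : ℝ)⁻¹ • iteratedFDeriv ℝ m V p fun _ => x - p := by
      intro m
      rw [hg, hQV, Complex.real_smul]
      push_cast
      rfl
    simp only [h2] at h1
    rw [hV1.unique h1, cuboidIntegral]
    refine setIntegral_congr_fun measurableSet_Icc fun s hs => ?_
    have hs' : shift c s ∈ cuboid c r := Set.mem_image_of_mem _ hs
    simp only [hg_eval]
    rw [hξbar_eq _ hs', ← linForm_sub]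
    exact (hsum _ (hsmall x hx _ hs')).tsum_eq
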